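/- Let $R,\rho>0$ and let $N\ge 2$ be an integer with $\rho\le R\sin\frac{\pi}{N}$. Let $V\in L^2(0,\rho)$ be real-valued with $V\ge 0$ almost everywhere and $V$ not almost everywhere zero. For a set $Y$ of $N$ points on the circle of radius $R$ centred at the origin of $\mathbb{R}^2$ such that the open disks $B_\rho(y)$, $y\in Y$, do not overlap, i.e. $|y-y'|\ge 2\rho$ for distinct $y,y'\in Y$ (call such a $Y$ admissible), consider the Schrödinger operator $$H_{V,Y}=-\Delta-\sum_{y\in Y}V(|x-y|)\,\mathbf 1_{B_\rho(y)}(x)\qquad\text{in } L^2(\mathbb{R}^2),\quad D(H_{V,Y})=H^2(\mathbb{R}^2),$$ and put $\epsilon_1(H_{V,Y})=\inf\sigma(H_{V,Y})$. Then for every admissible $Y$ the number $\epsilon_1(H_{V,Y})$ is a negative eigenvalue of $H_{V,Y}$ and the minimum of its spectrum. The configurations in which all neighbouring points have the same angular distance $\frac{2\pi}{N}$, i.e. the sets $$\Big\{R\big(\cos(\alpha+\tfrac{2\pi k}{N}),\,\sin(\alpha+\tfrac{2\pi k}{N})\big):\ k=0,\dots,N-1\Big\},\qquad \alpha\in\mathbb{R},$$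 are admissible, and an admissible $Y$ maximizes $\epsilon_1(H_{V,\cdot})$ among all admissible configurations if and only if it is one of them. Thus, up to rotations, $\epsilon_1(H_{V,Y})$ is uniquely maximized by the equiangular configuration. -/

import Mathlib

open MeasureTheory TemperedDistribution FourierTransform
open scoped ENNReal SchwartzMap Laplacian

noncomputable section

namespace WellArray

/-- The Euclidean plane `ℝ²`. -/
abbrev Plane : Type := EuclideanSpace ℝ (Fin 2)

/-- The complex Hilbert space `L²(ℝ²)` with respect to Lebesgue measure. -/
abbrev L2 : Type := Lp ℂ 2 (volume : Measure Plane)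

/-! ### The Sobolev space `H²(ℝ²)` and the Laplacian on it -/

/-- The Sobolev space `H²(ℝ²)`, as a subspace of `L²(ℝ²)`. -/
def sobolevH2 : Submodule ℂ L2 where
  carrier := {u | MemSobolev 2 2 (u : 𝓢'(Plane, ℂ))}
  add_mem' := by
    intro u v hu hv
    have h := MemSobolev.add hu hv
    simp only [← Lp.toTemperedDistributionCLM_apply, ← map_add] at h
    exact h
  zero_mem' := by
    have h := memSobolev_fun_zero Plane ℂ 2 2
    rw [← map_zero (Lp.toTemperedDistributionCLM ℂ (volume : Measure Plane) 2)] at h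
    exact h
  smul_mem' := by
    intro c u hu
    have h := MemSobolev.smul c hu
    simp only [← Lp.toTemperedDistributionCLM_apply, ← map_smul] at h
    exact h

theorem exists_laplacian (u : sobolevH2) :
    ∃ f : L2, Δ ((u : L2) : 𝓢'(Plane, ℂ)) = (f : 𝓢'(Plane, ℂ)) := by
  have h : MemSobolev (2 - 2) 2 (Δ ((u : L2) : 𝓢'(Plane, ℂ))) := MemSobolev.laplacian u.2
  rw [sub_self, memSobolev_zero_iff] at h
  exact h

theorem toTemperedDistribution_injective {f g : L2}
    (h : (f : 𝓢'(Plane, ℂ)) = (g : 𝓢'(Plane, ℂ))) : f = g := by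
  have hker := Lp.ker_toTemperedDistributionCLM_eq_bot (F := ℂ)
    (μ := (volume : Measure Plane)) (p := 2)
  exact LinearMap.ker_eq_bot.mp hker h

/-- The distributional Laplacian `Δ u` of `u ∈ H²(ℝ²)`, as an element of `L²(ℝ²)`. -/
def laplacianH2 : sobolevH2 →ₗ[ℂ] L2 where
  toFun u := (exists_laplacian u).choose
  map_add' u v := by
    apply toTemperedDistribution_injective
    have h : Lp.toTemperedDistributionCLM ℂ (volume : Measure Plane) 2
        ((exists_laplacian u).choose + (exists_laplacian v).choose) =
        Δ ((u : L2) : 𝓢'(Plane, ℂ)) + Δ ((v : L2) : 𝓢'(Plane, ℂ)) := by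
      rw [map_add]
      exact congrArg₂ (· + ·) (exists_laplacian u).choose_spec.symm
        (exists_laplacian v).choose_spec.symm
    have h' : (((u + v : sobolevH2) : L2) : 𝓢'(Plane, ℂ)) =
        ((u : L2) : 𝓢'(Plane, ℂ)) + ((v : L2) : 𝓢'(Plane, ℂ)) :=
      map_add (Lp.toTemperedDistributionCLM ℂ (volume : Measure Plane) 2) (u : L2) (v : L2)
    rw [← (exists_laplacian (u + v)).choose_spec, h', ← laplacianCLM_apply, map_add, laplacianCLM_apply,
      laplacianCLM_apply]
    exact h.symm
  map_smul' c u := by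
    apply toTemperedDistribution_injective
    have h : Lp.toTemperedDistributionCLM ℂ (volume : Measure Plane) 2
        (c • (exists_laplacian u).choose) = c • Δ ((u : L2) : 𝓢'(Plane, ℂ)) := by
      rw [map_smul]
      exact congrArg (c • ·) (exists_laplacian u).choose_spec.symm
    have h' : (((c • u : sobolevH2) : L2) : 𝓢'(Plane, ℂ)) = c • ((u : L2) : 𝓢'(Plane, ℂ)) :=
      map_smul (Lp.toTemperedDistributionCLM ℂ (volume : Measure Plane) 2) c (u : L2)
    rw [← (exists_laplacian (c • u)).choose_spec, h', ← laplacianCLM_apply, map_smul, laplacianCLM_apply]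
    exact h.symm

/-- Functions in `H²(ℝ²)` are essentially bounded. -/
theorem memLp_top_of_mem_sobolevH2 {u : L2} (hu : u ∈ sobolevH2) :
    MemLp (u : Plane → ℂ) ∞ volume := by
  obtain ⟨v, hv⟩ := MemSobolev.fourier_memL1 (E := Plane) (F := ℂ) (s := 2)
    (by simp) hu
  have hb : MemLp (Real.Lp.fourierTransformInv v : Plane → ℂ) ∞ volume :=
    BoundedContinuousFunction.memLp_top _
  refine hb.ae_eq ?_
  rw [Filter.eventuallyEq_comm, ← sub_ae_eq_zero]
  apply ae_eq_zero_of_integral_contDiff_smul_eq_zero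
  · exact ((Lp.memLp u).locallyIntegrable (by norm_num)).sub (hb.locallyIntegrable (by simp))
  · intro g g_smooth g_cpt
    have hg₁ : HasCompactSupport (Complex.ofRealCLM ∘ g) := g_cpt.comp_left rfl
    have hg₂ : ContDiff ℝ (⊤ : ℕ∞) (Complex.ofRealCLM ∘ g) := by fun_prop
    set φ : 𝓢(Plane, ℂ) := hg₁.toSchwartzMap hg₂ with hφ
    have hφg : ∀ x, φ x = (g x : ℂ) := fun x => rfl
    have h1 : (u : 𝓢'(Plane, ℂ)) φ = ∫ x, φ x • u x := Lp.toTemperedDistribution_apply u φ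
    have h2 : (u : 𝓢'(Plane, ℂ)) φ = ∫ x, (𝓕⁻ φ) x • v x := by
      rw [← Lp.toTemperedDistribution_apply, ← hv]
      simp
    have h3 : ∫ x, (𝓕⁻ φ) x • v x = ∫ x, φ x • (Real.Lp.fourierTransformInv v) x := by
      have := VectorFourier.integral_fourierIntegral_smul_eq_flip (L := -innerₗ Plane)
        (e := Real.fourierChar) (μ := volume) (ν := volume) Real.continuous_fourierChar
        (by
          change Continuous fun p : Plane × Plane => -inner ℝ p.1 p.2
          fun_prop) φ.integrable (L1.integrable_coeFn v)
      refine Eq.trans ?_ (this.trans ?_)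
      · refine integral_congr_ae (Filter.Eventually.of_forall fun x => ?_)
        simp [SchwartzMap.fourierInv_coe, Real.fourierInv_eq, VectorFourier.fourierIntegral]
      · refine integral_congr_ae (Filter.Eventually.of_forall fun x => ?_)
        simp [Real.fourierInv_eq, VectorFourier.fourierIntegral, real_inner_comm]
    have hi1 : Integrable (fun x => φ x • u x) := (Lp.memLp u).smul (φ.memLp 2)
      |> memLp_one_iff_integrable.1
    have hi2 : Integrable (fun x => φ x • (Real.Lp.fourierTransformInv v) x) :=
      memLp_one_iff_integrable.1 (hb.smul (φ.memLp 1))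
    calc ∫ x, g x • ((u : Plane → ℂ) - (Real.Lp.fourierTransformInv v : Plane → ℂ)) x
        = ∫ x, (φ x • u x - φ x • (Real.Lp.fourierTransformInv v) x) := by
          congr with x
          simp [hφg, mul_sub]
      _ = 0 := by rw [integral_sub hi1 hi2, ← h3, ← h2, h1, sub_self]

/-! ### Schrödinger operators `-Δ + W` with `W ∈ L²(ℝ²)` -/

theorem memLp_mul_of_mem_sobolevH2 {W : Plane → ℝ} (hW : MemLp W 2 volume) (u : sobolevH2) :
    MemLp (fun x => (W x : ℂ) * (u : L2) x) 2 volume :=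
  (memLp_top_of_mem_sobolevH2 u.2).mul hW.ofReal

/-- Multiplication by the real function `W ∈ L²(ℝ²)`, as a linear map from `H²(ℝ²)` to `L²(ℝ²)`. -/
def potentialH2 (W : Plane → ℝ) (hW : MemLp W 2 volume) : sobolevH2 →ₗ[ℂ] L2 where
  toFun u := (memLp_mul_of_mem_sobolevH2 hW u).toLp _
  map_add' u v := by
    rw [← MemLp.toLp_add]
    apply MemLp.toLp_congr
    filter_upwards [Lp.coeFn_add (u : L2) (v : L2)] with x hx
    simp only [Submodule.coe_add, hx, Pi.add_apply, mul_add]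
  map_smul' c u := by
    rw [RingHom.id_apply, ← MemLp.toLp_const_smul]
    apply MemLp.toLp_congr
    filter_upwards [Lp.coeFn_smul c (u : L2)] with x hx
    simp only [Submodule.coe_smul, hx, Pi.smul_apply, smul_eq_mul]
    ring

/-- The Schrödinger operator `-Δ + W` in `L²(ℝ²)`, an unbounded operator with domain `H²(ℝ²)`. -/
def schrodinger (W : Plane → ℝ) (hW : MemLp W 2 volume) : L2 →ₗ.[ℂ] L2 where
  domain := sobolevH2
  toFun := -laplacianH2 + potentialH2 W hW

/-! ### Spectrum and ground state energy -/

/-- The resolvent set of an unbounded operator `T` : all `z` such that `T - z` is a bijection from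
the domain of `T` onto the whole space with a bounded everywhere defined inverse `S`. -/
def resolventSet (T : L2 →ₗ.[ℂ] L2) : Set ℂ :=
  {z | ∃ S : L2 →L[ℂ] L2,
    (∀ f : L2, ∃ h : S f ∈ T.domain, T ⟨S f, h⟩ - z • S f = f) ∧
    (∀ u : T.domain, S (T u - z • (u : L2)) = u)}

/-- The real points of the spectrum of an unbounded operator
(the whole spectrum if the operator is self-adjoint). -/
def realSpectrum (T : L2 →ₗ.[ℂ] L2) : Set ℝ :=
  {E | (E : ℂ) ∉ resolventSet T}

/-- `E` is an eigenvalue of the unbounded operator `T`. -/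
def IsEigenvalue (T : L2 →ₗ.[ℂ] L2) (E : ℝ) : Prop :=
  ∃ u : T.domain, (u : L2) ≠ 0 ∧ T u = (E : ℂ) • (u : L2)

/-! ### Arrays of radial wells -/

/-- The potential `V_Y(x) = ∑_{y ∈ Y} V(|x - y|) 1_{B_ρ(y)}(x)`. -/
def arrayPotential (V : ℝ → ℝ) (ρ : ℝ) (Y : Finset Plane) (x : Plane) : ℝ :=
  ∑ y ∈ Y, (Metric.ball y ρ).indicator (fun x => V (dist x y)) x

theorem memLp_well {V : ℝ → ℝ} {ρ : ℝ} (hV : MemLp V 2 (volume.restrict (Set.Ioo 0 ρ)))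
    (y : Plane) :
    MemLp ((Metric.ball y ρ).indicator (fun x => V (dist x y))) 2 volume := by
  have key : ∀ {f : ℝ → ℝ}, IntegrableOn f (Set.Ioo 0 ρ) volume →
      IntegrableOn (fun x : Plane => f ‖x‖) (Metric.ball 0 ρ) volume := by
    intro f hf
    rw [integrableOn_fun_norm_addHaar]
    have hb : ∀ᵐ r ∂(volume.restrict (Set.Ioo (0 : ℝ) ρ)),
        ‖r ^ (Module.finrank ℝ Plane - 1)‖ ≤ ρ := by
      filter_upwards [ae_restrict_mem measurableSet_Ioo] with r hr
      simpa [abs_of_pos hr.1] using hr.2.le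
    exact hf.bdd_mul (by fun_prop) hb
  have h1 : IntegrableOn (fun x : Plane => V ‖x‖) (Metric.ball 0 ρ) volume :=
    key (hV.integrable (by norm_num))
  have h2 : IntegrableOn (fun x : Plane => V ‖x‖ ^ 2) (Metric.ball 0 ρ) volume :=
    key (f := fun r => V r ^ 2) hV.integrable_sq
  have h3 : MemLp ((Metric.ball (0 : Plane) ρ).indicator (fun x => V ‖x‖)) 2 volume := by
    rw [memLp_indicator_iff_restrict measurableSet_ball]
    exact (memLp_two_iff_integrable_sq h1.aestronglyMeasurable).2 h2
  have h4 := h3.comp_measurePreserving (measurePreserving_sub_right volume y)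
  convert h4 using 1
  ext x
  simp [Set.indicator, dist_eq_norm]

theorem memLp_arrayPotential {V : ℝ → ℝ} {ρ : ℝ}
    (hV : MemLp V 2 (volume.restrict (Set.Ioo 0 ρ))) (Y : Finset Plane) :
    MemLp (arrayPotential V ρ Y) 2 volume :=
  memLp_finsetSum Y fun y _ => memLp_well hV y

/-- The Hamiltonian `H_{V,Y} = -Δ - V_Y` with domain `H²(ℝ²)`. -/
def hamiltonian {V : ℝ → ℝ} {ρ : ℝ} (hV : MemLp V 2 (volume.restrict (Set.Ioo 0 ρ)))
    (Y : Finset Plane) : L2 →ₗ.[ℂ] L2 :=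
  schrodinger (-arrayPotential V ρ Y) (memLp_arrayPotential hV Y).neg

/-- The ground state energy `ε₁(H_{V,Y}) = inf σ(H_{V,Y})`. -/
def groundEnergy {V : ℝ → ℝ} {ρ : ℝ} (hV : MemLp V 2 (volume.restrict (Set.Ioo 0 ρ)))
    (Y : Finset Plane) : ℝ :=
  sInf (realSpectrum (hamiltonian hV Y))

/-- `Y` consists of `N` points on the circle of radius `R` about the origin, and the open disks of
radius `ρ` centred at these points do not overlap. -/
structure IsCircleArray (N : ℕ) (R ρ : ℝ) (Y : Finset Plane) : Prop where
  card_eq : Y.card = N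
  norm_eq : ∀ y ∈ Y, ‖y‖ = R
  two_mul_le_dist : ∀ y ∈ Y, ∀ y' ∈ Y, y ≠ y' → 2 * ρ ≤ dist y y'

/-- The point of the plane with polar coordinates `(R, θ)`. -/
def polarPoint (R θ : ℝ) : Plane := !₂[R * Real.cos θ, R * Real.sin θ]

/-- `Y` is the set of `N` points on the circle of radius `R` in which neighbouring points have
angular distance `2π / N`; the angle `α` fixes the position of this set up to rotation. -/
def IsEquiangular (N : ℕ) (R : ℝ) (Y : Finset Plane) : Prop :=
  ∃ α : ℝ, (Y : Set Plane) =
    Set.range fun k : Fin N => polarPoint R (α + 2 * Real.pi * (k : ℕ) / N)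

end WellArray

end

noncomputable section

namespace WellArray

open Set Metric

/-! ### The Fourier side -/

/-! The spectral problem is first made variational. Write `q` for the array potential and `G = (-Δ +
κ²)⁻¹`. Since `-Δ - q + κ² = (1 - qG)(-Δ + κ²)`, energies `-κ²` are governed by the Birman-Schwinger
comparison of `⟨qw, G qw⟩` with `∫ q w²` over bounded `w`. If the former is at least the latter for
some `w` with `qw ≠ 0`, the ground energy is at most `-κ²`, and it is smaller if the inequality is
strict (`trial_estimate`, `groundEnergy_le`, `groundEnergy_lt`). Conversely, the modulus of a ground
state of energy `-κ²` attains equality (`exists_integral_le_kernForm`, `kernForm_le_of_isLeast`). In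
the plane the kernel of `G` diverges as `κ → 0`, so `w = 1` already gives a negative energy; `qG` is
compact, so that energy is an eigenvalue (`groundEnergy_neg`, `isEigenvalue_schrodinger`).

Now let `Y₀` be equiangular with energy `-κ²`. Summing its optimal `w` over the symmetries of `Y₀`
keeps it optimal, and afterwards `qw` consists of `N` rotated copies of one nonnegative density `f`,
supported in the disk about `(R, 0)` and symmetric in the first axis (`exists_symmetric_profile`).
Place the same copies on the disks of another admissible `Y`. Because the disks are disjoint, `∫ q
w²` does not change, while `⟨qw, G qw⟩` becomes `∑ F(θ_j - θ_i)`, where `F = angForm κ f` is the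
interaction of two copies as a function of their angular distance. If `F` is strictly convex on the
admissible angular distances, Jensen's inequality for the `k`-th neighbours, whose angular distances
always sum to `2πk`, shows that the sum is smallest for equal gaps, and only there
(`mul_le_sum_angle`, `mul_lt_sum_angle`). Hence `Y` has energy at most `-κ²`, with strict inequality
unless it is equiangular (`groundEnergy_le_and_lt`).

The heart is the convexity of `F`. As `f` is reflection symmetric, its copy at angular distance `2β`
is also its mirror image in a line which the disk does not meet. Between a point and a mirror image
the resolvent kernel factorizes into an integral over a rapidity `s` of exponential solutions of `Δu
= κ²u` (`kern_sub_rot_mirror`), so `F(2β)` is a squared `L²` norm in `s` (`angForm_two_mul`). The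
angle enters only as the imaginary shift `s + iβ`, which the Fourier transform in `s` turns into the
factor `exp(-2πpβ)` (`fourier_waveTrace`). Thus `F(θ) = (4π)⁻¹ ∫ exp(-2πpθ) |A(p)|² dp` with `A`
independent of `θ`: a superposition of exponentials. -/

theorem ae_eq_of_forall_schwartz {E : Type*} [NormedAddCommGroup E] [InnerProductSpace ℝ E]
    [FiniteDimensional ℝ E] [MeasurableSpace E] [BorelSpace E] {f g : E → ℂ} (hf : LocallyIntegrable f)
    (hg : LocallyIntegrable g) (hfi : ∀ φ : 𝓢(E, ℂ), Integrable (fun x => φ x * f x))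
    (hgi : ∀ φ : 𝓢(E, ℂ), Integrable (fun x => φ x * g x))
    (h : ∀ φ : 𝓢(E, ℂ), ∫ x, φ x * f x = ∫ x, φ x * g x) : f =ᵐ[volume] g := by
  rw [← sub_ae_eq_zero]
  apply ae_eq_zero_of_integral_contDiff_smul_eq_zero (hf.sub hg)
  intro η hη hηc
  have h1 : HasCompactSupport (Complex.ofRealCLM ∘ η) := hηc.comp_left rfl
  have h2 : ContDiff ℝ (⊤ : ℕ∞) (Complex.ofRealCLM ∘ η) := by fun_prop
  set φ : 𝓢(E, ℂ) := h1.toSchwartzMap h2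
  have hφ : ∀ x, φ x = (η x : ℂ) := fun x => rfl
  calc ∫ x, η x • (f - g) x = ∫ x, (φ x * f x - φ x * g x) := by
        congr with x
        simp [hφ, mul_sub]
    _ = 0 := by rw [integral_sub (hfi φ) (hgi φ), h, sub_self]

theorem integrable_schwartz_mul {E : Type*} [NormedAddCommGroup E] [InnerProductSpace ℝ E]
    [FiniteDimensional ℝ E] [MeasurableSpace E] [BorelSpace E] (φ : 𝓢(E, ℂ))
    (f : Lp ℂ 2 (volume : Measure E)) :
    Integrable (fun x => φ x * f x) :=
  memLp_one_iff_integrable.1 ((Lp.memLp f).mul (φ.memLp 2))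

/-- Dictionary between multiplication of distributions and pointwise multiplication. Through it
membership in `H²` and the distributional Laplacian become almost everywhere statements about
Fourier transforms. -/
theorem smulLeftCLM_coe_iff {p : Plane → ℂ} (hp : p.HasTemperateGrowth) {f h : L2} :
    smulLeftCLM ℂ p (f : 𝓢'(Plane, ℂ)) = (h : 𝓢'(Plane, ℂ)) ↔
      (h : Plane → ℂ) =ᵐ[volume] fun x => p x * f x := by
  have key : ∀ φ : 𝓢(Plane, ℂ), smulLeftCLM ℂ p (f : 𝓢'(Plane, ℂ)) φ =
      ∫ x, φ x * (p x * f x) := fun φ => by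
    rw [smulLeftCLM_apply_apply, Lp.toTemperedDistribution_apply]
    refine integral_congr_ae (.of_forall fun x => ?_)
    simp [SchwartzMap.smulLeftCLM_apply_apply hp]
    ring
  have key2 : ∀ φ : 𝓢(Plane, ℂ), (h : 𝓢'(Plane, ℂ)) φ = ∫ x, φ x * h x := fun φ =>
    Lp.toTemperedDistribution_apply h φ
  constructor
  · intro e
    refine ae_eq_of_forall_schwartz ((Lp.memLp h).locallyIntegrable (by norm_num)) ?_
      (fun φ => integrable_schwartz_mul φ h) (fun φ => ?_) (fun φ => ?_)
    · have := ((Lp.memLp f).locallyIntegrable (by norm_num))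
      rw [← locallyIntegrableOn_univ] at this ⊢
      exact this.continuousOn_mul hp.1.continuous.continuousOn isOpen_univ.isLocallyClosed
    · have := integrable_schwartz_mul (SchwartzMap.smulLeftCLM ℂ p φ) f
      refine this.congr (.of_forall fun x => ?_)
      simp [SchwartzMap.smulLeftCLM_apply_apply hp]
      ring
    · rw [← key, ← key2, e]
  · intro e
    ext φ
    rw [key, key2]
    refine integral_congr_ae ?_
    filter_upwards [e] with x hx
    rw [hx]

/-- The Fourier transform on `L²(ℝ²)` as a unitary operator. -/
abbrev fourierL2 : L2 ≃ₗᵢ[ℂ] L2 := Lp.fourierTransformₗᵢ Plane ℂ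

theorem fourier_coe (f : L2) : 𝓕 (f : 𝓢'(Plane, ℂ)) = (fourierL2 f : 𝓢'(Plane, ℂ)) :=
  Lp.fourier_toTemperedDistribution_eq f

theorem mem_sobolevH2_iff {u : L2} : u ∈ sobolevH2 ↔
    ∃ h : L2, (h : Plane → ℂ) =ᵐ[volume] fun x => (((1 + ‖x‖ ^ 2 : ℝ)) : ℂ) * fourierL2 u x := by
  change MemSobolev 2 2 (u : 𝓢'(Plane, ℂ)) ↔ _
  rw [memSobolev_iff_exists_smulLeftCLM_fourier, fourier_coe]
  refine exists_congr fun h => ?_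
  rw [smulLeftCLM_coe_iff (by fun_prop)]
  simp

theorem fourier_laplacianH2 (u : sobolevH2) : (fourierL2 (laplacianH2 u) : Plane → ℂ) =ᵐ[volume]
    fun x => ((-((2 * Real.pi) ^ 2 * ‖x‖ ^ 2) : ℝ) : ℂ) * fourierL2 (u : L2) x := by
  have h1 : Δ ((u : L2) : 𝓢'(Plane, ℂ)) = (laplacianH2 u : 𝓢'(Plane, ℂ)) :=
    (exists_laplacian u).choose_spec
  rw [← smulLeftCLM_coe_iff (by fun_prop), ← fourier_coe, ← fourier_coe, ← h1,
    laplacian_eq_fourierMultiplierCLM, fourierMultiplierCLM_apply]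
  have : (fun x : Plane => ((-((2 * Real.pi) ^ 2 * ‖x‖ ^ 2) : ℝ) : ℂ)) =
    ((-(2 * Real.pi) ^ 2 : ℝ) : ℂ) • (fun x : Plane => ((‖x‖ ^ 2 : ℝ) : ℂ)) := by
    ext x; simp
  rw [this, smulLeftCLM_smul (by fun_prop)]
  rw [← Complex.coe_smul, FourierTransform.fourier_smul, fourier_fourierInv_eq]
  rfl

/-! ### The free resolvent -/

/-- The Fourier symbol of `(-Δ + κ²)⁻¹`. -/
def symbol (κ : ℝ) (ξ : Plane) : ℝ := (κ ^ 2 + (2 * Real.pi) ^ 2 * ‖ξ‖ ^ 2)⁻¹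

theorem symbol_den_pos {κ : ℝ} (hκ : 0 < κ) (ξ : Plane) :
    0 < κ ^ 2 + (2 * Real.pi) ^ 2 * ‖ξ‖ ^ 2 := by positivity

theorem symbol_pos {κ : ℝ} (hκ : 0 < κ) (ξ : Plane) : 0 < symbol κ ξ :=
  inv_pos.2 (symbol_den_pos hκ ξ)

theorem symbol_le {κ : ℝ} (hκ : 0 < κ) (ξ : Plane) : symbol κ ξ ≤ (κ ^ 2)⁻¹ := by
  unfold symbol
  gcongr
  have : 0 ≤ (2 * Real.pi) ^ 2 * ‖ξ‖ ^ 2 := by positivity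
  linarith

theorem continuous_symbol {κ : ℝ} (hκ : 0 < κ) : Continuous (symbol κ) := by
  unfold symbol
  exact Continuous.inv₀ (by fun_prop) fun ξ => (symbol_den_pos hκ ξ).ne'

theorem memLp_top_symbol {κ : ℝ} (hκ : 0 < κ) :
    MemLp (fun ξ => (symbol κ ξ : ℂ)) ∞ (volume : Measure Plane) := by
  refine memLp_top_of_bound (C := (κ ^ 2)⁻¹) ?_ (.of_forall fun ξ => ?_)
  · exact (Complex.continuous_ofReal.comp (continuous_symbol hκ)).aestronglyMeasurable
  · rw [Complex.norm_real, Real.norm_of_nonneg (symbol_pos hκ ξ).le]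
    exact symbol_le hκ ξ

/-- Multiplication by the symbol on `L²(ℝ²)`. -/
def symbolMul (κ : ℝ) (hκ : 0 < κ) : L2 →L[ℂ] L2 :=
  (ContinuousLinearMap.mul ℂ ℂ).holderL volume ∞ 2 2 (memLp_top_symbol hκ).toLp

theorem symbolMul_apply {κ : ℝ} (hκ : 0 < κ) (f : L2) :
    (symbolMul κ hκ f : Plane → ℂ) =ᵐ[volume] fun ξ => symbol κ ξ * f ξ := by
  have h := ContinuousLinearMap.coeFn_holder (r := 2) (ContinuousLinearMap.mul ℂ ℂ)
    (memLp_top_symbol hκ).toLp f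
  filter_upwards [h, (memLp_top_symbol hκ).coeFn_toLp] with x hx hx'
  simp only [symbolMul, ContinuousLinearMap.holderL_apply_apply]
  rw [hx, hx']
  simp

/-- The free resolvent `(-Δ + κ²)⁻¹` on `L²(ℝ²)`. -/
def freeRes (κ : ℝ) (hκ : 0 < κ) : L2 →L[ℂ] L2 :=
  (fourierL2.symm : L2 →L[ℂ] L2) ∘L symbolMul κ hκ ∘L (fourierL2 : L2 →L[ℂ] L2)

theorem fourier_freeRes {κ : ℝ} (hκ : 0 < κ) (f : L2) :
    (fourierL2 (freeRes κ hκ f) : Plane → ℂ) =ᵐ[volume] fun ξ => symbol κ ξ * fourierL2 f ξ := by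
  have : fourierL2 (freeRes κ hκ f) = symbolMul κ hκ (fourierL2 f) := by
    simp [freeRes]
  rw [this]
  exact symbolMul_apply hκ _

theorem freeRes_mem {κ : ℝ} (hκ : 0 < κ) (f : L2) : freeRes κ hκ f ∈ sobolevH2 := by
  rw [mem_sobolevH2_iff]
  have hb : MemLp (fun ξ : Plane => (((1 + ‖ξ‖ ^ 2) * symbol κ ξ : ℝ) : ℂ)) ∞ volume := by
    refine memLp_top_of_bound (C := 1 + (κ ^ 2)⁻¹) ?_ (.of_forall fun ξ => ?_)
    · have := continuous_symbol hκ
      exact Continuous.aestronglyMeasurable (by fun_prop)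
    · have h0 := symbol_pos hκ ξ
      rw [Complex.norm_real, Real.norm_of_nonneg (by positivity), add_mul, one_mul, add_comm]
      gcongr ?_ + ?_
      · rw [symbol, ← div_eq_mul_inv, div_le_one (symbol_den_pos hκ ξ)]
        have : 1 ≤ (2 * Real.pi) ^ 2 := by nlinarith [Real.pi_gt_three]
        nlinarith [sq_nonneg κ, sq_nonneg ‖ξ‖]
      · exact symbol_le hκ ξ
  refine ⟨((Lp.memLp (fourierL2 f)).mul hb (r := 2)).toLp, ?_⟩
  filter_upwards [((Lp.memLp (fourierL2 f)).mul hb (r := 2)).coeFn_toLp, fourier_freeRes hκ f]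
    with x hx hx'
  rw [hx, hx']
  simp
  ring

/-- The free resolvent as a map into `H²(ℝ²)`. -/
def freeResH2 (κ : ℝ) (hκ : 0 < κ) (f : L2) : sobolevH2 := ⟨freeRes κ hκ f, freeRes_mem hκ f⟩

theorem helmholtz_freeRes {κ : ℝ} (hκ : 0 < κ) (f : L2) :
    -laplacianH2 (freeResH2 κ hκ f) + ((κ ^ 2 : ℝ) : ℂ) • freeRes κ hκ f = f := by
  apply fourierL2.injective
  apply Lp.ext
  rw [map_add, map_neg, map_smul]
  filter_upwards [Lp.coeFn_add (-fourierL2 (laplacianH2 (freeResH2 κ hκ f)))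
    (((κ ^ 2 : ℝ) : ℂ) • fourierL2 (freeRes κ hκ f)), Lp.coeFn_neg (fourierL2 (laplacianH2 (freeResH2 κ hκ f))),
    Lp.coeFn_smul ((κ ^ 2 : ℝ) : ℂ) (fourierL2 (freeRes κ hκ f)),
    fourier_laplacianH2 (freeResH2 κ hκ f), fourier_freeRes hκ f] with x h1 h2 h3 h4 h5
  rw [h1, Pi.add_apply, h2, Pi.neg_apply, h3, Pi.smul_apply, h4]
  change -(_ * fourierL2 (freeRes κ hκ f) x) + _ = _
  rw [h5]
  have h6 : (((κ ^ 2 + (2 * Real.pi) ^ 2 * ‖x‖ ^ 2) * symbol κ x : ℝ) : ℂ) = 1 := by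
    rw [symbol, mul_inv_cancel₀ (symbol_den_pos hκ x).ne', Complex.ofReal_one]
  push_cast at h6 ⊢
  rw [smul_eq_mul]
  linear_combination (fourierL2 f x) * h6

theorem freeRes_helmholtz {κ : ℝ} (hκ : 0 < κ) (u : sobolevH2) :
    freeRes κ hκ (-laplacianH2 u + ((κ ^ 2 : ℝ) : ℂ) • (u : L2)) = u := by
  apply fourierL2.injective
  apply Lp.ext
  refine (fourier_freeRes hκ _).trans ?_
  rw [map_add, map_neg, map_smul]
  filter_upwards [Lp.coeFn_add (-fourierL2 (laplacianH2 u))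
    (((κ ^ 2 : ℝ) : ℂ) • fourierL2 (u : L2)), Lp.coeFn_neg (fourierL2 (laplacianH2 u)),
    Lp.coeFn_smul ((κ ^ 2 : ℝ) : ℂ) (fourierL2 (u : L2)),
    fourier_laplacianH2 u] with x h1 h2 h3 h4
  rw [h1, Pi.add_apply, h2, Pi.neg_apply, h3, Pi.smul_apply, h4]
  have h6 : (((κ ^ 2 + (2 * Real.pi) ^ 2 * ‖x‖ ^ 2) * symbol κ x : ℝ) : ℂ) = 1 := by
    rw [symbol, mul_inv_cancel₀ (symbol_den_pos hκ x).ne', Complex.ofReal_one]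
  push_cast at h6 ⊢
  rw [smul_eq_mul]
  linear_combination (fourierL2 (u : L2) x) * h6

theorem inner_eq_integral (f g : L2) : inner ℂ f g = ∫ x, g x * (starRingEnd ℂ) (f x) := rfl

theorem inner_freeRes_eq {κ : ℝ} (hκ : 0 < κ) (f g : L2) :
    inner ℂ (freeRes κ hκ f) g =
      ∫ ξ, (symbol κ ξ : ℂ) * (fourierL2 g ξ * (starRingEnd ℂ) (fourierL2 f ξ)) := by
  rw [← fourierL2.inner_map_map, inner_eq_integral]
  refine integral_congr_ae ?_
  filter_upwards [fourier_freeRes hκ f] with x hx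
  rw [hx]
  simp
  ring

theorem inner_laplacianH2_symm (u v : sobolevH2) :
    inner ℂ (laplacianH2 u) (v : L2) = inner ℂ (u : L2) (laplacianH2 v) := by
  rw [← fourierL2.inner_map_map, ← fourierL2.inner_map_map (u : L2), inner_eq_integral,
    inner_eq_integral]
  refine integral_congr_ae ?_
  filter_upwards [fourier_laplacianH2 u, fourier_laplacianH2 v] with x hu hv
  rw [hu, hv, map_mul, Complex.conj_ofReal]
  ring

/-- Both sides pair equally with every Schwartz function: the transform moves onto the test
function, on the left because `L²` and distributional transforms agree, on the right by Fubini. -/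
theorem fourierTransformₗᵢ_ae_eq {E : Type*} [NormedAddCommGroup E] [InnerProductSpace ℝ E]
    [FiniteDimensional ℝ E] [MeasurableSpace E] [BorelSpace E] (h : Lp ℂ 2 (volume : Measure E))
    (hi : Integrable h) :
    (Lp.fourierTransformₗᵢ E ℂ h : E → ℂ) =ᵐ[volume] 𝓕 (h : E → ℂ) := by
  have hL : Continuous fun p : E × E => innerₗ E p.1 p.2 := by
    change Continuous fun p : E × E => inner ℝ p.1 p.2
    fun_prop
  have hc : Continuous (𝓕 (h : E → ℂ)) :=
    VectorFourier.fourierIntegral_continuous Real.continuous_fourierChar hL hi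
  have hb : ∀ w, ‖𝓕 (h : E → ℂ) w‖ ≤ ∫ x, ‖h x‖ := fun w =>
    VectorFourier.norm_fourierIntegral_le_integral_norm _ _ _ _ _
  refine ae_eq_of_forall_schwartz ((Lp.memLp _).locallyIntegrable (by norm_num))
    hc.locallyIntegrable (fun φ => integrable_schwartz_mul φ _) (fun φ => ?_) (fun φ => ?_)
  · exact φ.integrable.mul_bdd (c := ∫ x, ‖h x‖) hc.aestronglyMeasurable (.of_forall hb)
  · have h1 : (Lp.fourierTransformₗᵢ E ℂ h : 𝓢'(E, ℂ)) φ = ∫ x, φ x * Lp.fourierTransformₗᵢ E ℂ h x :=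
      Lp.toTemperedDistribution_apply _ φ
    have h2 : (h : 𝓢'(E, ℂ)) (𝓕 φ) = ∫ x, (𝓕 φ) x * h x :=
      Lp.toTemperedDistribution_apply _ (𝓕 φ)
    have h3 : (Lp.fourierTransformₗᵢ E ℂ h : 𝓢'(E, ℂ)) = 𝓕 (h : 𝓢'(E, ℂ)) :=
      (Lp.fourier_toTemperedDistribution_eq h).symm
    rw [← h1, h3, TemperedDistribution.fourier_apply, h2]
    have := VectorFourier.integral_fourierIntegral_smul_eq_flip (L := innerₗ E)
        (e := Real.fourierChar) (μ := volume) (ν := volume) Real.continuous_fourierChar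
        hL φ.integrable hi
    simp only [smul_eq_mul] at this
    refine Eq.trans ?_ (this.trans ?_)
    · simp [SchwartzMap.fourier_coe, Real.fourier_eq, VectorFourier.fourierIntegral]
    · simp [Real.fourier_eq, VectorFourier.fourierIntegral, real_inner_comm]

theorem fourierL2_ae_eq (h : L2) (hi : Integrable h) :
    (fourierL2 h : Plane → ℂ) =ᵐ[volume] 𝓕 (h : Plane → ℂ) :=
  fourierTransformₗᵢ_ae_eq h hi

/-- Plancherel's theorem for functions in `L¹ ∩ L²`. -/
theorem integral_norm_sq_fourier_eq {E : Type*} [NormedAddCommGroup E] [InnerProductSpace ℝ E]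
    [FiniteDimensional ℝ E] [MeasurableSpace E] [BorelSpace E] {h : E → ℂ} (hi : Integrable h)
    (h2 : MemLp h 2 volume) :
    MemLp (𝓕 h) 2 volume ∧ ∫ ξ, ‖𝓕 h ξ‖ ^ 2 = ∫ x, ‖h x‖ ^ 2 := by
  have hi' : Integrable (h2.toLp : E → ℂ) := hi.congr h2.coeFn_toLp.symm
  have h3 : 𝓕 (h2.toLp : E → ℂ) = 𝓕 h := by
    ext ξ
    rw [Real.fourier_eq, Real.fourier_eq]
    refine integral_congr_ae ?_
    filter_upwards [h2.coeFn_toLp] with x hx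
    rw [hx]
  have h4 := fourierTransformₗᵢ_ae_eq h2.toLp hi'
  rw [h3] at h4
  refine ⟨(Lp.memLp _).ae_eq h4, ?_⟩
  have h5 : ∀ g : Lp ℂ 2 (volume : Measure E), ∫ x, ‖g x‖ ^ 2 = ‖g‖ ^ 2 := fun g => by
    rw [← inner_self_eq_norm_sq (𝕜 := ℂ), L2.inner_def]
    simp only [inner_self_eq_norm_sq_to_K]
    rw [← integral_re]
    · simp [← Complex.ofReal_pow]
    · exact_mod_cast (L2.integrable_inner g g).congr (.of_forall fun x => by
        simp)
  calc ∫ ξ, ‖𝓕 h ξ‖ ^ 2 = ∫ ξ, ‖Lp.fourierTransformₗᵢ E ℂ h2.toLp ξ‖ ^ 2 :=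
        integral_congr_ae (by filter_upwards [h4] with x hx; rw [hx])
    _ = ∫ x, ‖(h2.toLp : E → ℂ) x‖ ^ 2 := by
        rw [h5, h5, LinearIsometryEquiv.norm_map]
    _ = ∫ x, ‖h x‖ ^ 2 :=
        integral_congr_ae (by filter_upwards [h2.coeFn_toLp] with x hx; rw [hx])

theorem fourierL2_symm_ae_eq (h : L2) (hi : Integrable h) :
    (fourierL2.symm h : Plane → ℂ) =ᵐ[volume] 𝓕⁻ (h : Plane → ℂ) := by
  have hL : Continuous fun p : Plane × Plane => (-innerₗ Plane) p.1 p.2 := by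
    change Continuous fun p : Plane × Plane => -inner ℝ p.1 p.2
    fun_prop
  have heq : 𝓕⁻ (h : Plane → ℂ) =
      VectorFourier.fourierIntegral Real.fourierChar volume (-innerₗ Plane) h := by
    ext w
    simp [Real.fourierInv_eq, VectorFourier.fourierIntegral]
  have hc : Continuous (𝓕⁻ (h : Plane → ℂ)) := by
    rw [heq]
    exact VectorFourier.fourierIntegral_continuous Real.continuous_fourierChar hL hi
  have hb : ∀ w, ‖𝓕⁻ (h : Plane → ℂ) w‖ ≤ ∫ x, ‖h x‖ := fun w => by
    rw [heq]
    exact VectorFourier.norm_fourierIntegral_le_integral_norm _ _ _ _ _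
  refine ae_eq_of_forall_schwartz ((Lp.memLp _).locallyIntegrable (by norm_num))
    hc.locallyIntegrable (fun φ => integrable_schwartz_mul φ _) (fun φ => ?_) (fun φ => ?_)
  · exact φ.integrable.mul_bdd (c := ∫ x, ‖h x‖) hc.aestronglyMeasurable (.of_forall hb)
  · have h1 : (fourierL2.symm h : 𝓢'(Plane, ℂ)) φ = ∫ x, φ x * fourierL2.symm h x :=
      Lp.toTemperedDistribution_apply _ φ
    have h2 : (h : 𝓢'(Plane, ℂ)) (𝓕⁻ φ) = ∫ x, (𝓕⁻ φ) x * h x :=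
      Lp.toTemperedDistribution_apply _ (𝓕⁻ φ)
    have h3 : 𝓕⁻ (h : 𝓢'(Plane, ℂ)) = (fourierL2.symm h : 𝓢'(Plane, ℂ)) :=
      Lp.fourierInv_toTemperedDistribution_eq h
    rw [← h1, ← h3, TemperedDistribution.fourierInv_apply, h2]
    have := VectorFourier.integral_fourierIntegral_smul_eq_flip (L := -innerₗ Plane)
        (e := Real.fourierChar) (μ := volume) (ν := volume) Real.continuous_fourierChar
        hL φ.integrable hi
    simp only [smul_eq_mul] at this
    refine Eq.trans ?_ (this.trans ?_)
    · simp [SchwartzMap.fourierInv_coe, Real.fourierInv_eq, VectorFourier.fourierIntegral]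
    · simp [Real.fourierInv_eq, VectorFourier.fourierIntegral, real_inner_comm]

/-! ### Square integrability of the symbol -/

/-- The exponent `3/4` is a compromise: its double `3/2` exceeds half of twice the dimension needed
for integrability in the plane, namely `1`, and a power `1/4` of the symbol is left over to produce
decay in `κ`. -/
theorem memLp_bracket : MemLp (fun ξ : Plane => (1 + ‖ξ‖ ^ 2) ^ (-(3 / 4 : ℝ))) 2 volume := by
  have hc : Continuous fun ξ : Plane => (1 + ‖ξ‖ ^ 2) ^ (-(3 / 4 : ℝ)) :=
    Continuous.rpow_const (by fun_prop) fun ξ => Or.inl (by positivity)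
  rw [memLp_two_iff_integrable_sq hc.aestronglyMeasurable]
  have h := integrable_rpow_neg_one_add_norm_sq (E := Plane) (μ := volume) (r := 3) (by
    simp; norm_num)
  refine h.congr (.of_forall fun ξ => ?_)
  simp only
  rw [← Real.rpow_mul_natCast (by positivity)]
  norm_num

theorem symbol_le_bracket {κ : ℝ} (hκ : 0 < κ) (ξ : Plane) :
    symbol κ ξ ≤ (min (κ ^ 2) 1)⁻¹ * (1 + ‖ξ‖ ^ 2) ^ (-(3 / 4 : ℝ)) := by
  have h1 : (1 + ‖ξ‖ ^ 2) ^ (-(1 : ℝ)) ≤ (1 + ‖ξ‖ ^ 2) ^ (-(3 / 4 : ℝ)) :=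
    Real.rpow_le_rpow_of_exponent_le (by nlinarith [sq_nonneg ‖ξ‖]) (by norm_num)
  rw [Real.rpow_neg_one] at h1
  have hm : 0 < min (κ ^ 2) 1 := lt_min (by positivity) one_pos
  refine le_trans ?_ (mul_le_mul_of_nonneg_left h1 (inv_pos.2 hm).le)
  rw [← mul_inv, symbol]
  gcongr
  have h2 := min_le_left (κ ^ 2) 1
  have h3 := min_le_right (κ ^ 2) 1
  have h4 : 1 ≤ (2 * Real.pi) ^ 2 := by nlinarith [Real.pi_gt_three]
  nlinarith [sq_nonneg ‖ξ‖]

/-- Split `a⁻¹ = a^(-1/4) a^(-3/4)` and use `a ≥ κ²` in the first factor, `a ≥ 1 + ‖ξ‖²` in the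
second. The decay in `κ` makes `W (-Δ + κ²)⁻¹` small for large `κ`, hence the operators bounded
below. -/
theorem symbol_le_bracket_of_one_le {κ : ℝ} (hκ : 1 ≤ κ) (ξ : Plane) :
    symbol κ ξ ≤ κ ^ (-(1 / 2 : ℝ)) * (1 + ‖ξ‖ ^ 2) ^ (-(3 / 4 : ℝ)) := by
  have h4 : 1 ≤ (2 * Real.pi) ^ 2 := by nlinarith [Real.pi_gt_three]
  have hκ0 : 0 < κ := by linarith
  set a := κ ^ 2 + (2 * Real.pi) ^ 2 * ‖ξ‖ ^ 2 with ha
  have ha0 : 0 < a := symbol_den_pos hκ0 ξ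
  have e : symbol κ ξ = a ^ (-(1 / 4 : ℝ)) * a ^ (-(3 / 4 : ℝ)) := by
    rw [← Real.rpow_add ha0, symbol]
    norm_num
    rw [Real.rpow_neg_one]
  have e2 : κ ^ (-(1 / 2 : ℝ)) = (κ ^ 2) ^ (-(1 / 4 : ℝ)) := by
    rw [← Real.rpow_natCast, ← Real.rpow_mul hκ0.le]
    norm_num
  rw [e, e2]
  gcongr ?_ * ?_
  · apply Real.rpow_le_rpow_of_nonpos (by positivity) _ (by norm_num)
    rw [ha]
    nlinarith [sq_nonneg ‖ξ‖]
  · apply Real.rpow_le_rpow_of_nonpos (by positivity) _ (by norm_num)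
    rw [ha]
    nlinarith [sq_nonneg ‖ξ‖]

theorem memLp_symbol {κ : ℝ} (hκ : 0 < κ) : MemLp (symbol κ) 2 volume := by
  refine MemLp.mono (memLp_bracket.const_mul (min (κ ^ 2) 1)⁻¹)
    (continuous_symbol hκ).aestronglyMeasurable (.of_forall fun ξ => ?_)
  rw [Real.norm_of_nonneg (symbol_pos hκ ξ).le]
  exact (symbol_le_bracket hκ ξ).trans (le_abs_self _)

/-- The plane wave `x ↦ exp (-2πi ⟨ξ, x⟩)`. -/
def wave (ξ x : Plane) : ℂ := ((Real.fourierChar (-inner ℝ ξ x) : Circle) : ℂ)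

@[simp]
theorem norm_wave (ξ x : Plane) : ‖wave ξ x‖ = 1 := Circle.norm_coe _

theorem continuous_wave_left (x : Plane) : Continuous fun ξ : Plane => wave ξ x := by
  unfold wave
  have := Real.continuous_fourierChar
  fun_prop

theorem continuous_wave_right (ξ : Plane) : Continuous fun x : Plane => wave ξ x := by
  unfold wave
  have := Real.continuous_fourierChar
  fun_prop

theorem continuous_symbol_mul_wave (κ : ℝ) (hκ : 0 < κ) (x : Plane) :
    Continuous fun ξ : Plane => (symbol κ ξ : ℂ) * wave ξ x := by
  have := continuous_symbol hκ
  exact (Complex.continuous_ofReal.comp this).mul (continuous_wave_left x)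

theorem memLp_wave {κ : ℝ} (hκ : 0 < κ) (x : Plane) :
    MemLp (fun ξ : Plane => (symbol κ ξ : ℂ) * wave ξ x) 2 volume := by
  refine MemLp.mono (memLp_symbol hκ) (continuous_symbol_mul_wave κ hκ x).aestronglyMeasurable
    (.of_forall fun ξ => ?_)
  simp

/-- The vector of `L²(ℝ²)` that represents the evaluation of `(-Δ + κ²)⁻¹ f` at `x`, on the
Fourier side. -/
def waveVec (κ : ℝ) (hκ : 0 < κ) (x : Plane) : L2 := (memLp_wave hκ x).toLp

theorem norm_waveVec {κ : ℝ} (hκ : 0 < κ) (x : Plane) :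
    ‖waveVec κ hκ x‖ = ‖(memLp_symbol hκ).toLp‖ := by
  rw [waveVec, Lp.norm_toLp, Lp.norm_toLp]
  congr 1
  exact eLpNorm_congr_norm_ae (.of_forall fun ξ => by simp)

theorem norm_symbol_le {κ : ℝ} (hκ : 1 ≤ κ) :
    ‖(memLp_symbol (one_pos.trans_le hκ)).toLp‖ ≤ κ ^ (-(1 / 2 : ℝ)) * ‖memLp_bracket.toLp‖ := by
  apply Lp.norm_le_mul_norm_of_ae_le_mul
  filter_upwards [(memLp_symbol (one_pos.trans_le hκ)).coeFn_toLp, memLp_bracket.coeFn_toLp]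
    with ξ h1 h2
  rw [h1, h2, Real.norm_of_nonneg (symbol_pos (one_pos.trans_le hκ) ξ).le,
    Real.norm_of_nonneg (by positivity)]
  exact symbol_le_bracket_of_one_le hκ ξ

/-- The Fourier transform of `(-Δ + κ²)⁻¹ f` is a product of two `L²` functions, hence integrable,
and can be inverted pointwise. Point evaluation is thus a pairing with a vector of norm independent
of the point, which is what makes multiplication by an unbounded `W ∈ L²` harmless. -/
theorem freeRes_ae_eq {κ : ℝ} (hκ : 0 < κ) (f : L2) :
    (freeRes κ hκ f : Plane → ℂ) =ᵐ[volume] fun x => inner ℂ (waveVec κ hκ x) (fourierL2 f) := by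
  set h := fourierL2 (freeRes κ hκ f)
  have hh := fourier_freeRes hκ f
  have hi : Integrable h := by
    refine Integrable.congr ?_ hh.symm
    exact memLp_one_iff_integrable.1
      ((Lp.memLp (fourierL2 f)).mul (memLp_symbol hκ).ofReal (r := 1))
  have h1 := fourierL2_symm_ae_eq h hi
  rw [LinearIsometryEquiv.symm_apply_apply] at h1
  filter_upwards [h1] with x hx
  rw [hx, Real.fourierInv_eq, inner_eq_integral]
  refine integral_congr_ae ?_
  filter_upwards [hh, (memLp_wave hκ x).coeFn_toLp] with ξ h2 h3
  rw [waveVec, h3, h2, map_mul, Complex.conj_ofReal, wave, Circle.smul_def, smul_eq_mul,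
    AddChar.map_neg_eq_inv, Circle.coe_inv_eq_conj, Complex.conj_conj]
  ring

theorem continuous_waveVec {κ : ℝ} (hκ : 0 < κ) : Continuous (waveVec κ hκ) := by
  rw [continuous_iff_continuousAt]
  intro x₀
  rw [ContinuousAt, tendsto_iff_norm_sub_tendsto_zero]
  have key : ∀ x, ‖waveVec κ hκ x - waveVec κ hκ x₀‖ ^ 2 = ∫ ξ : Plane, symbol κ ξ ^ 2 *
      ‖wave ξ x - wave ξ x₀‖ ^ 2 := by
    intro x
    rw [← Complex.ofReal_inj]
    push_cast
    refine (inner_self_eq_norm_sq_to_K (𝕜 := ℂ) (E := L2) _).symm.trans ?_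
    rw [inner_eq_integral, ← integral_complex_ofReal]
    refine integral_congr_ae ?_
    filter_upwards [Lp.coeFn_sub (waveVec κ hκ x) (waveVec κ hκ x₀),
      (memLp_wave hκ x).coeFn_toLp, (memLp_wave hκ x₀).coeFn_toLp] with ξ h1 h2 h3
    rw [h1, Pi.sub_apply, waveVec, waveVec, h2, h3, ← mul_sub, Complex.mul_conj,
      Complex.normSq_eq_norm_sq, norm_mul, Complex.norm_real, mul_pow, Real.norm_eq_abs, sq_abs]
  have hcont : Continuous fun x : Plane => ∫ ξ : Plane, symbol κ ξ ^ 2 *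
      ‖wave ξ x - wave ξ x₀‖ ^ 2 := by
    have hs := continuous_symbol hκ
    refine continuous_of_dominated (bound := fun ξ => symbol κ ξ ^ 2 * 2 ^ 2) (fun x => ?_)
      (fun x => .of_forall fun ξ => ?_) ((memLp_symbol hκ).integrable_sq.mul_const _)
      (.of_forall fun ξ => ?_)
    · exact ((hs.pow 2).mul (((continuous_wave_left x).sub (continuous_wave_left x₀)).norm.pow 2)).aestronglyMeasurable
    · rw [norm_mul, norm_pow, norm_pow, norm_norm, Real.norm_eq_abs, sq_abs]
      gcongr
      refine (norm_sub_le _ _).trans ?_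
      rw [norm_wave, norm_wave]
      norm_num
    · exact continuous_const.mul (((continuous_wave_right ξ).sub continuous_const).norm.pow 2)
  have h0 := hcont.tendsto x₀
  simp only [← key, sub_self, norm_zero, ne_eq, OfNat.ofNat_ne_zero, not_false_eq_true,
    zero_pow] at h0
  have := h0.sqrt
  simpa using this

/-! ### Multiplication by a potential after the free resolvent -/

theorem norm_potentialH2_freeRes_le {W : Plane → ℝ} (hW : MemLp W 2 volume) {κ : ℝ} (hκ : 0 < κ)
    (f : L2) : ‖potentialH2 W hW (freeResH2 κ hκ f)‖ ≤
      ‖(memLp_symbol hκ).toLp‖ * ‖hW.toLp‖ * ‖f‖ := by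
  have : ‖potentialH2 W hW (freeResH2 κ hκ f)‖ ≤
      (‖(memLp_symbol hκ).toLp‖ * ‖f‖) * ‖hW.toLp‖ := by
    apply Lp.norm_le_mul_norm_of_ae_le_mul
    filter_upwards [(memLp_mul_of_mem_sobolevH2 hW (freeResH2 κ hκ f)).coeFn_toLp,
      hW.coeFn_toLp, freeRes_ae_eq hκ f] with x h1 h2 h3
    change ‖(memLp_mul_of_mem_sobolevH2 hW (freeResH2 κ hκ f)).toLp _ x‖ ≤ _
    rw [h1, h2, norm_mul, Complex.norm_real, mul_comm]
    gcongr
    change ‖freeRes κ hκ f x‖ ≤ _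
    rw [h3]
    refine (norm_inner_le_norm _ _).trans ?_
    rw [norm_waveVec, LinearIsometryEquiv.norm_map]
  calc _ ≤ _ := this
    _ = _ := by ring

/-- The operator `W (-Δ + κ²)⁻¹` on `L²(ℝ²)`. -/
def potRes (W : Plane → ℝ) (hW : MemLp W 2 volume) (κ : ℝ) (hκ : 0 < κ) : L2 →L[ℂ] L2 :=
  LinearMap.mkContinuous
    { toFun := fun f => potentialH2 W hW (freeResH2 κ hκ f)
      map_add' := fun f g => by
        rw [← map_add]
        congr 1
        exact Subtype.ext (map_add _ _ _)
      map_smul' := fun c f => by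
        rw [RingHom.id_apply, ← map_smul]
        congr 1
        exact Subtype.ext (map_smul _ _ _) }
    _ (norm_potentialH2_freeRes_le hW hκ)

theorem potRes_apply {W : Plane → ℝ} (hW : MemLp W 2 volume) {κ : ℝ} (hκ : 0 < κ) (f : L2) :
    potRes W hW κ hκ f = potentialH2 W hW (freeResH2 κ hκ f) := rfl

theorem norm_potRes_le {W : Plane → ℝ} (hW : MemLp W 2 volume) {κ : ℝ} (hκ : 0 < κ) :
    ‖potRes W hW κ hκ‖ ≤ ‖(memLp_symbol hκ).toLp‖ * ‖hW.toLp‖ :=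
  LinearMap.mkContinuous_norm_le _ (by positivity) _

theorem exists_forall_norm_potRes_lt {W : Plane → ℝ} (hW : MemLp W 2 volume) :
    ∃ κ₀ : ℝ, 0 < κ₀ ∧ ∀ κ (hκ : 0 < κ), κ₀ ≤ κ → ‖potRes W hW κ hκ‖ < 1 := by
  have ht : Filter.Tendsto (fun κ : ℝ => κ ^ (-(1 / 2 : ℝ)) * ‖memLp_bracket.toLp‖ * ‖hW.toLp‖)
      Filter.atTop (nhds (0 * ‖memLp_bracket.toLp‖ * ‖hW.toLp‖)) :=
    ((tendsto_rpow_neg_atTop (by norm_num)).mul_const _).mul_const _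
  rw [zero_mul, zero_mul] at ht
  obtain ⟨a, ha⟩ := Filter.eventually_atTop.1 (ht.eventually_lt_const one_pos)
  refine ⟨max a 1, by positivity, fun κ hκ h => ?_⟩
  refine lt_of_le_of_lt ?_ (ha κ ((le_max_left _ _).trans h))
  refine (norm_potRes_le hW hκ).trans ?_
  gcongr
  exact norm_symbol_le ((le_max_right _ _).trans h)

/-- The evaluation of `𝓕⁻ (symbol κ * f)` on a closed ball, as an operator into the continuous
functions on the ball. -/
def ballEval (κ : ℝ) (hκ : 0 < κ) (D : ℝ) :
    L2 →L[ℂ] BoundedContinuousFunction (closedBall (0 : Plane) D) ℂ :=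
  haveI : CompactSpace (closedBall (0 : Plane) D) :=
    isCompact_iff_compactSpace.1 (isCompact_closedBall _ _)
  LinearMap.mkContinuous
    { toFun := fun f => BoundedContinuousFunction.mkOfCompact
        ⟨fun x => inner ℂ (waveVec κ hκ (x : Plane)) (f : L2),
          ((continuous_waveVec hκ).comp continuous_subtype_val).inner continuous_const⟩
      map_add' := fun f g => by
        ext x
        simp [inner_add_right]
      map_smul' := fun c f => by
        ext x
        simp [inner_smul_right] }
    ‖(memLp_symbol hκ).toLp‖ fun f => by
      rw [BoundedContinuousFunction.norm_le (by positivity)]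
      intro x
      change ‖inner ℂ (waveVec κ hκ (x : Plane)) (f : L2)‖ ≤ _
      refine (norm_inner_le_norm _ _).trans ?_
      rw [norm_waveVec]

theorem ballEval_apply {κ : ℝ} (hκ : 0 < κ) {D : ℝ} (f : L2) (x : closedBall (0 : Plane) D) :
    ballEval κ hκ D f x = inner ℂ (waveVec κ hκ x) f := rfl

/-- Arzelà-Ascoli: on the unit ball of `L²` the images are bounded by `‖waveVec‖`, and
equicontinuous because `|⟨waveVec x - waveVec y, f⟩| ≤ ‖waveVec x - waveVec y‖`. -/
theorem isCompactOperator_ballEval {κ : ℝ} (hκ : 0 < κ) (D : ℝ) :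
    IsCompactOperator (ballEval κ hκ D) := by
  have : CompactSpace (closedBall (0 : Plane) D) :=
    isCompact_iff_compactSpace.1 (isCompact_closedBall _ _)
  change IsCompactOperator (ballEval κ hκ D).toLinearMap
  rw [isCompactOperator_iff_isCompact_closure_image_closedBall _ one_pos]
  refine BoundedContinuousFunction.arzela_ascoli
    (closedBall (0 : ℂ) ‖(memLp_symbol hκ).toLp‖) (isCompact_closedBall _ _) _ ?_ ?_
  · rintro _ x ⟨f, hf, rfl⟩
    rw [mem_closedBall_zero_iff] at hf ⊢
    change ‖inner ℂ (waveVec κ hκ (x : Plane)) (f : L2)‖ ≤ _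
    refine (norm_inner_le_norm _ _).trans ?_
    rw [norm_waveVec]
    exact mul_le_of_le_one_right (by positivity) hf
  · intro x
    rw [Metric.equicontinuousAt_iff]
    intro ε hε
    obtain ⟨δ, hδ, h⟩ := Metric.continuous_iff.1 (continuous_waveVec hκ) x ε hε
    refine ⟨δ, hδ, fun y hy => ?_⟩
    rintro ⟨_, f, hf, rfl⟩
    rw [mem_closedBall_zero_iff] at hf
    change dist (inner ℂ (waveVec κ hκ x) (f : L2)) (inner ℂ (waveVec κ hκ y) (f : L2)) < ε
    rw [dist_comm, dist_eq_norm, ← inner_sub_left]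
    refine (norm_inner_le_norm _ _).trans_lt ?_
    rw [← dist_eq_norm]
    exact (mul_le_of_le_one_right (by positivity) hf).trans_lt (h y hy)

theorem memLp_weight {W : Plane → ℝ} (hW : MemLp W 2 volume) {D : ℝ}
    (g : BoundedContinuousFunction (closedBall (0 : Plane) D) ℂ) :
    MemLp (fun x => (W x : ℂ) * Function.extend Subtype.val g 0 x) 2 volume := by
  have hm : Measurable (Function.extend Subtype.val g 0) :=
    (MeasurableEmbedding.subtype_coe measurableSet_closedBall).measurable_extend
      g.continuous.measurable measurable_const
  have hb : MemLp (Function.extend Subtype.val g 0) ∞ (volume : Measure Plane) := by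
    refine memLp_top_of_bound hm.aestronglyMeasurable ‖g‖ (.of_forall fun x => ?_)
    by_cases hx : x ∈ closedBall (0 : Plane) D
    · have : Function.extend Subtype.val g 0 x = g ⟨x, hx⟩ :=
        Subtype.val_injective.extend_apply g 0 ⟨x, hx⟩
      rw [this]
      exact g.norm_coe_le_norm _
    · rw [Function.extend_apply' _ _ _ (by simpa using hx)]
      simp
  exact hb.mul hW.ofReal

/-- Multiplication by `W`, from the continuous functions on a closed ball to `L²(ℝ²)`. -/
def weightMul (W : Plane → ℝ) (hW : MemLp W 2 volume) (D : ℝ) :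
    BoundedContinuousFunction (closedBall (0 : Plane) D) ℂ →L[ℂ] L2 :=
  LinearMap.mkContinuous
    { toFun := fun g => (memLp_weight hW g).toLp
      map_add' := fun f g => by
        rw [← MemLp.toLp_add]
        refine MemLp.toLp_congr _ _ (.of_forall fun x => ?_)
        by_cases hx : ∃ y : closedBall (0 : Plane) D, (y : Plane) = x
        · obtain ⟨y, rfl⟩ := hx
          simp only [Pi.add_apply, Subtype.val_injective.extend_apply,
            BoundedContinuousFunction.coe_add, mul_add]
        · simp [Function.extend_apply' _ _ _ hx]
      map_smul' := fun c f => by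
        rw [RingHom.id_apply, ← MemLp.toLp_const_smul]
        refine MemLp.toLp_congr _ _ (.of_forall fun x => ?_)
        by_cases hx : ∃ y : closedBall (0 : Plane) D, (y : Plane) = x
        · obtain ⟨y, rfl⟩ := hx
          simp only [Pi.smul_apply, Subtype.val_injective.extend_apply,
            BoundedContinuousFunction.coe_smul, smul_eq_mul]
          ring
        · simp [Function.extend_apply' _ _ _ hx] }
    ‖hW.toLp‖ fun g => by
      refine le_of_le_of_eq ?_ (mul_comm ‖g‖ _)
      apply Lp.norm_le_mul_norm_of_ae_le_mul
      filter_upwards [(memLp_weight hW g).coeFn_toLp, hW.coeFn_toLp] with x h1 h2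
      change ‖(memLp_weight hW g).toLp _ x‖ ≤ _
      rw [h1, h2, norm_mul, Complex.norm_real, mul_comm]
      gcongr
      by_cases hx : ∃ y : closedBall (0 : Plane) D, (y : Plane) = x
      · obtain ⟨y, rfl⟩ := hx
        rw [Subtype.val_injective.extend_apply]
        exact g.norm_coe_le_norm _
      · simp [Function.extend_apply' _ _ _ hx]

/-- As `W` vanishes outside a ball, the operator factors through the compact evaluation map into
continuous functions on that ball. -/
theorem isCompactOperator_potRes {W : Plane → ℝ} (hW : MemLp W 2 volume) {D : ℝ}
    (hD : ∀ x, x ∉ closedBall (0 : Plane) D → W x = 0) {κ : ℝ} (hκ : 0 < κ) :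
    IsCompactOperator (potRes W hW κ hκ) := by
  have : potRes W hW κ hκ =
      (weightMul W hW D) ∘L (ballEval κ hκ D ∘L (fourierL2 : L2 →L[ℂ] L2)) := by
    ext1 f
    apply Lp.ext
    filter_upwards [(memLp_mul_of_mem_sobolevH2 hW (freeResH2 κ hκ f)).coeFn_toLp,
      (memLp_weight hW (ballEval κ hκ D (fourierL2 f))).coeFn_toLp, freeRes_ae_eq hκ f]
      with x h1 h2 h3
    change (memLp_mul_of_mem_sobolevH2 hW (freeResH2 κ hκ f)).toLp _ x =
      (memLp_weight hW (ballEval κ hκ D (fourierL2 f))).toLp _ x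
    rw [h1, h2]
    by_cases hx : x ∈ closedBall (0 : Plane) D
    · have h4 : Function.extend (Subtype.val : closedBall (0 : Plane) D → Plane)
          (fun y => ballEval κ hκ D (fourierL2 f) y) 0 x =
          ballEval κ hκ D (fourierL2 f) ⟨x, hx⟩ :=
        Function.Injective.extend_apply (f := (Subtype.val : closedBall (0 : Plane) D → Plane))
          Subtype.val_injective _ _ ⟨x, hx⟩
      rw [h4, ballEval_apply, ← h3]
      rfl
    · simp [hD x hx]
  rw [this]
  exact ((isCompactOperator_ballEval hκ D).comp_clm (fourierL2 : L2 →L[ℂ] L2)).clm_comp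
    (weightMul W hW D)

/-! ### Spectral theory of semibounded symmetric operators -/

instance : Nontrivial L2 := by
  refine ⟨⟨0, indicatorConstLp 2 (measurableSet_ball (x := (0 : Plane)) (ε := 1))
    measure_ball_lt_top.ne 1, fun h => ?_⟩⟩
  have h1 := congrArg norm h
  rw [norm_zero, norm_indicatorConstLp (by norm_num) (by norm_num)] at h1
  have h2 : 0 < (volume : Measure Plane).real (Metric.ball (0 : Plane) 1) :=
    ENNReal.toReal_pos (Metric.measure_ball_pos _ _ one_pos).ne' measure_ball_lt_top.ne
  have h3 := Real.rpow_pos_of_pos h2 (1 / (2 : ℝ≥0∞).toReal)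
  simp at h1 h3
  linarith

theorem isSymmetric_resolvent {T : L2 →ₗ.[ℂ] L2}
    (hT : ∀ u v : T.domain, inner ℂ (T u) (v : L2) = inner ℂ (u : L2) (T v)) {E : ℝ}
    {S : L2 →L[ℂ] L2}
    (hS : ∀ f : L2, ∃ h : S f ∈ T.domain, T ⟨S f, h⟩ - (E : ℂ) • S f = f) (f g : L2) :
    inner ℂ (S f) g = inner ℂ f (S g) := by
  obtain ⟨hf, ef⟩ := hS f
  obtain ⟨hg, eg⟩ := hS g
  calc inner ℂ (S f) g = inner ℂ (S f) (T ⟨S g, hg⟩ - (E : ℂ) • S g) := by rw [eg]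
    _ = inner ℂ (T ⟨S f, hf⟩ - (E : ℂ) • S f) (S g) := by
      rw [inner_sub_left, inner_sub_right, inner_smul_left, inner_smul_right, Complex.conj_ofReal]
      rw [hT ⟨S f, hf⟩ ⟨S g, hg⟩]
    _ = inner ℂ f (S g) := by rw [ef]

theorem algebraMap_real_apply (s : ℝ) (f : L2) :
    algebraMap ℝ (L2 →L[ℂ] L2) s f = (s : ℂ) • f := rfl

/-- `S = (T - E)⁻¹`, so the point `t = E + s⁻¹` of `T` corresponds to the point `(t - E)⁻¹ = s` of
`S`. If `R` is the resolvent of `T` at `t`, then `(s - S)⁻¹ = s⁻¹ (1 + s⁻¹ R)`. -/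
theorem notMem_spectrum_of_mem_resolventSet {T : L2 →ₗ.[ℂ] L2} {E : ℝ} {S : L2 →L[ℂ] L2}
    (hS : ∀ f : L2, ∃ h : S f ∈ T.domain, T ⟨S f, h⟩ - (E : ℂ) • S f = f)
    (hS' : ∀ u : T.domain, S (T u - (E : ℂ) • (u : L2)) = u) {s : ℝ} (hs : s ≠ 0)
    (h : ((E + s⁻¹ : ℝ) : ℂ) ∈ resolventSet T) : s ∉ spectrum ℝ S := by
  obtain ⟨R, hR, hR'⟩ := h
  rw [spectrum.notMem_iff]
  have hsc : (s : ℂ) ≠ 0 := by exact_mod_cast hs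
  have e1 : (algebraMap ℝ (L2 →L[ℂ] L2) s - S) * ((s : ℂ)⁻¹ • (1 + (s : ℂ)⁻¹ • R)) = 1 := by
    ext1 f
    obtain ⟨hd, e⟩ := hR f
    have h1 := hS' ⟨R f, hd⟩
    have h2 : T ⟨R f, hd⟩ - (E : ℂ) • R f = f + (s : ℂ)⁻¹ • R f := by
      nth_rw 3 [← e]
      push_cast
      module
    rw [h2] at h1
    simp only [mul_apply_eq_comp, smul_apply, add_apply, one_apply_eq_self, sub_apply,
      algebraMap_real_apply, map_smul, h1]
    match_scalars <;> field_simp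
    ring
  have e2 : ((s : ℂ)⁻¹ • (1 + (s : ℂ)⁻¹ • R)) * (algebraMap ℝ (L2 →L[ℂ] L2) s - S) = 1 := by
    ext1 f
    obtain ⟨hd, e⟩ := hS f
    have h1 := hR' ⟨S f, hd⟩
    have h2 : (s : ℂ) • f - S f = (s : ℂ) • (T ⟨S f, hd⟩ - ((E + s⁻¹ : ℝ) : ℂ) • S f) := by
      nth_rw 1 [← e]
      push_cast
      rw [add_smul, smul_sub, smul_sub, smul_add, smul_smul (s : ℂ) (s : ℂ)⁻¹,
        mul_inv_cancel₀ hsc]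
      module
    simp only [mul_apply_eq_comp, smul_apply, add_apply, one_apply_eq_self, sub_apply,
      algebraMap_real_apply]
    have h3 : T ⟨S f, hd⟩ = f + (E : ℂ) • S f := sub_eq_iff_eq_add.1 e
    rw [h2, map_smul, h1, h3]
    push_cast
    match_scalars <;> field_simp
    ring
  exact ⟨⟨_, _, e1, e2⟩, rfl⟩

/-- The same correspondence read backwards: the resolvent of `T` at `E + s⁻¹` is `s S (s - S)⁻¹`. -/
theorem mem_resolventSet_of_notMem_spectrum {T : L2 →ₗ.[ℂ] L2} {E : ℝ} {S : L2 →L[ℂ] L2}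
    (hS : ∀ f : L2, ∃ h : S f ∈ T.domain, T ⟨S f, h⟩ - (E : ℂ) • S f = f)
    (hS' : ∀ u : T.domain, S (T u - (E : ℂ) • (u : L2)) = u) {s : ℝ} (hs : s ≠ 0)
    (h : s ∉ spectrum ℝ S) : ((E + s⁻¹ : ℝ) : ℂ) ∈ resolventSet T := by
  rw [spectrum.notMem_iff] at h
  obtain ⟨Q, hQ⟩ := h
  have hsc : (s : ℂ) ≠ 0 := by exact_mod_cast hs
  have q1 : ∀ f, (s : ℂ) • (Q⁻¹.1 f) - S (Q⁻¹.1 f) = f := fun f => by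
    have : Q.1 (Q⁻¹.1 f) = f := congrArg (fun A : L2 →L[ℂ] L2 => A f) Q.mul_inv
    rwa [hQ] at this
  have q2 : ∀ f, Q⁻¹.1 ((s : ℂ) • f - S f) = f := fun f => by
    have : Q⁻¹.1 (Q.1 f) = f := congrArg (fun A : L2 →L[ℂ] L2 => A f) Q.inv_mul
    rwa [hQ] at this
  refine ⟨(s : ℂ) • (S ∘L Q⁻¹.1), fun f => ?_, fun u => ?_⟩
  · obtain ⟨hd, e⟩ := hS ((s : ℂ) • Q⁻¹.1 f)
    have hd' : ((s : ℂ) • (S ∘L Q⁻¹.1)) f = S ((s : ℂ) • Q⁻¹.1 f) := (map_smul S _ _).symm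
    refine ⟨hd' ▸ hd, ?_⟩
    have : T ⟨((s : ℂ) • (S ∘L Q⁻¹.1)) f, hd' ▸ hd⟩ = T ⟨S ((s : ℂ) • Q⁻¹.1 f), hd⟩ := by
      congr 1
      exact Subtype.ext hd'
    rw [this, hd']
    have e3 : T ⟨S ((s : ℂ) • Q⁻¹.1 f), hd⟩ =
      (s : ℂ) • Q⁻¹.1 f + (E : ℂ) • S ((s : ℂ) • Q⁻¹.1 f) := sub_eq_iff_eq_add.1 e
    rw [e3]
    refine Eq.trans ?_ (q1 f)
    rw [map_smul]
    push_cast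
    match_scalars <;> field_simp
    ring
  · have h1 := hS' u
    set f := T u - (E : ℂ) • (u : L2) with hf
    have h2 : T u - ((E + s⁻¹ : ℝ) : ℂ) • (u : L2) = (s : ℂ)⁻¹ • ((s : ℂ) • f - S f) := by
      rw [h1, smul_sub, smul_smul, inv_mul_cancel₀ hsc, hf]
      push_cast
      module
    rw [h2]
    change (s : ℂ) • S (Q⁻¹.1 ((s : ℂ)⁻¹ • ((s : ℂ) • f - S f))) = u
    rw [map_smul, q2, map_smul, smul_smul, mul_inv_cancel₀ hsc, one_smul, h1]

/-! ### Positive bounded operators and the bottom of the spectrum. -/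

theorem nonneg_of_spectrum_nonneg {H : Type*} [NormedAddCommGroup H] [InnerProductSpace ℂ H]
    [CompleteSpace H] {S : H →L[ℂ] H} (hS : IsSelfAdjoint S) (h : ∀ s ∈ spectrum ℝ S, 0 ≤ s) :
    0 ≤ S := by
  rwa [StarOrderedRing.nonneg_iff_spectrum_nonneg (R := ℝ) S hS]

theorem norm_mem_spectrum_of_nonneg {H : Type*} [NormedAddCommGroup H] [InnerProductSpace ℂ H]
    [CompleteSpace H] [Nontrivial H] {S : H →L[ℂ] H} (hS : 0 ≤ S) : ‖S‖ ∈ spectrum ℝ S :=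
  CStarAlgebra.norm_mem_spectrum_of_nonneg hS

/-- This is `S² ≤ ‖S‖ S` in weak form, obtained from positivity of `S` at the vector `f - ‖S‖⁻¹ S
f`. For a resolvent `S` it becomes the lower form bound by the bottom of the spectrum. -/
theorem norm_sq_le_of_nonneg {H : Type*} [NormedAddCommGroup H] [InnerProductSpace ℂ H]
    [CompleteSpace H] {S : H →L[ℂ] H} (hS : 0 ≤ S) (hS0 : 0 < ‖S‖) (f : H) :
    ‖S‖⁻¹ * ‖S f‖ ^ 2 ≤ (inner ℂ (S f) f).re := by
  have hp := (ContinuousLinearMap.nonneg_iff_isPositive S).1 hS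
  have hsym : ∀ f g, inner ℂ (S f) g = inner ℂ f (S g) := hp.isSymmetric
  have h3 : 0 ≤ (inner ℂ (S (f - (‖S‖⁻¹ : ℂ) • S f)) (f - (‖S‖⁻¹ : ℂ) • S f)).re :=
    hp.re_inner_nonneg_left _
  have h4 : (inner ℂ (S (f - (‖S‖⁻¹ : ℂ) • S f)) (f - (‖S‖⁻¹ : ℂ) • S f)).re =
      (inner ℂ (S f) f).re - 2 * (‖S‖⁻¹ * ‖S f‖ ^ 2) +
        ‖S‖⁻¹ ^ 2 * (inner ℂ (S (S f)) (S f)).re := by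
    have e2 : inner ℂ (S f) (S f) = ((‖S f‖ ^ 2 : ℝ) : ℂ) := by
      push_cast
      exact inner_self_eq_norm_sq_to_K (𝕜 := ℂ) _
    have e1 : inner ℂ (S (S f)) f = ((‖S f‖ ^ 2 : ℝ) : ℂ) := by
      rw [hsym, e2]
    rw [map_sub, map_smul, inner_sub_left, inner_sub_right, inner_sub_right, inner_smul_left,
      inner_smul_left, inner_smul_right, inner_smul_right, e1, e2, ← Complex.ofReal_inv,
      Complex.conj_ofReal]
    simp only [Complex.sub_re, Complex.re_ofReal_mul, Complex.ofReal_re]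
    ring
  have h5 : (inner ℂ (S (S f)) (S f)).re ≤ ‖S‖ * ‖S f‖ ^ 2 := by
    refine (Complex.re_le_norm _).trans ((norm_inner_le_norm _ _).trans ?_)
    nlinarith [S.le_opNorm (S f), norm_nonneg (S f)]
  rw [h4] at h3
  have h6 : ‖S‖⁻¹ ^ 2 * (inner ℂ (S (S f)) (S f)).re ≤ ‖S‖⁻¹ * ‖S f‖ ^ 2 := by
    calc _ ≤ ‖S‖⁻¹ ^ 2 * (‖S‖ * ‖S f‖ ^ 2) := by gcongr
      _ = _ := by field_simp
  linarith

/-- Everything is read off from the bounded operator `S = (T - E)⁻¹`, so no spectral theorem for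
unbounded operators enters. It is self-adjoint, and positive because `T` has no spectrum below `E`.
Its norm is the top of its spectrum, so `E + ‖S‖⁻¹` is the bottom of the spectrum of `T`. -/
theorem exists_isLeast_realSpectrum {T : L2 →ₗ.[ℂ] L2}
    (hT : ∀ u v : T.domain, inner ℂ (T u) (v : L2) = inner ℂ (u : L2) (T v)) {E : ℝ}
    (hE : ∀ E' ≤ E, (E' : ℂ) ∈ resolventSet T) :
    ∃ ε : ℝ, IsLeast (realSpectrum T) ε ∧
      ∀ u : T.domain, ε * ‖(u : L2)‖ ^ 2 ≤ (inner ℂ (u : L2) (T u)).re := by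
  obtain ⟨S, hS, hS'⟩ := hE E le_rfl
  have hsym := isSymmetric_resolvent hT hS
  have hsa : IsSelfAdjoint S := ContinuousLinearMap.isSelfAdjoint_iff_isSymmetric.2 hsym
  have hnn : 0 ≤ S := by
    refine nonneg_of_spectrum_nonneg hsa fun s hs => ?_
    by_contra hneg
    push Not at hneg
    exact notMem_spectrum_of_mem_resolventSet hS hS' hneg.ne
      (hE _ (by linarith [inv_lt_zero.2 hneg])) hs
  have hS0 : 0 < ‖S‖ := by
    rw [norm_pos_iff]
    rintro rfl
    obtain ⟨f, hf⟩ := exists_ne (0 : L2)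
    obtain ⟨h, e⟩ := hS f
    have h0 : T ⟨(0 : L2 →L[ℂ] L2) f, h⟩ = 0 := by
      rw [← map_zero T.toFun]
      congr 1
    apply hf
    rw [← e, h0]
    simp
  refine ⟨E + ‖S‖⁻¹, ⟨fun hmem => ?_, fun E' hE' => ?_⟩, fun u => ?_⟩
  · exact notMem_spectrum_of_mem_resolventSet hS hS' hS0.ne' hmem
      (norm_mem_spectrum_of_nonneg hnn)
  · by_contra hlt
    push Not at hlt
    apply hE'
    rcases le_or_gt E' E with h | h
    · exact hE _ h
    · have hs : (E' - E)⁻¹ ∉ spectrum ℝ S := fun hmem => by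
        have h1 := spectrum.norm_le_norm_of_mem hmem
        have h2 : ‖S‖ < (E' - E)⁻¹ := by
          rw [lt_inv_comm₀ hS0 (by linarith)]
          linarith
        linarith [le_abs_self (E' - E)⁻¹, Real.norm_eq_abs (E' - E)⁻¹]
      have := mem_resolventSet_of_notMem_spectrum hS hS' (inv_ne_zero (by linarith)) hs
      simpa using this
  · have h1 := hS' u
    set f := T u - (E : ℂ) • (u : L2) with hf
    have h2 : (inner ℂ (u : L2) (T u)).re = E * ‖(u : L2)‖ ^ 2 + (inner ℂ (S f) f).re := by
      have : T u = f + (E : ℂ) • (u : L2) := by rw [hf]; abel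
      rw [this, inner_add_right, inner_smul_right, h1, Complex.add_re, Complex.re_ofReal_mul,
        add_comm]
      congr 2
      exact inner_self_eq_norm_sq (𝕜 := ℂ) _
    rw [h2, add_mul]
    rw [← h1]
    gcongr
    exact norm_sq_le_of_nonneg hnn hS0 f

/-! ### Schrödinger operators -/

theorem inner_potentialH2_symm {W : Plane → ℝ} (hW : MemLp W 2 volume) (u v : sobolevH2) :
    inner ℂ (potentialH2 W hW u) (v : L2) = inner ℂ (u : L2) (potentialH2 W hW v) := by
  rw [inner_eq_integral, inner_eq_integral]
  refine integral_congr_ae ?_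
  filter_upwards [(memLp_mul_of_mem_sobolevH2 hW u).coeFn_toLp,
    (memLp_mul_of_mem_sobolevH2 hW v).coeFn_toLp] with x h1 h2
  change _ * (starRingEnd ℂ) ((memLp_mul_of_mem_sobolevH2 hW u).toLp _ x) =
    (memLp_mul_of_mem_sobolevH2 hW v).toLp _ x * _
  rw [h1, h2, map_mul, Complex.conj_ofReal]
  ring

theorem schrodinger_symm {W : Plane → ℝ} (hW : MemLp W 2 volume)
    (u v : (schrodinger W hW).domain) :
    inner ℂ (schrodinger W hW u) (v : L2) = inner ℂ (u : L2) (schrodinger W hW v) := by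
  suffices h : ∀ u v : sobolevH2, inner ℂ (-laplacianH2 u + potentialH2 W hW u) (v : L2) =
      inner ℂ (u : L2) (-laplacianH2 v + potentialH2 W hW v) from h u v
  intro u v
  rw [inner_add_left, inner_add_right, inner_neg_left, inner_neg_right, inner_laplacianH2_symm,
    inner_potentialH2_symm]

theorem schrodinger_freeRes {W : Plane → ℝ} (hW : MemLp W 2 volume) {κ : ℝ} (hκ : 0 < κ)
    (g : L2) : schrodinger W hW (freeResH2 κ hκ g) =
      g + potRes W hW κ hκ g - ((κ ^ 2 : ℝ) : ℂ) • freeRes κ hκ g := by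
  change -laplacianH2 (freeResH2 κ hκ g) + potentialH2 W hW (freeResH2 κ hκ g) = _
  nth_rw 3 [← helmholtz_freeRes hκ g]
  rw [potRes_apply]
  abel

/-- With `G = (-Δ + κ²)⁻¹` one has `-Δ + W + κ² = (1 + WG)(-Δ + κ²)`, so the inverse is `G (1 +
WG)⁻¹`. -/
theorem mem_resolventSet_schrodinger {W : Plane → ℝ} (hW : MemLp W 2 volume) {κ : ℝ}
    (hκ : 0 < κ) (h : IsUnit (1 + potRes W hW κ hκ)) :
    ((-κ ^ 2 : ℝ) : ℂ) ∈ resolventSet (schrodinger W hW) := by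
  obtain ⟨Q, hQ⟩ := h
  have q1 : ∀ f, Q⁻¹.1 f + potRes W hW κ hκ (Q⁻¹.1 f) = f := fun f => by
    have := congrArg (fun A : L2 →L[ℂ] L2 => A f) Q.mul_inv
    simpa [hQ] using this
  have q2 : ∀ f, Q⁻¹.1 (f + potRes W hW κ hκ f) = f := fun f => by
    have := congrArg (fun A : L2 →L[ℂ] L2 => A f) Q.inv_mul
    simpa [hQ] using this
  refine ⟨freeRes κ hκ ∘L Q⁻¹.1, fun f => ⟨freeRes_mem hκ _, ?_⟩, fun u => ?_⟩
  · change schrodinger W hW (freeResH2 κ hκ (Q⁻¹.1 f)) - _ • freeRes κ hκ (Q⁻¹.1 f) = f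
    rw [schrodinger_freeRes, q1]
    push_cast
    module
  · set g := -laplacianH2 u + ((κ ^ 2 : ℝ) : ℂ) • (u : L2) with hg
    have hu : (u : L2) = freeRes κ hκ g := (freeRes_helmholtz hκ u).symm
    have hu' : u = freeResH2 κ hκ g := Subtype.ext hu
    have h3 : schrodinger W hW u = g + potRes W hW κ hκ g - ((κ ^ 2 : ℝ) : ℂ) • (u : L2) := by
      rw [hu, ← schrodinger_freeRes hW hκ g]
      congr 1
    have h4 : schrodinger W hW u - ((-κ ^ 2 : ℝ) : ℂ) • (u : L2) = g + potRes W hW κ hκ g := by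
      rw [h3]
      push_cast
      module
    rw [h4, ContinuousLinearMap.comp_apply, q2, ← hu]

/-- If `-κ²` is spectral, then `1 + WG` is not invertible. Since `WG` is compact, `-1` is then an
eigenvalue by the Fredholm alternative; from `WG g = -g` the eigenfunction is `G g`. -/
theorem isEigenvalue_schrodinger {W : Plane → ℝ} (hW : MemLp W 2 volume) {D : ℝ}
    (hD : ∀ x, x ∉ Metric.closedBall (0 : Plane) D → W x = 0) {κ : ℝ} (hκ : 0 < κ)
    (h : (-κ ^ 2 : ℝ) ∈ realSpectrum (schrodinger W hW)) :
    IsEigenvalue (schrodinger W hW) (-κ ^ 2) := by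
  have h1 : ¬ IsUnit (1 + potRes W hW κ hκ) := fun hu => h (mem_resolventSet_schrodinger hW hκ hu)
  have h2 : (-1 : ℂ) ∉ _root_.resolventSet ℂ (potRes W hW κ hκ) := fun hm => by
    apply h1
    rw [spectrum.mem_resolventSet_iff] at hm
    have := hm.neg
    simpa [add_comm] using this
  obtain h3 := ((isCompactOperator_potRes hW hD hκ).hasEigenvalue_or_mem_resolventSet
    (by norm_num : (-1 : ℂ) ≠ 0)).resolve_right h2
  obtain ⟨g, hg⟩ := h3.exists_hasEigenvector
  have hg1 : potRes W hW κ hκ g = -g := by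
    have := hg.apply_eq_smul
    simpa using this
  refine ⟨freeResH2 κ hκ g, fun h0 => hg.2 ?_, ?_⟩
  · have h0' : freeRes κ hκ g = 0 := h0
    have h5 : freeResH2 κ hκ g = 0 := Subtype.ext h0
    rw [← helmholtz_freeRes hκ g, h0', h5]
    simp
  · rw [schrodinger_freeRes, hg1]
    change _ = _ • freeRes κ hκ g
    push_cast
    module

/-- For `κ ≥ κ₀` the Neumann series inverts `1 + WG`, so all energies up to `-κ₀²` lie in the
resolvent set. -/
theorem exists_isLeast_schrodinger {W : Plane → ℝ} (hW : MemLp W 2 volume) :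
    ∃ ε : ℝ, IsLeast (realSpectrum (schrodinger W hW)) ε ∧
      ∀ u : sobolevH2, ε * ‖(u : L2)‖ ^ 2 ≤
        (inner ℂ (u : L2) (-laplacianH2 u + potentialH2 W hW u)).re := by
  obtain ⟨κ₀, hκ₀, h⟩ := exists_forall_norm_potRes_lt hW
  refine exists_isLeast_realSpectrum (schrodinger_symm hW) (E := -κ₀ ^ 2) fun E hE => ?_
  have hE0 : κ₀ ^ 2 ≤ -E := by linarith
  have h1 : κ₀ ≤ √(-E) := Real.le_sqrt_of_sq_le hE0
  have h2 : 0 < √(-E) := hκ₀.trans_le h1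
  have h3 := mem_resolventSet_schrodinger hW h2 (by
    have := isUnit_one_sub_of_norm_lt_one (x := -potRes W hW _ h2) (by
      rw [norm_neg]; exact h _ h2 h1)
    simpa [add_comm] using this)
  rwa [Real.sq_sqrt (by nlinarith [sq_nonneg κ₀]), neg_neg] at h3

/-! ### The resolvent kernel -/

/-- The integrand of the heat kernel representation of the kernel of `(-Δ + κ²)⁻¹`. -/
def heatKern (κ t : ℝ) (z : Plane) : ℝ :=
  Real.exp (-(κ ^ 2 * t)) * ((4 * Real.pi * t)⁻¹ * Real.exp (-(4 * t)⁻¹ * ‖z‖ ^ 2))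

/-- The integral kernel of `(-Δ + κ²)⁻¹`. -/
def kern (κ : ℝ) (z : Plane) : ℝ := ∫ t in Ioi 0, heatKern κ t z

theorem heatKern_nonneg (κ : ℝ) {t : ℝ} (ht : 0 < t) (z : Plane) : 0 ≤ heatKern κ t z := by
  unfold heatKern
  positivity

theorem heatKern_neg (κ t : ℝ) (z : Plane) : heatKern κ t (-z) = heatKern κ t z := by
  simp [heatKern]

theorem kern_nonneg (κ : ℝ) (z : Plane) : 0 ≤ kern κ z :=
  setIntegral_nonneg measurableSet_Ioi fun _ ht => heatKern_nonneg κ ht z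

theorem measurable_heatKern (κ : ℝ) : Measurable fun q : ℝ × Plane => heatKern κ q.1 q.2 := by
  unfold heatKern
  fun_prop

theorem integral_gaussian_plane {t : ℝ} (ht : 0 < t) :
    ∫ z : Plane, Real.exp (-(4 * t)⁻¹ * ‖z‖ ^ 2) = 4 * Real.pi * t := by
  have : Real.pi / (4 * t)⁻¹ = 4 * Real.pi * t := by field_simp
  rw [GaussianFourier.integral_rexp_neg_mul_sq_norm (by positivity), this]
  simp

theorem integrable_gaussian_plane {t : ℝ} (ht : 0 < t) :
    Integrable fun z : Plane => Real.exp (-(4 * t)⁻¹ * ‖z‖ ^ 2) := by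
  by_contra h
  have h1 := integral_gaussian_plane ht
  rw [integral_undef h] at h1
  have : 0 < 4 * Real.pi * t := by positivity
  linarith

theorem integral_heatKern (κ : ℝ) {t : ℝ} (ht : 0 < t) :
    ∫ z, heatKern κ t z = Real.exp (-(κ ^ 2 * t)) := by
  unfold heatKern
  rw [integral_const_mul, integral_const_mul, integral_gaussian_plane ht, inv_mul_cancel₀, mul_one]
  positivity

theorem integrableOn_exp_neg_sq_mul {κ : ℝ} (hκ : 0 < κ) :
    IntegrableOn (fun t => Real.exp (-(κ ^ 2 * t))) (Ioi 0) := by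
  have := integrableOn_exp_mul_Ioi (a := -κ ^ 2) (by nlinarith [sq_pos_of_pos hκ]) 0
  simpa using this

theorem integrable_heatKern {κ : ℝ} (hκ : 0 < κ) :
    Integrable (fun q : ℝ × Plane => heatKern κ q.1 q.2)
      ((volume.restrict (Ioi 0)).prod volume) := by
  rw [integrable_prod_iff (measurable_heatKern κ).aestronglyMeasurable]
  constructor
  · filter_upwards [ae_restrict_mem measurableSet_Ioi] with t ht
    exact ((integrable_gaussian_plane ht).const_mul _).const_mul _
  · refine (integrableOn_exp_neg_sq_mul hκ).congr ?_
    filter_upwards [ae_restrict_mem measurableSet_Ioi] with t ht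
    rw [← integral_heatKern κ ht]
    refine integral_congr_ae (.of_forall fun z => ?_)
    exact (Real.norm_of_nonneg (heatKern_nonneg κ ht z)).symm

theorem integrable_heatKern_mul_snd {κ : ℝ} (hκ : 0 < κ) {h : Plane → ℝ} (hh : Integrable h) :
    Integrable (fun q : ℝ × Plane × Plane => heatKern κ q.1 (q.2.1 - q.2.2) * h q.2.2)
      ((volume.restrict (Ioi 0)).prod (volume.prod volume)) := by
  have h1 : Integrable (fun q : (ℝ × Plane) × Plane => heatKern κ q.1.1 q.1.2 * h q.2)
      (((volume.restrict (Ioi 0)).prod volume).prod volume) := (integrable_heatKern hκ).mul_prod hh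
  have h2 : MeasurePreserving (fun q : ℝ × Plane × Plane => ((q.1, q.2.1 - q.2.2), q.2.2))
      ((volume.restrict (Ioi 0)).prod (volume.prod volume))
      (((volume.restrict (Ioi 0)).prod volume).prod volume) :=
    ((measurePreserving_prodAssoc _ _ _).symm MeasurableEquiv.prodAssoc).comp
      ((MeasurePreserving.id _).prod (measurePreserving_sub_prod volume volume))
  exact h2.integrable_comp_of_integrable h1

theorem integrable_heatKern_mul_fst {κ : ℝ} (hκ : 0 < κ) {h : Plane → ℝ} (hh : Integrable h) :
    Integrable (fun q : ℝ × Plane × Plane => heatKern κ q.1 (q.2.1 - q.2.2) * h q.2.1)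
      ((volume.restrict (Ioi 0)).prod (volume.prod volume)) := by
  have h2 : MeasurePreserving (fun q : ℝ × Plane × Plane => (q.1, q.2.swap))
      ((volume.restrict (Ioi 0)).prod (volume.prod volume))
      ((volume.restrict (Ioi 0)).prod (volume.prod volume)) :=
    (MeasurePreserving.id _).prod Measure.measurePreserving_swap
  refine (h2.integrable_comp_of_integrable (integrable_heatKern_mul_snd hκ hh)).congr
    (.of_forall fun q => ?_)
  simp only [Function.comp, Prod.fst_swap, Prod.snd_swap]
  rw [← heatKern_neg, neg_sub]

/-- Dominate `|g(x) f(y)|` by `|f(y)|² + |g(x)|²`; in each term one space variable is free and is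
integrated against the heat kernel, so square integrability of `f` and `g` is enough. -/
theorem integrable_heatKern_mul {κ : ℝ} (hκ : 0 < κ) {f g : Plane → ℂ} (hf : MemLp f 2 volume)
    (hg : MemLp g 2 volume) :
    Integrable (fun q : ℝ × Plane × Plane =>
      (heatKern κ q.1 (q.2.1 - q.2.2) : ℂ) * (g q.2.1 * (starRingEnd ℂ) (f q.2.2)))
      ((volume.restrict (Ioi 0)).prod (volume.prod volume)) := by
  have h1 := (integrable_heatKern_mul_snd hκ hf.norm.integrable_sq).add
    (integrable_heatKern_mul_fst hκ hg.norm.integrable_sq)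
  refine h1.mono ?_ ?_
  · refine AEStronglyMeasurable.mul ?_ (AEStronglyMeasurable.mul ?_ ?_)
    · have : Measurable fun q : ℝ × Plane × Plane => heatKern κ q.1 (q.2.1 - q.2.2) :=
        (measurable_heatKern κ).comp (by fun_prop : Measurable fun q : ℝ × Plane × Plane =>
          (q.1, q.2.1 - q.2.2))
      exact (Complex.measurable_ofReal.comp this).aestronglyMeasurable
    · exact hg.1.comp_fst.comp_snd
    · exact Complex.continuous_conj.comp_aestronglyMeasurable hf.1.comp_snd.comp_snd
  · have : ∀ᵐ q : ℝ × Plane × Plane ∂((volume.restrict (Ioi 0)).prod (volume.prod volume)),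
        q.1 ∈ Ioi (0 : ℝ) :=
      Measure.quasiMeasurePreserving_fst.ae (ae_restrict_mem measurableSet_Ioi)
    filter_upwards [this] with q hq
    have h0 := heatKern_nonneg κ hq (q.2.1 - q.2.2)
    rw [norm_mul, norm_mul, Complex.norm_real, RCLike.norm_conj, Real.norm_of_nonneg h0,
      Pi.add_apply, ← mul_add, norm_mul, Real.norm_of_nonneg h0,
      Real.norm_of_nonneg (by positivity)]
    gcongr
    nlinarith [two_mul_le_add_sq ‖g q.2.1‖ ‖f q.2.2‖, norm_nonneg (g q.2.1),
      norm_nonneg (f q.2.2), sq_nonneg ‖g q.2.1‖, sq_nonneg ‖f q.2.2‖]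

theorem integrable_kern_mul {κ : ℝ} (hκ : 0 < κ) {f g : Plane → ℂ} (hf : MemLp f 2 volume)
    (hg : MemLp g 2 volume) :
    Integrable (fun p : Plane × Plane =>
      (kern κ (p.1 - p.2) : ℂ) * (g p.1 * (starRingEnd ℂ) (f p.2))) (volume.prod volume) := by
  refine (integrable_heatKern_mul hκ hf hg).integral_prod_right.congr (.of_forall fun p => ?_)
  simp only [kern]
  rw [integral_mul_const, integral_complex_ofReal]

theorem integral_heatKern_mul {κ : ℝ} (hκ : 0 < κ) {f g : Plane → ℂ} (hf : MemLp f 2 volume)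
    (hg : MemLp g 2 volume) :
    ∫ t in Ioi 0, ∫ p : Plane × Plane,
      (heatKern κ t (p.1 - p.2) : ℂ) * (g p.1 * (starRingEnd ℂ) (f p.2)) =
    ∫ p : Plane × Plane, (kern κ (p.1 - p.2) : ℂ) * (g p.1 * (starRingEnd ℂ) (f p.2)) := by
  rw [Measure.volume_eq_prod Plane Plane]
  rw [integral_integral_swap (integrable_heatKern_mul hκ hf hg)]
  refine integral_congr_ae (.of_forall fun p => ?_)
  simp only [kern]
  rw [integral_mul_const, integral_complex_ofReal]

/-! ### The kernel represents the free resolvent -/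

theorem integral_exp_neg_symbol {κ : ℝ} (hκ : 0 < κ) (ξ : Plane) :
    ∫ t in Ioi 0, Real.exp (-(κ ^ 2 * t)) * Real.exp (-((2 * Real.pi) ^ 2 * t) * ‖ξ‖ ^ 2) =
      symbol κ ξ := by
  have h := integral_exp_mul_Ioi (a := -(κ ^ 2 + (2 * Real.pi) ^ 2 * ‖ξ‖ ^ 2))
    (neg_lt_zero.2 (symbol_den_pos hκ ξ)) 0
  rw [mul_zero, Real.exp_zero, neg_div_neg_eq, one_div] at h
  rw [symbol, ← h]
  congr with t
  rw [← Real.exp_add]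
  ring_nf

theorem fourier_gaussian_plane {t : ℝ} (ht : 0 < t) (x y : Plane) :
    𝓕 (fun ξ : Plane => (Real.exp (-((2 * Real.pi) ^ 2 * t) * ‖ξ‖ ^ 2) : ℂ) *
      (starRingEnd ℂ) (wave ξ x)) y =
      (((4 * Real.pi * t)⁻¹ * Real.exp (-(4 * t)⁻¹ * ‖x - y‖ ^ 2) : ℝ) : ℂ) := by
  have h := fourier_gaussian_innerProductSpace' (V := Plane) (b := (((2 * Real.pi) ^ 2 * t : ℝ) : ℂ))
    (by rw [Complex.ofReal_re]; positivity) x y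
  have h1 : (fun ξ : Plane => (Real.exp (-((2 * Real.pi) ^ 2 * t) * ‖ξ‖ ^ 2) : ℂ) *
      (starRingEnd ℂ) (wave ξ x)) = fun v : Plane => Complex.exp
        (-(((2 * Real.pi) ^ 2 * t : ℝ) : ℂ) * ‖v‖ ^ 2 + 2 * Real.pi * Complex.I * inner ℝ x v) := by
    ext ξ
    rw [Complex.exp_add, wave, AddChar.map_neg_eq_inv, Circle.coe_inv_eq_conj, Complex.conj_conj,
      Real.fourierChar_apply, real_inner_comm]
    push_cast
    congr 2
    ring
  rw [h1, h]
  have h2 : (Real.pi / (((2 * Real.pi) ^ 2 * t : ℝ) : ℂ)) ^ (Module.finrank ℝ Plane / 2 : ℂ) =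
      (((4 * Real.pi * t)⁻¹ : ℝ) : ℂ) := by
    have : (Module.finrank ℝ Plane / 2 : ℂ) = 1 := by simp
    rw [this, Complex.cpow_one, ← Complex.ofReal_div]
    congr 1
    have := Real.pi_pos.ne'
    field_simp
    ring
  rw [h2]
  push_cast
  congr 2
  have hp : (Real.pi : ℂ) ≠ 0 := by exact_mod_cast Real.pi_pos.ne'
  have ht' : (t : ℂ) ≠ 0 := by exact_mod_cast ht.ne'
  field_simp
  ring

theorem integral_fourier_mul {f g : Plane → ℂ} (hf : Integrable f) (hg : Integrable g) :
    ∫ ξ, 𝓕 f ξ * g ξ = ∫ x, f x * 𝓕 g x := by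
  have hL : Continuous fun p : Plane × Plane => innerₗ Plane p.1 p.2 := by
    change Continuous fun p : Plane × Plane => inner ℝ p.1 p.2
    fun_prop
  have := VectorFourier.integral_fourierIntegral_smul_eq_flip (L := innerₗ Plane)
        (e := Real.fourierChar) (μ := volume) (ν := volume) Real.continuous_fourierChar hL hf hg
  simp only [smul_eq_mul] at this
  rw [flip_innerₗ] at this
  exact this

theorem continuous_fourier_plane {f : Plane → ℂ} (hf : Integrable f) : Continuous (𝓕 f) := by
  have hL : Continuous fun p : Plane × Plane => innerₗ Plane p.1 p.2 := by
    change Continuous fun p : Plane × Plane => inner ℝ p.1 p.2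
    fun_prop
  exact VectorFourier.fourierIntegral_continuous Real.continuous_fourierChar hL hf

theorem norm_fourier_le_integral (f : Plane → ℂ) (ξ : Plane) : ‖𝓕 f ξ‖ ≤ ∫ x, ‖f x‖ :=
  VectorFourier.norm_fourierIntegral_le_integral_norm _ _ _ _ _

theorem integrable_gaussian_fourier {t : ℝ} (ht : 0 < t) :
    Integrable fun ξ : Plane => Real.exp (-((2 * Real.pi) ^ 2 * t) * ‖ξ‖ ^ 2) := by
  have := integrable_gaussian_plane (t := (4 * ((2 * Real.pi) ^ 2 * t))⁻¹) (by positivity)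
  convert this using 5
  field_simp

/-- The multiplication formula `∫ 𝓕g · h = ∫ g · 𝓕h`, used twice, moves both transforms onto the
Gaussian, whose transform is the heat kernel. -/
theorem integral_gaussian_fourier_mul {t : ℝ} (ht : 0 < t) {f g : Plane → ℂ} (hf : Integrable f)
    (hg : Integrable g) :
    ∫ ξ, (Real.exp (-((2 * Real.pi) ^ 2 * t) * ‖ξ‖ ^ 2) : ℂ) *
        (𝓕 g ξ * (starRingEnd ℂ) (𝓕 f ξ)) =
      ∫ x, g x * ∫ y, (((4 * Real.pi * t)⁻¹ * Real.exp (-(4 * t)⁻¹ * ‖x - y‖ ^ 2) : ℝ) : ℂ) *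
        (starRingEnd ℂ) (f y) := by
  have hG := (integrable_gaussian_fourier ht).ofReal (𝕜 := ℂ)
  have hfb : Integrable fun ξ : Plane => (Real.exp (-((2 * Real.pi) ^ 2 * t) * ‖ξ‖ ^ 2) : ℂ) *
      (starRingEnd ℂ) (𝓕 f ξ) :=
    hG.mul_bdd (c := ∫ x, ‖f x‖)
      (Complex.continuous_conj.comp (continuous_fourier_plane hf)).aestronglyMeasurable
      (.of_forall fun ξ => by
        rw [RCLike.norm_conj]; exact norm_fourier_le_integral f ξ)
  calc _ = ∫ ξ, 𝓕 g ξ * ((Real.exp (-((2 * Real.pi) ^ 2 * t) * ‖ξ‖ ^ 2) : ℂ) *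
      (starRingEnd ℂ) (𝓕 f ξ)) := by
        congr with ξ
        ring
    _ = _ := integral_fourier_mul hg hfb
    _ = _ := by
        refine integral_congr_ae (.of_forall fun x => ?_)
        simp only
        congr 1
        have hGx : Integrable fun ξ : Plane =>
            (Real.exp (-((2 * Real.pi) ^ 2 * t) * ‖ξ‖ ^ 2) : ℂ) * (starRingEnd ℂ) (wave ξ x) :=
          hG.mul_bdd (c := 1)
            (Complex.continuous_conj.comp (continuous_wave_left x)).aestronglyMeasurable
            (.of_forall fun ξ => by simp)
        have h1 := integral_fourier_mul hf hGx
        simp only [fourier_gaussian_plane ht] at h1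
        rw [Real.fourier_eq]
        have h2 := congrArg (starRingEnd ℂ) h1
        rw [← integral_conj, ← integral_conj] at h2
        refine Eq.trans ?_ (h2.trans ?_)
        · congr with ξ
          rw [Circle.smul_def, smul_eq_mul, wave, map_mul, map_mul, Complex.conj_conj,
            Complex.conj_ofReal]
          ring
        · congr with y
          rw [map_mul, Complex.conj_ofReal]
          ring

/-- Write the symbol as `∫ exp(-κ²t) exp(-4π²t‖ξ‖²) dt`, pass to position space at each fixed `t`,
and integrate over `t` again. Integrability of `f` and `g` permits the use of their pointwise
Fourier integrals. -/
theorem inner_freeRes_eq_kern {κ : ℝ} (hκ : 0 < κ) {f g : L2} (hf : Integrable f)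
    (hg : Integrable g) :
    inner ℂ (freeRes κ hκ f) g =
      ∫ p : Plane × Plane, (kern κ (p.1 - p.2) : ℂ) * (g p.1 * (starRingEnd ℂ) (f p.2)) := by
  have hF : MemLp (fun ξ => 𝓕 (f : Plane → ℂ) ξ) 2 volume :=
    (Lp.memLp (fourierL2 f)).ae_eq (fourierL2_ae_eq f hf)
  have hG : MemLp (fun ξ => 𝓕 (g : Plane → ℂ) ξ) 2 volume :=
    (Lp.memLp (fourierL2 g)).ae_eq (fourierL2_ae_eq g hg)
  have hGF : Integrable fun ξ : Plane => 𝓕 (g : Plane → ℂ) ξ *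
      (starRingEnd ℂ) (𝓕 (f : Plane → ℂ) ξ) :=
    memLp_one_iff_integrable.1 (hF.star.mul hG)
  rw [inner_freeRes_eq, ← integral_heatKern_mul hκ (Lp.memLp f) (Lp.memLp g)]
  have e1 : ∫ ξ, (symbol κ ξ : ℂ) * (fourierL2 g ξ * (starRingEnd ℂ) (fourierL2 f ξ)) =
      ∫ ξ : Plane, ∫ t in Ioi 0, ((Real.exp (-(κ ^ 2 * t)) *
        Real.exp (-((2 * Real.pi) ^ 2 * t) * ‖ξ‖ ^ 2) : ℝ) : ℂ) *
        (𝓕 (g : Plane → ℂ) ξ * (starRingEnd ℂ) (𝓕 (f : Plane → ℂ) ξ)) := by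
    refine integral_congr_ae ?_
    filter_upwards [fourierL2_ae_eq f hf, fourierL2_ae_eq g hg] with ξ h1 h2
    rw [integral_mul_const, integral_complex_ofReal, integral_exp_neg_symbol hκ, h1, h2]
  have e2 : Integrable (fun q : Plane × ℝ => ((Real.exp (-(κ ^ 2 * q.2)) *
        Real.exp (-((2 * Real.pi) ^ 2 * q.2) * ‖q.1‖ ^ 2) : ℝ) : ℂ) *
        (𝓕 (g : Plane → ℂ) q.1 * (starRingEnd ℂ) (𝓕 (f : Plane → ℂ) q.1)))
      (volume.prod (volume.restrict (Ioi 0))) := by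
    have h3 := hGF.mul_prod ((integrableOn_exp_neg_sq_mul hκ).ofReal (𝕜 := ℂ))
    refine h3.mono ?_ ?_
    · refine AEStronglyMeasurable.mul ?_ hGF.1.comp_fst
      exact Continuous.aestronglyMeasurable (by fun_prop)
    · have : ∀ᵐ q : Plane × ℝ ∂(volume.prod (volume.restrict (Ioi 0))), q.2 ∈ Ioi (0 : ℝ) :=
        Measure.quasiMeasurePreserving_snd.ae (ae_restrict_mem measurableSet_Ioi)
      filter_upwards [this] with q hq
      rw [norm_mul, mul_comm, norm_mul (_ * _)]
      gcongr
      rw [Complex.norm_real, RCLike.norm_ofReal, norm_mul, Real.norm_eq_abs]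
      refine mul_le_of_le_one_right (abs_nonneg _) ?_
      rw [Real.norm_eq_abs, Real.abs_exp, Real.exp_le_one_iff, neg_mul, neg_nonpos]
      have : 0 < q.2 := hq
      positivity
  rw [e1, integral_integral_swap e2]
  refine setIntegral_congr_fun measurableSet_Ioi fun t ht => ?_
  have e3 : Integrable (fun p : Plane × Plane => (heatKern κ t (p.1 - p.2) : ℂ) *
      (g p.1 * (starRingEnd ℂ) (f p.2))) (volume.prod volume) := by
    have hfg := hg.mul_prod (f := (g : Plane → ℂ)) (g := fun y => (starRingEnd ℂ) (f y))
      ((Complex.conjLIE : ℂ ≃L[ℝ] ℂ).integrable_comp_iff.2 hf)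
    refine hfg.bdd_mul (c := Real.exp (-(κ ^ 2 * t)) * (4 * Real.pi * t)⁻¹) ?_
      (.of_forall fun p => ?_)
    · unfold heatKern
      exact Continuous.aestronglyMeasurable (by fun_prop)
    · have ht' : 0 < t := ht
      rw [Complex.norm_real, Real.norm_of_nonneg (heatKern_nonneg κ ht _), heatKern, ← mul_assoc]
      refine mul_le_of_le_one_right (by positivity) ?_
      rw [Real.exp_le_one_iff, neg_mul, neg_nonpos]
      positivity
  rw [Measure.volume_eq_prod Plane Plane, integral_prod _ e3]
  have e4 := integral_gaussian_fourier_mul ht hf hg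
  calc _ = (Real.exp (-(κ ^ 2 * t)) : ℂ) *
      ∫ ξ, (Real.exp (-((2 * Real.pi) ^ 2 * t) * ‖ξ‖ ^ 2) : ℂ) *
        (𝓕 (g : Plane → ℂ) ξ * (starRingEnd ℂ) (𝓕 (f : Plane → ℂ) ξ)) := by
        rw [← integral_const_mul]
        congr with ξ
        push_cast
        ring
    _ = _ := by
        rw [e4, ← integral_const_mul]
        refine integral_congr_ae (.of_forall fun x => ?_)
        simp only
        rw [← mul_assoc, ← integral_const_mul]
        congr with y
        simp only [heatKern]
        push_cast
        ring

/-! ### The kernel as an integral over the line -/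

theorem kern_eq {κ : ℝ} (hκ : 0 < κ) {z : Plane} (hz : z ≠ 0) :
    kern κ z = (4 * Real.pi)⁻¹ * ∫ s : ℝ, Real.exp (-(κ * ‖z‖ * Real.cosh s)) := by
  have hr : 0 < ‖z‖ := norm_pos_iff.2 hz
  -- The substitution `t = c exp s` with this `c` balances the two exponents: `κ²t` and `‖z‖²/(4t)`
  -- become `κ‖z‖ exp(±s)/2`, whose sum is `κ‖z‖ cosh s`.
  set c := ‖z‖ / (2 * κ) with hc
  have hc0 : 0 < c := by positivity
  have himg : (fun s : ℝ => c * Real.exp s) '' univ = Ioi 0 := by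
    ext t
    simp only [image_univ, mem_range, mem_Ioi]
    constructor
    · rintro ⟨s, rfl⟩
      positivity
    · intro ht
      exact ⟨Real.log (t / c), by rw [Real.exp_log (by positivity)]; field_simp⟩
  rw [kern, ← himg, integral_image_eq_integral_abs_deriv_smul MeasurableSet.univ
    (fun s _ => ((Real.hasDerivAt_exp s).const_mul c).hasDerivWithinAt)
    (fun s _ s' _ h => Real.exp_injective (mul_left_cancel₀ hc0.ne' h)), Measure.restrict_univ,
    ← integral_const_mul]
  congr with s
  have h1 : 0 < Real.exp s := Real.exp_pos s
  rw [abs_of_pos (by positivity), smul_eq_mul, heatKern]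
  have h2 : Real.exp (-(κ * ‖z‖ * Real.cosh s)) = Real.exp (-(κ ^ 2 * (c * Real.exp s))) *
      Real.exp (-(4 * (c * Real.exp s))⁻¹ * ‖z‖ ^ 2) := by
    rw [← Real.exp_add]
    congr 1
    rw [Real.cosh_eq, Real.exp_neg, hc]
    field_simp
    ring
  rw [h2]
  field_simp

theorem integrable_exp_neg_cosh {a : ℝ} (ha : 0 < a) :
    Integrable fun s : ℝ => Real.exp (-(a * Real.cosh s)) := by
  have h := integrable_exp_neg_mul_sq (b := a / 2) (by positivity)
  refine h.mono (by fun_prop) (.of_forall fun s => ?_)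
  rw [Real.norm_of_nonneg (Real.exp_pos _).le, Real.norm_of_nonneg (Real.exp_pos _).le]
  gcongr
  have h1 : s ^ 2 / 2 ≤ Real.cosh s := by
    have h2 : Real.cosh s = 1 + 2 * Real.sinh (s / 2) ^ 2 := by
      have := Real.cosh_two_mul (s / 2)
      rw [mul_div_cancel₀ s (two_ne_zero' ℝ), Real.cosh_sq] at this
      linarith
    have h3 : (s / 2) ^ 2 ≤ Real.sinh (s / 2) ^ 2 := by
      rw [sq_le_sq, Real.abs_sinh]
      exact Real.self_le_sinh_iff.2 (abs_nonneg _)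
    linarith
  nlinarith

/-! ### The quadratic form of the free resolvent -/

/-- The bilinear form `⟨f, (-Δ + κ²)⁻¹ g⟩` for real functions `f`, `g`. -/
def kernForm (κ : ℝ) (f g : Plane → ℝ) : ℝ :=
  ∫ p : Plane × Plane, kern κ (p.1 - p.2) * (f p.1 * g p.2)

theorem integrable_kern_mul_real {κ : ℝ} (hκ : 0 < κ) {f g : Plane → ℝ} (hf : MemLp f 2 volume)
    (hg : MemLp g 2 volume) :
    Integrable (fun p : Plane × Plane => kern κ (p.1 - p.2) * (f p.1 * g p.2))
      (volume.prod volume) := by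
  refine (integrable_kern_mul hκ (hg.ofReal (K := ℂ)) (hf.ofReal (K := ℂ))).re.congr (.of_forall fun p => ?_)
  simp [← Complex.ofReal_mul]

theorem kernForm_add_left {κ : ℝ} (hκ : 0 < κ) {f f' g : Plane → ℝ} (hf : MemLp f 2 volume)
    (hf' : MemLp f' 2 volume) (hg : MemLp g 2 volume) :
    kernForm κ (f + f') g = kernForm κ f g + kernForm κ f' g := by
  unfold kernForm
  rw [Measure.volume_eq_prod, ← integral_add (integrable_kern_mul_real hκ hf hg)
    (integrable_kern_mul_real hκ hf' hg)]
  congr with p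
  simp only [Pi.add_apply]
  ring

theorem kernForm_comm (κ : ℝ) (f g : Plane → ℝ) : kernForm κ f g = kernForm κ g f := by
  unfold kernForm
  rw [Measure.volume_eq_prod, ← (Measure.measurePreserving_swap (μ := (volume : Measure Plane))
    (ν := (volume : Measure Plane))).integral_comp MeasurableEquiv.prodComm.measurableEmbedding]
  congr with p
  have : kern κ (p.2 - p.1) = kern κ (p.1 - p.2) := by
    unfold kern
    simp only [← heatKern_neg κ _ (p.2 - p.1), neg_sub]
  rw [Prod.fst_swap, Prod.snd_swap, this]
  ring

theorem kernForm_add_right {κ : ℝ} (hκ : 0 < κ) {f g g' : Plane → ℝ} (hf : MemLp f 2 volume)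
    (hg : MemLp g 2 volume) (hg' : MemLp g' 2 volume) :
    kernForm κ f (g + g') = kernForm κ f g + kernForm κ f g' := by
  rw [kernForm_comm, kernForm_add_left hκ hg hg' hf, kernForm_comm κ g, kernForm_comm κ g']

theorem kernForm_smul_left (κ c : ℝ) (f g : Plane → ℝ) :
    kernForm κ (c • f) g = c * kernForm κ f g := by
  unfold kernForm
  rw [← integral_const_mul]
  congr with p
  simp only [Pi.smul_apply, smul_eq_mul]
  ring

theorem kernForm_smul_right (κ c : ℝ) (f g : Plane → ℝ) :
    kernForm κ f (c • g) = c * kernForm κ f g := by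
  rw [kernForm_comm, kernForm_smul_left, kernForm_comm]

theorem kernForm_sum_left {κ : ℝ} (hκ : 0 < κ) {ι : Type*} (s : Finset ι) {f : ι → Plane → ℝ}
    {g : Plane → ℝ} (hf : ∀ i ∈ s, MemLp (f i) 2 volume) (hg : MemLp g 2 volume) :
    kernForm κ (∑ i ∈ s, f i) g = ∑ i ∈ s, kernForm κ (f i) g := by
  classical
  induction s using Finset.induction_on with
  | empty => simp [kernForm]
  | insert a s ha ih =>
    rw [Finset.sum_insert ha, Finset.sum_insert ha, kernForm_add_left hκ
      (hf a (Finset.mem_insert_self _ _)) (memLp_finsetSum' s fun i hi =>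
        hf i (Finset.mem_insert_of_mem hi)) hg, ih fun i hi => hf i (Finset.mem_insert_of_mem hi)]

theorem kernForm_sum_right {κ : ℝ} (hκ : 0 < κ) {ι : Type*} (s : Finset ι) {f : Plane → ℝ}
    {g : ι → Plane → ℝ} (hf : MemLp f 2 volume) (hg : ∀ i ∈ s, MemLp (g i) 2 volume) :
    kernForm κ f (∑ i ∈ s, g i) = ∑ i ∈ s, kernForm κ f (g i) := by
  rw [kernForm_comm, kernForm_sum_left hκ s hg hf]
  exact Finset.sum_congr rfl fun i _ => kernForm_comm _ _ _

theorem heatKern_linearIsometryEquiv (κ t : ℝ) (e : Plane ≃ₗᵢ[ℝ] Plane) (z : Plane) :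
    heatKern κ t (e z) = heatKern κ t z := by
  simp [heatKern]

theorem kern_linearIsometryEquiv (κ : ℝ) (e : Plane ≃ₗᵢ[ℝ] Plane) (z : Plane) :
    kern κ (e z) = kern κ z := by
  simp [kern, heatKern_linearIsometryEquiv]

theorem kernForm_comp (κ : ℝ) (e : Plane ≃ₗᵢ[ℝ] Plane) (f g : Plane → ℝ) :
    kernForm κ (f ∘ e) (g ∘ e) = kernForm κ f g := by
  unfold kernForm
  rw [Measure.volume_eq_prod]
  refine Eq.trans ?_ ((e.measurePreserving.prod e.measurePreserving).integral_comp
    (e.toHomeomorph.measurableEmbedding.prodMap e.toHomeomorph.measurableEmbedding) _)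
  congr with p
  simp only [Prod.map_fst, Prod.map_snd, ← map_sub, kern_linearIsometryEquiv, Function.comp_apply]

theorem inner_freeRes_ofReal {κ : ℝ} (hκ : 0 < κ) {f g : Plane → ℝ} (hf : MemLp f 2 volume)
    (hg : MemLp g 2 volume) (hf1 : Integrable f) (hg1 : Integrable g) :
    inner ℂ (freeRes κ hκ (hf.ofReal (K := ℂ)).toLp) (hg.ofReal (K := ℂ)).toLp =
      (kernForm κ g f : ℂ) := by
  rw [inner_freeRes_eq_kern hκ (hf1.ofReal.congr (hf.ofReal (K := ℂ)).coeFn_toLp.symm)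
    (hg1.ofReal.congr (hg.ofReal (K := ℂ)).coeFn_toLp.symm), kernForm, ← integral_complex_ofReal,
    Measure.volume_eq_prod]
  refine integral_congr_ae ?_
  filter_upwards [Measure.quasiMeasurePreserving_fst.ae (hg.ofReal (K := ℂ)).coeFn_toLp,
    Measure.quasiMeasurePreserving_snd.ae (hf.ofReal (K := ℂ)).coeFn_toLp] with p h1 h2
  rw [h1, h2]
  simp

/-! ### Variational estimates for `-Δ - q`, `q ≥ 0` -/

theorem MemLp.mul_bounded {q w : Plane → ℝ} (hq : MemLp q 2 volume) (hw : MemLp w ∞ volume) :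
    MemLp (q * w) 2 volume := hw.mul hq

theorem integrable_mul_bounded {q w : Plane → ℝ} (hq : Integrable q) (hw : MemLp w ∞ volume) :
    Integrable (q * w) :=
  memLp_one_iff_integrable.1 (hw.mul (memLp_one_iff_integrable.2 hq) (r := 1))

/-- The density `q w` as an element of the complex `L²(ℝ²)`. -/
def density {q : Plane → ℝ} (hq : MemLp q 2 volume) {w : Plane → ℝ} (hw : MemLp w ∞ volume) : L2 :=
  ((MemLp.mul_bounded hq hw).ofReal (K := ℂ)).toLp

theorem inner_potentialH2_self {q : Plane → ℝ} (hq : MemLp q 2 volume) (u : sobolevH2) :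
    inner ℂ (u : L2) (potentialH2 (-q) hq.neg u) = -((∫ x, q x * ‖(u : L2) x‖ ^ 2 : ℝ) : ℂ) := by
  rw [inner_eq_integral, ← integral_complex_ofReal, ← integral_neg]
  refine integral_congr_ae ?_
  filter_upwards [(memLp_mul_of_mem_sobolevH2 hq.neg u).coeFn_toLp] with x h1
  change (memLp_mul_of_mem_sobolevH2 hq.neg u).toLp _ x * _ = _
  rw [h1, mul_assoc, Complex.mul_conj, Complex.normSq_eq_norm_sq]
  simp

/-- Test the form bound with `u = (-Δ + κ²)⁻¹ (q w)`. The kinetic part is `⟨u, qw⟩ - κ²‖u‖²` with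
`⟨u, qw⟩ = kernForm κ (q * w) (q * w)`, and expanding `0 ≤ ∫ q |u - w|²` bounds the potential part
by `∫ q |u|² ≥ 2⟨u, qw⟩ - ∫ q w²`. This is the quantitative half of the Birman-Schwinger principle;
it needs `q ≥ 0`. -/
theorem trial_estimate {q : Plane → ℝ} (hq : MemLp q 2 volume) (hq1 : Integrable q)
    (hq0 : ∀ᵐ x, 0 ≤ q x) {ε : ℝ}
    (hε : ∀ u : sobolevH2, ε * ‖(u : L2)‖ ^ 2 ≤
        (inner ℂ (u : L2) (-laplacianH2 u + potentialH2 (-q) hq.neg u)).re)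
    {κ : ℝ} (hκ : 0 < κ) {w : Plane → ℝ} (hw : MemLp w ∞ volume) :
    kernForm κ (q * w) (q * w) - ∫ x, q x * w x ^ 2 ≤
      (-κ ^ 2 - ε) * ‖freeRes κ hκ (density hq hw)‖ ^ 2 := by
  set f := density hq hw with hf
  set u := freeResH2 κ hκ f with hu
  have hu' : (u : L2) = freeRes κ hκ f := rfl
  have e1 : inner ℂ (u : L2) f = (kernForm κ (q * w) (q * w) : ℂ) :=
    inner_freeRes_ofReal hκ (MemLp.mul_bounded hq hw) (MemLp.mul_bounded hq hw)
      (integrable_mul_bounded hq1 hw) (integrable_mul_bounded hq1 hw)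
  have e2 : -laplacianH2 u = f - ((κ ^ 2 : ℝ) : ℂ) • (u : L2) := by
    rw [eq_sub_iff_add_eq]
    exact helmholtz_freeRes hκ f
  have e3 : inner ℂ (u : L2) (u : L2) = ((‖(u : L2)‖ ^ 2 : ℝ) : ℂ) := by
    push_cast
    exact inner_self_eq_norm_sq_to_K (𝕜 := ℂ) _
  have h1 := hε u
  rw [inner_add_right, e2, inner_sub_right, inner_smul_right, e1, e3, inner_potentialH2_self hq,
    ← Complex.ofReal_mul, ← Complex.ofReal_sub, ← Complex.ofReal_neg, ← Complex.ofReal_add,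
    Complex.ofReal_re] at h1
  have hub := memLp_top_of_mem_sobolevH2 u.2
  have hq1' : MemLp q 1 volume := memLp_one_iff_integrable.2 hq1
  have i1 : Integrable fun x => q x * ‖(u : L2) x‖ ^ 2 := by
    have := (hub.norm.mul (hub.norm.mul hq1' (r := 1)) (r := 1))
    refine (memLp_one_iff_integrable.1 this).congr (.of_forall fun x => ?_)
    simp only [Pi.mul_apply]
    ring
  have i2 : Integrable fun x => q x * w x ^ 2 := by
    have := (hw.mul (hw.mul hq1' (r := 1)) (r := 1))
    refine (memLp_one_iff_integrable.1 this).congr (.of_forall fun x => ?_)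
    simp only [Pi.mul_apply]
    ring
  have i3 : Integrable fun x => q x * (w x * ((u : L2) x).re) := by
    have hre : MemLp (fun x => ((u : L2) x).re) ∞ volume := hub.re
    have := (hw.mul (hre.mul hq1' (r := 1)) (r := 1))
    refine (memLp_one_iff_integrable.1 this).congr (.of_forall fun x => ?_)
    simp only [Pi.mul_apply]
    ring
  have e4 : kernForm κ (q * w) (q * w) = ∫ x, q x * (w x * ((u : L2) x).re) := by
    have h := congrArg Complex.re e1
    rw [Complex.ofReal_re, inner_eq_integral] at h
    rw [← h]
    have hi : Integrable fun x => f x * (starRingEnd ℂ) ((u : L2) x) :=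
      L2.integrable_inner (𝕜 := ℂ) (u : L2) f
    have h' : (∫ x, f x * (starRingEnd ℂ) ((u : L2) x)).re =
        ∫ x, (f x * (starRingEnd ℂ) ((u : L2) x)).re := (integral_re hi).symm
    rw [h']
    refine integral_congr_ae ?_
    filter_upwards [((MemLp.mul_bounded hq hw).ofReal (K := ℂ)).coeFn_toLp] with x hx
    have hx' : f x = (((q * w) x : ℝ) : ℂ) := hx
    rw [hx', Complex.re_ofReal_mul, Complex.conj_re, Pi.mul_apply]
    ring
  have h2 : 0 ≤ ∫ x, (q x * ‖(u : L2) x‖ ^ 2 - 2 * (q x * (w x * ((u : L2) x).re)) +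
      q x * w x ^ 2) := by
    refine integral_nonneg_of_ae ?_
    filter_upwards [hq0] with x hx
    have : (((u : L2) x).re) ^ 2 ≤ ‖(u : L2) x‖ ^ 2 := by
      rw [sq_le_sq, abs_norm]
      exact Complex.abs_re_le_norm _
    have h5 : 0 ≤ ‖(u : L2) x‖ ^ 2 - 2 * (w x * ((u : L2) x).re) + w x ^ 2 := by
      nlinarith [sq_nonneg (w x - ((u : L2) x).re)]
    have := mul_nonneg hx h5
    simp only [Pi.zero_apply]
    linarith
  have i4 : Integrable fun x => q x * ‖(u : L2) x‖ ^ 2 - 2 * (q x * (w x * ((u : L2) x).re)) :=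
    i1.sub (i3.const_mul 2)
  rw [integral_add i4 i2, integral_sub i1 (i3.const_mul 2),
    integral_const_mul, ← e4] at h2
  rw [← hu']
  linarith

theorem kernForm_le_of_isLeast {q : Plane → ℝ} (hq : MemLp q 2 volume) (hq1 : Integrable q)
    (hq0 : ∀ᵐ x, 0 ≤ q x) {κ : ℝ} (hκ : 0 < κ)
    (hε : ∀ u : sobolevH2, -κ ^ 2 * ‖(u : L2)‖ ^ 2 ≤
        (inner ℂ (u : L2) (-laplacianH2 u + potentialH2 (-q) hq.neg u)).re)
    {w : Plane → ℝ} (hw : MemLp w ∞ volume) :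
    kernForm κ (q * w) (q * w) ≤ ∫ x, q x * w x ^ 2 := by
  have := trial_estimate hq hq1 hq0 hε hκ hw
  linarith

theorem freeRes_eq_zero {κ : ℝ} (hκ : 0 < κ) {f : L2} (h : freeRes κ hκ f = 0) : f = 0 := by
  have h5 : freeResH2 κ hκ f = 0 := Subtype.ext h
  rw [← helmholtz_freeRes hκ f, h, h5]
  simp

theorem density_ne_zero {q : Plane → ℝ} (hq : MemLp q 2 volume) {w : Plane → ℝ}
    (hw : MemLp w ∞ volume) (h : ¬ (q * w) =ᵐ[volume] 0) : density hq hw ≠ 0 := by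
  intro h0
  apply h
  have h1 := ((MemLp.mul_bounded hq hw).ofReal (K := ℂ)).coeFn_toLp
  have h2 : (density hq hw : Plane → ℂ) =ᵐ[volume] 0 := by
    rw [h0]
    exact Lp.coeFn_zero _ _ _
  filter_upwards [h1, h2] with x hx hx'
  have hx2 : (((q * w) x : ℝ) : ℂ) = 0 := hx.symm.trans hx'
  exact_mod_cast hx2

/-- The absolute value of an eigenfunction is a maximizer of the form. -/
theorem exists_integral_le_kernForm {q : Plane → ℝ} (hq : MemLp q 2 volume) (hq1 : Integrable q)
    (hq0 : ∀ᵐ x, 0 ≤ q x) {κ : ℝ} (hκ : 0 < κ)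
    (he : IsEigenvalue (schrodinger (-q) hq.neg) (-κ ^ 2)) :
    ∃ w : Plane → ℝ, MemLp w ∞ volume ∧ (∀ x, 0 ≤ w x) ∧ ¬ (q * w) =ᵐ[volume] 0 ∧
      ∫ x, q x * w x ^ 2 ≤ kernForm κ (q * w) (q * w) := by
  obtain ⟨u, hu0, hu⟩ := he
  suffices H : ∀ u : sobolevH2, (u : L2) ≠ 0 → -laplacianH2 u + potentialH2 (-q) hq.neg u =
      ((-κ ^ 2 : ℝ) : ℂ) • (u : L2) → ∃ w : Plane → ℝ, MemLp w ∞ volume ∧ (∀ x, 0 ≤ w x) ∧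
      ¬ (q * w) =ᵐ[volume] 0 ∧ ∫ x, q x * w x ^ 2 ≤ kernForm κ (q * w) (q * w) from H u hu0 hu
  clear! u
  intro u hu0 hu
  have hub := memLp_top_of_mem_sobolevH2 u.2
  have hwb : MemLp (fun x => ‖(u : L2) x‖) ∞ volume := hub.norm
  set f : L2 := -potentialH2 (-q) hq.neg u with hf
  have hfx : ∀ᵐ x, f x = (q x : ℂ) * (u : L2) x := by
    filter_upwards [(memLp_mul_of_mem_sobolevH2 hq.neg u).coeFn_toLp,
      Lp.coeFn_neg (potentialH2 (-q) hq.neg u)] with x h1 h2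
    rw [hf, h2, Pi.neg_apply]
    change -((memLp_mul_of_mem_sobolevH2 hq.neg u).toLp _ x) = _
    rw [h1]
    simp
  have hGf : freeRes κ hκ f = u := by
    rw [← freeRes_helmholtz hκ u]
    congr 1
    rw [hf, ← sub_eq_zero]
    have := sub_eq_zero.2 hu
    push_cast at this ⊢
    rw [← neg_eq_zero, ← this]
    module
  have hf1 : Integrable f := by
    have h1 : Integrable fun x => (q x : ℂ) * (u : L2) x :=
      memLp_one_iff_integrable.1
        (hub.mul (memLp_one_iff_integrable.2 (hq1.ofReal (𝕜 := ℂ))) (r := 1))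
    exact h1.congr (Filter.EventuallyEq.symm hfx)
  refine ⟨fun x => ‖(u : L2) x‖, hwb, fun x => norm_nonneg _, fun h0 => hu0 ?_, ?_⟩
  · have : f = 0 := by
      apply Lp.ext
      filter_upwards [hfx, h0, Lp.coeFn_zero ℂ 2 (volume : Measure Plane)] with x h1 h2 h3
      rw [h1, h3, Pi.zero_apply, ← norm_eq_zero, norm_mul, Complex.norm_real]
      have h2' : q x * ‖(u : L2) x‖ = 0 := h2
      rcases mul_eq_zero.1 h2' with h | h <;> simp [h]
    rw [← hGf, this, map_zero]
  · have e1 := inner_freeRes_eq_kern hκ hf1 hf1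
    rw [hGf] at e1
    have e2 : inner ℂ (u : L2) f = ((∫ x, q x * ‖(u : L2) x‖ ^ 2 : ℝ) : ℂ) := by
      rw [hf, inner_neg_right, inner_potentialH2_self hq, neg_neg]
    rw [e2] at e1
    have e3 := congrArg Complex.re e1
    rw [Complex.ofReal_re] at e3
    rw [e3]
    -- The eigenvalue equation says `G(qu) = u`, so `∫ q|u|²` is the kernel form of `qu`. The kernel
    -- is nonnegative, hence replacing `u` by `|u|` can only increase the double integral.
    refine (Complex.re_le_norm _).trans ((norm_integral_le_integral_norm _).trans_eq ?_)
    rw [kernForm, Measure.volume_eq_prod]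
    refine integral_congr_ae ?_
    filter_upwards [Measure.quasiMeasurePreserving_fst.ae hfx,
      Measure.quasiMeasurePreserving_snd.ae hfx, Measure.quasiMeasurePreserving_fst.ae hq0,
      Measure.quasiMeasurePreserving_snd.ae hq0] with p h1 h2 h3 h4
    rw [h1, h2]
    simp only [norm_mul, Complex.norm_real, RCLike.norm_conj, Pi.mul_apply,
      Real.norm_of_nonneg (kern_nonneg _ _), Real.norm_of_nonneg h3, Real.norm_of_nonneg h4]

/-! ### Null vectors of the form -/

/-- The bounded functions on which the (nonpositive) form `⟨q w, (-Δ + κ²)⁻¹ q w⟩ - ∫ q w²`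
vanishes. -/
def IsNullVector (κ : ℝ) (q w : Plane → ℝ) : Prop :=
  MemLp w ∞ volume ∧ kernForm κ (q * w) (q * w) = ∫ x, q x * w x ^ 2

/-- For null vectors `w`, `v` of a nonpositive quadratic form, the form at `w + t v` is linear in
`t`. Being nonpositive at `t = 1` and at `t = -1`, it has zero slope. Thus optimizers can be
symmetrized by summation, without uniqueness of the ground state. -/
theorem IsNullVector.add {q : Plane → ℝ} (hq : MemLp q 2 volume) (hq1 : Integrable q) {κ : ℝ}
    (hκ : 0 < κ)
    (hle : ∀ w : Plane → ℝ, MemLp w ∞ volume → kernForm κ (q * w) (q * w) ≤ ∫ x, q x * w x ^ 2)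
    {w v : Plane → ℝ} (hw : IsNullVector κ q w) (hv : IsNullVector κ q v) :
    IsNullVector κ q (w + v) := by
  have hq1' : MemLp q 1 volume := memLp_one_iff_integrable.2 hq1
  have hint : ∀ {a b : Plane → ℝ}, MemLp a ∞ volume → MemLp b ∞ volume →
      Integrable fun x => q x * (a x * b x) := fun {a b} ha hb => by
    refine (memLp_one_iff_integrable.1 (ha.mul (hb.mul hq1' (r := 1)) (r := 1))).congr
      (.of_forall fun x => ?_)
    simp only [Pi.mul_apply]
    ring
  have key : ∀ t : ℝ, kernForm κ (q * (w + t • v)) (q * (w + t • v)) -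
      ∫ x, q x * (w + t • v) x ^ 2 =
      2 * t * (kernForm κ (q * w) (q * v) - ∫ x, q x * (w x * v x)) := by
    intro t
    have hqw := MemLp.mul_bounded hq hw.1
    have hqv := MemLp.mul_bounded hq hv.1
    have e1 : q * (w + t • v) = q * w + t • (q * v) := by
      rw [mul_add, mul_smul_comm]
    have e2 : ∫ x, q x * (w + t • v) x ^ 2 =
        ∫ x, (q x * (w x * w x) + ((2 * t) * (q x * (w x * v x)) + t ^ 2 * (q x * (v x * v x)))) := by
      congr with x
      simp only [Pi.add_apply, Pi.smul_apply, smul_eq_mul]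
      ring
    have i1 : Integrable fun x => (2 * t) * (q x * (w x * v x)) + t ^ 2 * (q x * (v x * v x)) :=
      ((hint hw.1 hv.1).const_mul _).add ((hint hv.1 hv.1).const_mul _)
    rw [e1, e2, integral_add (hint hw.1 hw.1) i1,
      integral_add ((hint hw.1 hv.1).const_mul _) ((hint hv.1 hv.1).const_mul _),
      integral_const_mul, integral_const_mul,
      kernForm_add_left hκ hqw (hqv.const_smul t) (hqw.add (hqv.const_smul t)),
      kernForm_add_right hκ hqw hqw (hqv.const_smul t),
      kernForm_add_right hκ (hqv.const_smul t) hqw (hqv.const_smul t),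
      kernForm_smul_left, kernForm_smul_left, kernForm_smul_right, kernForm_smul_right,
      hw.2, hv.2, kernForm_comm κ (q * v) (q * w)]
    simp only [← pow_two]
    ring
  have h0 : kernForm κ (q * w) (q * v) - ∫ x, q x * (w x * v x) = 0 := by
    have h1 := key 1
    have h2 := key (-1)
    have h3 := hle (w + (1 : ℝ) • v) (hw.1.add (hv.1.const_smul _))
    have h4 := hle (w + (-1 : ℝ) • v) (hw.1.add (hv.1.const_smul _))
    linarith
  refine ⟨hw.1.add hv.1, ?_⟩
  have h1 := key 1
  rw [h0, mul_zero, one_smul] at h1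
  linarith

theorem IsNullVector.sum {q : Plane → ℝ} (hq : MemLp q 2 volume) (hq1 : Integrable q) {κ : ℝ}
    (hκ : 0 < κ)
    (hle : ∀ w : Plane → ℝ, MemLp w ∞ volume → kernForm κ (q * w) (q * w) ≤ ∫ x, q x * w x ^ 2)
    {ι : Type*} (s : Finset ι) {w : ι → Plane → ℝ} (hw : ∀ i ∈ s, IsNullVector κ q (w i)) :
    IsNullVector κ q (∑ i ∈ s, w i) := by
  classical
  induction s using Finset.induction_on with
  | empty => exact ⟨MemLp.zero, by simp [kernForm]⟩
  | insert a s ha ih =>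
    rw [Finset.sum_insert ha]
    exact (hw a (Finset.mem_insert_self _ _)).add hq hq1 hκ hle
      (ih fun i hi => hw i (Finset.mem_insert_of_mem hi))

theorem memLp_comp_isometry {f : Plane → ℝ} {p : ℝ≥0∞} (hf : MemLp f p volume) (e : Plane ≃ₗᵢ[ℝ] Plane) :
    MemLp (f ∘ e) p volume := hf.comp_measurePreserving e.measurePreserving

theorem IsNullVector.comp {κ : ℝ} {q w : Plane → ℝ} (hw : IsNullVector κ q w)
    (e : Plane ≃ₗᵢ[ℝ] Plane) (he : q ∘ e = q) : IsNullVector κ q (w ∘ e) := by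
  refine ⟨memLp_comp_isometry hw.1 e, ?_⟩
  have e1 : q * (w ∘ e) = (q * w) ∘ e := by
    nth_rw 1 [← he]
    rfl
  rw [e1, kernForm_comp, hw.2,
    ← e.measurePreserving.integral_comp e.toHomeomorph.measurableEmbedding]
  congr with x
  rw [Function.comp_apply]
  nth_rw 2 [← he]
  rfl

/-! ### Negativity of the ground state energy -/

/-- As `κ → 0` the two-dimensional kernel diverges, uniformly on bounded sets. This is why
arbitrarily weak attractive wells bind in the plane. -/
theorem exists_le_kern {C D : ℝ} (hC : 0 < C) (hD : 0 < D) :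
    ∃ κ : ℝ, 0 < κ ∧ ∀ z : Plane, z ≠ 0 → ‖z‖ ≤ D → C ≤ kern κ z := by
  -- Chosen so that `(4π)⁻¹ · 2S · exp(-1) = C`; the `κ` below makes the exponent `κ‖z‖ cosh s` at
  -- most `1` for `|s| ≤ S`.
  set S := 2 * Real.pi * Real.exp 1 * C with hS
  have hS0 : 0 < S := by positivity
  set κ := (D * Real.cosh S)⁻¹ with hκ
  have hκ0 : 0 < κ := by
    have := Real.cosh_pos S
    positivity
  refine ⟨κ, hκ0, fun z hz hzD => ?_⟩
  have hr : 0 < ‖z‖ := norm_pos_iff.2 hz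
  have h1 : ∀ s ∈ Icc (-S) S, Real.exp (-1) ≤ Real.exp (-(κ * ‖z‖ * Real.cosh s)) := by
    intro s hs
    rw [Real.exp_le_exp, neg_le_neg_iff]
    have h2 : Real.cosh s ≤ Real.cosh S := by
      rw [Real.cosh_le_cosh, abs_of_pos hS0]
      exact abs_le.2 hs
    have hc := Real.cosh_pos S
    calc κ * ‖z‖ * Real.cosh s ≤ κ * D * Real.cosh S := by
          gcongr
      _ = 1 := by rw [hκ]; field_simp
  have hi : Integrable fun s : ℝ => Real.exp (-(κ * ‖z‖ * Real.cosh s)) :=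
    integrable_exp_neg_cosh (by positivity)
  have h3 : ∫ s in Icc (-S) S, Real.exp (-1) ≤ ∫ s, Real.exp (-(κ * ‖z‖ * Real.cosh s)) :=
    (setIntegral_mono_on (by simp) hi.integrableOn measurableSet_Icc h1).trans
      (setIntegral_le_integral hi (.of_forall fun s => (Real.exp_pos _).le))
  rw [setIntegral_const, smul_eq_mul, Measure.real, Real.volume_Icc,
    ENNReal.toReal_ofReal (by linarith)] at h3
  rw [kern_eq hκ0 hz]
  calc C = (4 * Real.pi)⁻¹ * ((S - -S) * Real.exp (-1)) := by
        rw [hS, Real.exp_neg]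
        have := Real.exp_pos 1
        have := Real.pi_pos
        field_simp
        ring
    _ ≤ _ := by gcongr

theorem ae_ne_prod : ∀ᵐ p : Plane × Plane ∂((volume : Measure Plane).prod volume), p.1 ≠ p.2 := by
  have hm : MeasurableSet {p : Plane × Plane | p.1 = p.2} := measurableSet_eq_fun (by fun_prop)
    (by fun_prop)
  rw [ae_iff]
  simp only [ne_eq, not_not]
  rw [Measure.measure_prod_null hm]
  refine .of_forall fun x => ?_
  have : Prod.mk x ⁻¹' {p : Plane × Plane | p.1 = p.2} = {x} := by
    ext y
    simp [eq_comm]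
  simp only [this]
  simp

theorem exists_integral_lt_kernForm {q : Plane → ℝ} (hq : MemLp q 2 volume) (hq1 : Integrable q)
    (hq0 : ∀ᵐ x, 0 ≤ q x) (hqne : ¬ q =ᵐ[volume] 0) {D : ℝ} (hD : 0 < D)
    (hqD : ∀ x, x ∉ closedBall (0 : Plane) D → q x = 0) :
    ∃ κ : ℝ, 0 < κ ∧ ∫ x, q x < kernForm κ q q := by
  have hpos : 0 < ∫ x, q x := by
    refine lt_of_le_of_ne (integral_nonneg_of_ae hq0) fun h => hqne ?_
    exact (integral_eq_zero_iff_of_nonneg_ae hq0 hq1).1 h.symm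
  -- Points of the support are at most `2 * D` apart. The numerator `2` makes the kernel form at
  -- least `2 ∫ q`, leaving room for the strict inequality.
  obtain ⟨κ, hκ, h⟩ := exists_le_kern (C := 2 / ∫ x, q x) (D := 2 * D) (by positivity)
    (by positivity)
  refine ⟨κ, hκ, ?_⟩
  have h1 : ∫ p : Plane × Plane, (2 / ∫ x, q x) * (q p.1 * q p.2) ∂(volume.prod volume) ≤
      ∫ p : Plane × Plane, kern κ (p.1 - p.2) * (q p.1 * q p.2) ∂(volume.prod volume) := by
    refine integral_mono_ae ((hq1.mul_prod hq1).const_mul _) (integrable_kern_mul_real hκ hq hq) ?_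
    filter_upwards [ae_ne_prod, Measure.quasiMeasurePreserving_fst.ae hq0,
      Measure.quasiMeasurePreserving_snd.ae hq0] with p h1 h2 h3
    by_cases hp1 : p.1 ∈ closedBall (0 : Plane) D
    · by_cases hp2 : p.2 ∈ closedBall (0 : Plane) D
      · rw [mem_closedBall_zero_iff] at hp1 hp2
        have h4 := h (p.1 - p.2) (sub_ne_zero.2 h1)
          ((norm_sub_le _ _).trans (by linarith))
        exact mul_le_mul_of_nonneg_right h4 (mul_nonneg h2 h3)
      · simp [hqD _ hp2]
    · simp [hqD _ hp1]
  rw [integral_const_mul, integral_prod_mul] at h1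
  rw [kernForm, Measure.volume_eq_prod]
  refine lt_of_lt_of_le ?_ h1
  have : (2 / ∫ x, q x) * ((∫ x, q x) * ∫ x, q x) = 2 * ∫ x, q x := by field_simp
  rw [this]
  linarith

/-! ### The array potential -/

theorem ae_norm_eq_zero {g : ℝ → ℝ} (h : ∀ᵐ r ∂(volume.restrict (Ioi (0 : ℝ))), g r = 0) :
    ∀ᵐ x : Plane, g ‖x‖ = 0 := by
  have h1 : ∀ᵐ r ∂(volume.restrict (Ioi (0 : ℝ))), r ^ (Module.finrank ℝ Plane - 1) • |g r| = 0 := by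
    filter_upwards [h] with r hr
    simp [hr]
  have hi : Integrable (fun x : Plane => |g ‖x‖|) := by
    rw [integrable_fun_norm_addHaar (μ := volume) (f := fun r => |g r|)]
    exact (integrable_zero _ _ _).congr (Filter.EventuallyEq.symm h1)
  have h2 : ∫ x : Plane, |g ‖x‖| = 0 := by
    rw [integral_fun_norm_addHaar volume (fun r => |g r|), integral_congr_ae h1]
    simp
  rw [integral_eq_zero_iff_of_nonneg (fun x => abs_nonneg _) hi] at h2
  filter_upwards [h2] with x hx
  simpa using hx

/-- The potential of a single well of radius `ρ` centred at `y`. -/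
def well (V : ℝ → ℝ) (ρ : ℝ) (y x : Plane) : ℝ :=
  (ball y ρ).indicator (fun x => V (dist x y)) x

theorem arrayPotential_eq (V : ℝ → ℝ) (ρ : ℝ) (Y : Finset Plane) :
    arrayPotential V ρ Y = ∑ y ∈ Y, well V ρ y := by
  ext x
  simp [arrayPotential, well]

theorem well_nonneg {V : ℝ → ℝ} {ρ : ℝ}
    (hV : ∀ᵐ r ∂(volume.restrict (Ioo 0 ρ)), 0 ≤ V r) (y : Plane) : ∀ᵐ x, 0 ≤ well V ρ y x := by
  -- The sign condition is expressed as the vanishing of `min (V r) 0`, which polar coordinates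
  -- carry over from radii to the plane.
  have h1 : ∀ᵐ r ∂(volume.restrict (Ioi (0 : ℝ))),
      (Iio ρ).indicator (fun r => min (V r) 0) r = 0 := by
    rw [ae_restrict_iff' measurableSet_Ioi]
    rw [ae_restrict_iff' measurableSet_Ioo] at hV
    filter_upwards [hV] with r hr hr0
    by_cases hρ : r < ρ
    · rw [indicator_of_mem (mem_Iio.2 hρ), min_eq_right (hr ⟨hr0, hρ⟩)]
    · rw [indicator_of_notMem (fun h => hρ (mem_Iio.1 h))]
  have h2 := (measurePreserving_sub_right volume y).quasiMeasurePreserving.ae (ae_norm_eq_zero h1)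
  filter_upwards [h2] with x hx
  unfold well
  by_cases hxy : x ∈ ball y ρ
  · rw [indicator_of_mem hxy]
    rw [mem_ball] at hxy
    rw [← dist_eq_norm, indicator_of_mem (by exact hxy)] at hx
    exact min_eq_right_iff.1 hx
  · rw [indicator_of_notMem hxy]

theorem not_ae_well_eq_zero {V : ℝ → ℝ} {ρ : ℝ}
    (hV_ne : ¬ ∀ᵐ r ∂(volume.restrict (Ioo 0 ρ)), V r = 0) (y : Plane) :
    ¬ well V ρ y =ᵐ[volume] 0 := by
  intro h
  apply hV_ne
  have h1 := (measurePreserving_add_right volume y).quasiMeasurePreserving.ae h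
  have h2 : ∫ x : Plane, |(Iio ρ).indicator V ‖x‖| = 0 := by
    refine integral_eq_zero_of_ae ?_
    filter_upwards [h1] with x hx
    simp only [well, Pi.zero_apply] at hx
    by_cases hxρ : ‖x‖ < ρ
    · rw [indicator_of_mem (by simpa [mem_ball, dist_eq_norm] using hxρ)] at hx
      rw [indicator_of_mem (by exact hxρ)]
      simpa [dist_eq_norm] using hx
    · rw [indicator_of_notMem (by exact hxρ)]
      simp
  have hi : Integrable (fun x : Plane => |(Iio ρ).indicator V ‖x‖|) := by
    refine (integrable_zero Plane ℝ volume).congr ?_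
    filter_upwards [h1] with x hx
    simp only [well, Pi.zero_apply] at hx
    by_cases hxρ : ‖x‖ < ρ
    · rw [indicator_of_mem (by simpa [mem_ball, dist_eq_norm] using hxρ)] at hx
      rw [indicator_of_mem (by exact hxρ)]
      have hx' : V ‖x‖ = 0 := by simpa [dist_eq_norm] using hx
      simp [hx']
    · rw [indicator_of_notMem (by exact hxρ)]
      simp
  rw [integrable_fun_norm_addHaar (μ := volume) (f := fun r => |(Iio ρ).indicator V r|)] at hi
  rw [integral_fun_norm_addHaar volume (fun r => |(Iio ρ).indicator V r|)] at h2
  have hc : 0 < (volume : Measure Plane).real (ball (0 : Plane) 1) :=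
    ENNReal.toReal_pos (measure_ball_pos _ _ one_pos).ne' measure_ball_lt_top.ne
  have h3 : ∫ r in Ioi (0 : ℝ), r ^ (Module.finrank ℝ Plane - 1) • |(Iio ρ).indicator V r| = 0 := by
    rw [nsmul_eq_mul, smul_eq_mul] at h2
    simpa [hc.ne'] using h2
  rw [setIntegral_eq_zero_iff_of_nonneg_ae ?_ hi] at h3
  · rw [Filter.EventuallyEq, ae_restrict_iff' measurableSet_Ioi] at h3
    rw [ae_restrict_iff' measurableSet_Ioo]
    filter_upwards [h3] with r hr hr'
    have := hr hr'.1
    rw [indicator_of_mem (by exact hr'.2)] at this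
    simpa [hr'.1.ne'] using this
  · rw [Filter.EventuallyLE, ae_restrict_iff' measurableSet_Ioi]
    refine .of_forall fun r hr => ?_
    have : (0 : ℝ) < r := hr
    simp only [Pi.zero_apply, smul_eq_mul]
    positivity

theorem arrayPotential_nonneg {V : ℝ → ℝ} {ρ : ℝ}
    (hV : ∀ᵐ r ∂(volume.restrict (Ioo 0 ρ)), 0 ≤ V r) (Y : Finset Plane) :
    ∀ᵐ x, 0 ≤ arrayPotential V ρ Y x := by
  have : ∀ᵐ x, ∀ y ∈ Y, 0 ≤ well V ρ y x :=
    (Filter.eventually_all_finset Y).2 fun y _ => well_nonneg hV y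
  filter_upwards [this] with x hx
  exact Finset.sum_nonneg hx

theorem not_ae_arrayPotential_eq_zero {V : ℝ → ℝ} {ρ : ℝ}
    (hV : ∀ᵐ r ∂(volume.restrict (Ioo 0 ρ)), 0 ≤ V r)
    (hV_ne : ¬ ∀ᵐ r ∂(volume.restrict (Ioo 0 ρ)), V r = 0) {Y : Finset Plane}
    (hY : Y.Nonempty) : ¬ arrayPotential V ρ Y =ᵐ[volume] 0 := by
  intro h
  obtain ⟨y, hy⟩ := hY
  apply not_ae_well_eq_zero hV_ne y
  have : ∀ᵐ x, ∀ y ∈ Y, 0 ≤ well V ρ y x :=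
    (Filter.eventually_all_finset Y).2 fun y _ => well_nonneg hV y
  filter_upwards [this, h] with x hx h0
  have := Finset.single_le_sum (f := fun y => well V ρ y x) hx hy
  have h1 : ∑ y ∈ Y, well V ρ y x = 0 := h0
  exact le_antisymm (by simpa [h1] using this) (hx y hy)

theorem arrayPotential_eq_zero {V : ℝ → ℝ} {R ρ : ℝ} {Y : Finset Plane} (hY : ∀ y ∈ Y, ‖y‖ = R)
    (x : Plane) (hx : x ∉ closedBall (0 : Plane) (R + ρ)) : arrayPotential V ρ Y x = 0 := by
  refine Finset.sum_eq_zero fun y hy => indicator_of_notMem (fun hxy => hx ?_) _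
  rw [mem_closedBall_zero_iff]
  rw [mem_ball, dist_eq_norm] at hxy
  have := norm_le_norm_add_norm_sub' x y
  rw [hY y hy] at this
  linarith

theorem integrable_well {V : ℝ → ℝ} {ρ : ℝ} (hV : MemLp V 2 (volume.restrict (Ioo 0 ρ)))
    (y : Plane) : Integrable (well V ρ y) := by
  have h1 : MemLp (well V ρ y) 2 volume := memLp_well hV y
  have h2 : MemLp ((ball y ρ).indicator fun _ : Plane => (1 : ℝ)) 2 volume :=
    memLp_indicator_const 2 measurableSet_ball 1 (Or.inr measure_ball_lt_top.ne)
  refine (memLp_one_iff_integrable.1 (h2.mul h1 (r := 1))).congr (.of_forall fun x => ?_)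
  by_cases hx : x ∈ ball y ρ <;> simp [well, hx]

theorem integrable_arrayPotential {V : ℝ → ℝ} {ρ : ℝ}
    (hV : MemLp V 2 (volume.restrict (Ioo 0 ρ))) (Y : Finset Plane) :
    Integrable (arrayPotential V ρ Y) := by
  rw [arrayPotential_eq]
  exact integrable_finsetSum' _ fun y _ => integrable_well hV y

/-! ### The ground state energy -/

section GroundEnergy

variable {V : ℝ → ℝ} {ρ : ℝ} (hV : MemLp V 2 (volume.restrict (Ioo 0 ρ)))

theorem isLeast_groundEnergy (Y : Finset Plane) :
    IsLeast (realSpectrum (hamiltonian hV Y)) (groundEnergy hV Y) ∧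
      ∀ u : sobolevH2, groundEnergy hV Y * ‖(u : L2)‖ ^ 2 ≤
        (inner ℂ (u : L2) (-laplacianH2 u + potentialH2 (-arrayPotential V ρ Y)
          (memLp_arrayPotential hV Y).neg u)).re := by
  obtain ⟨ε, h1, h2⟩ := exists_isLeast_schrodinger (memLp_arrayPotential hV Y).neg
  have : groundEnergy hV Y = ε := h1.csInf_eq
  rw [this]
  exact ⟨h1, h2⟩

theorem groundEnergy_lt {Y : Finset Plane}
    (hV0 : ∀ᵐ r ∂(volume.restrict (Ioo 0 ρ)), 0 ≤ V r) {κ : ℝ} (hκ : 0 < κ) {w : Plane → ℝ}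
    (hw : MemLp w ∞ volume)
    (h : ∫ x, arrayPotential V ρ Y x * w x ^ 2 <
      kernForm κ (arrayPotential V ρ Y * w) (arrayPotential V ρ Y * w)) :
    groundEnergy hV Y < -κ ^ 2 := by
  have h1 := trial_estimate (memLp_arrayPotential hV Y) (integrable_arrayPotential hV Y)
    (arrayPotential_nonneg hV0 Y) (isLeast_groundEnergy hV Y).2 hκ hw
  by_contra hle
  push Not at hle
  have := mul_nonpos_of_nonpos_of_nonneg (sub_nonpos.2 hle)
    (sq_nonneg ‖freeRes κ hκ (density (memLp_arrayPotential hV Y) hw)‖)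
  linarith

theorem groundEnergy_le {Y : Finset Plane}
    (hV0 : ∀ᵐ r ∂(volume.restrict (Ioo 0 ρ)), 0 ≤ V r) {κ : ℝ} (hκ : 0 < κ) {w : Plane → ℝ}
    (hw : MemLp w ∞ volume) (hne : ¬ arrayPotential V ρ Y * w =ᵐ[volume] 0)
    (h : ∫ x, arrayPotential V ρ Y x * w x ^ 2 ≤
      kernForm κ (arrayPotential V ρ Y * w) (arrayPotential V ρ Y * w)) :
    groundEnergy hV Y ≤ -κ ^ 2 := by
  have h1 := trial_estimate (memLp_arrayPotential hV Y) (integrable_arrayPotential hV Y)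
    (arrayPotential_nonneg hV0 Y) (isLeast_groundEnergy hV Y).2 hκ hw
  -- The nontriviality of `q w` enters here: were the trial function zero, the estimate would say
  -- nothing about the energy.
  have h2 : 0 < ‖freeRes κ hκ (density (memLp_arrayPotential hV Y) hw)‖ := by
    rw [norm_pos_iff]
    exact fun h0 => density_ne_zero _ hw hne (freeRes_eq_zero hκ h0)
  by_contra hlt
  push Not at hlt
  have := mul_neg_of_neg_of_pos (sub_neg.2 hlt) (pow_pos h2 2)
  linarith

theorem groundEnergy_neg {R : ℝ} (hR : 0 < R) (hρ : 0 < ρ) {Y : Finset Plane} (hY : Y.Nonempty)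
    (hYR : ∀ y ∈ Y, ‖y‖ = R) (hV0 : ∀ᵐ r ∂(volume.restrict (Ioo 0 ρ)), 0 ≤ V r)
    (hV_ne : ¬ ∀ᵐ r ∂(volume.restrict (Ioo 0 ρ)), V r = 0) : groundEnergy hV Y < 0 := by
  obtain ⟨κ, hκ, h⟩ := exists_integral_lt_kernForm (memLp_arrayPotential hV Y)
    (integrable_arrayPotential hV Y) (arrayPotential_nonneg hV0 Y)
    (not_ae_arrayPotential_eq_zero hV0 hV_ne hY) (by positivity : 0 < R + ρ)
    (arrayPotential_eq_zero hYR)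
  have h1 := groundEnergy_lt hV hV0 hκ (w := 1) (memLp_top_const (1 : ℝ)) (by simpa using h)
  nlinarith [sq_nonneg κ]

theorem isEigenvalue_groundEnergy {R : ℝ} {Y : Finset Plane}
    (hYR : ∀ y ∈ Y, ‖y‖ = R) (hneg : groundEnergy hV Y < 0) :
    IsEigenvalue (hamiltonian hV Y) (groundEnergy hV Y) := by
  have h1 : 0 < √(-groundEnergy hV Y) := Real.sqrt_pos.2 (by linarith)
  have h2 : groundEnergy hV Y = -√(-groundEnergy hV Y) ^ 2 := by
    rw [Real.sq_sqrt (by linarith), neg_neg]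
  have h3 := (isLeast_groundEnergy hV Y).1.1
  rw [h2] at h3 ⊢
  exact isEigenvalue_schrodinger _ (D := R + ρ)
    (fun x hx => by simp [arrayPotential_eq_zero hYR x hx]) h1 h3

end GroundEnergy

/-! ### Rotations and the reflection of the plane -/

/-- The identification of the plane with `ℂ`. -/
def toC : Plane ≃ₗᵢ[ℝ] ℂ := Complex.orthonormalBasisOneI.repr.symm

theorem toC_apply (x : Plane) : toC x = x 0 + x 1 * Complex.I :=
  Complex.orthonormalBasisOneI_repr_symm_apply x

theorem toC_symm_apply (z : ℂ) : toC.symm z = !₂[z.re, z.im] := by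
  apply toC.injective
  rw [LinearIsometryEquiv.apply_symm_apply, toC_apply]
  simp

/-- The rotation of the plane by the angle `θ`. -/
def rot (θ : ℝ) : Plane ≃ₗᵢ[ℝ] Plane :=
  toC.trans ((rotation (Circle.exp θ)).trans toC.symm)

/-- The reflection of the plane in the first coordinate axis. -/
def mirror : Plane ≃ₗᵢ[ℝ] Plane := toC.trans (Complex.conjLIE.trans toC.symm)

theorem rot_apply_zero (θ : ℝ) (x : Plane) :
    rot θ x 0 = x 0 * Real.cos θ - x 1 * Real.sin θ := by
  simp [rot, toC_symm_apply, toC_apply, rotation_apply, Circle.coe_exp, Complex.exp_mul_I,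
    ← Complex.ofReal_cos, ← Complex.ofReal_sin]
  ring

theorem rot_apply_one (θ : ℝ) (x : Plane) :
    rot θ x 1 = x 0 * Real.sin θ + x 1 * Real.cos θ := by
  simp [rot, toC_symm_apply, toC_apply, rotation_apply, Circle.coe_exp, Complex.exp_mul_I,
    ← Complex.ofReal_cos, ← Complex.ofReal_sin]
  ring

theorem mirror_apply_zero (x : Plane) : mirror x 0 = x 0 := by
  simp [mirror, toC_symm_apply, toC_apply]

theorem mirror_apply_one (x : Plane) : mirror x 1 = -x 1 := by
  simp [mirror, toC_symm_apply, toC_apply]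

theorem plane_ext {x y : Plane} (h0 : x 0 = y 0) (h1 : x 1 = y 1) : x = y := by
  ext i
  fin_cases i
  · exact h0
  · exact h1

theorem rot_rot (θ φ : ℝ) (x : Plane) : rot θ (rot φ x) = rot (θ + φ) x := by
  apply plane_ext <;>
    simp only [rot_apply_zero, rot_apply_one, Real.cos_add, Real.sin_add] <;> ring

theorem rot_zero (x : Plane) : rot 0 x = x := by
  apply plane_ext <;> simp [rot_apply_zero, rot_apply_one]

theorem rot_two_pi_mul_int (k : ℤ) (x : Plane) : rot (2 * Real.pi * k) x = x := by
  have h1 : Real.cos (2 * Real.pi * k) = 1 := by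
    rw [mul_comm]; exact Real.cos_int_mul_two_pi k
  have h2 : Real.sin (2 * Real.pi * k) = 0 := by
    have := Real.sin_int_mul_pi (2 * k)
    rw [← this]; push_cast; ring_nf
  apply plane_ext <;> simp [rot_apply_zero, rot_apply_one, h1, h2]

theorem mirror_rot (θ : ℝ) (x : Plane) : mirror (rot θ x) = rot (-θ) (mirror x) := by
  apply plane_ext <;>
    simp only [rot_apply_zero, rot_apply_one, mirror_apply_zero, mirror_apply_one, Real.cos_neg,
      Real.sin_neg] <;> ring

theorem mirror_mirror (x : Plane) : mirror (mirror x) = x := by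
  apply plane_ext <;> simp [mirror_apply_zero, mirror_apply_one]

theorem rot_polarPoint (R θ φ : ℝ) : rot θ (polarPoint R φ) = polarPoint R (θ + φ) := by
  apply plane_ext <;>
    simp only [rot_apply_zero, rot_apply_one, polarPoint, PiLp.toLp_apply, Matrix.cons_val_zero,
      Matrix.cons_val_one, Matrix.cons_val_fin_one, Real.cos_add, Real.sin_add] <;> ring

theorem mirror_polarPoint (R φ : ℝ) : mirror (polarPoint R φ) = polarPoint R (-φ) := by
  apply plane_ext <;>
    simp [mirror_apply_zero, mirror_apply_one, polarPoint]

theorem plane_norm_sq (x : Plane) : ‖x‖ ^ 2 = x 0 ^ 2 + x 1 ^ 2 := by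
  rw [EuclideanSpace.norm_sq_eq]
  simp

/-- `x₀ sin β + x₁ cos β` is the signed distance of `x` from the line through the origin with
direction `(cos β, -sin β)`. It equals `R sin β` at the centre of the disk and varies by at most `ρ`
inside, by Cauchy-Schwarz. -/
theorem le_of_mem_ball_polarPoint_zero {R ρ : ℝ} (β : ℝ) {x : Plane}
    (hx : x ∈ ball (polarPoint R 0) ρ) :
    R * Real.sin β - ρ ≤ x 0 * Real.sin β + x 1 * Real.cos β := by
  rw [mem_ball, dist_eq_norm] at hx
  have h2 : ‖x - polarPoint R 0‖ ^ 2 ≤ ρ ^ 2 := by gcongr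
  have h0 : ‖x - polarPoint R 0‖ ^ 2 = (x 0 - R) ^ 2 + x 1 ^ 2 := by
    rw [plane_norm_sq]
    simp [polarPoint]
  rw [h0] at h2
  have hρ : 0 ≤ ρ := (norm_nonneg _).trans hx.le
  have h3 := Real.sin_sq_add_cos_sq β
  have h4 : ((x 0 - R) * Real.sin β + x 1 * Real.cos β) ^ 2 ≤ ρ ^ 2 := by
    have h5 : ((x 0 - R) ^ 2 + x 1 ^ 2) * (Real.sin β ^ 2 + Real.cos β ^ 2) =
      ((x 0 - R) * Real.sin β + x 1 * Real.cos β) ^ 2 +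
      ((x 0 - R) * Real.cos β - x 1 * Real.sin β) ^ 2 := by ring
    rw [h3] at h5
    linarith [sq_nonneg ((x 0 - R) * Real.cos β - x 1 * Real.sin β)]
  have := (abs_le.1 (abs_le_of_sq_le_sq h4 hρ)).1
  linarith

/-! ### Shifting horizontal contours -/

/-- Cauchy's theorem on the rectangle with vertices `±T + ia` and `±T + ib`; the vertical sides
vanish as `T → ∞` by the doubly exponential decay. -/
theorem integral_add_mul_I_eq {g : ℂ → ℂ} (hg : Differentiable ℂ g) {a b c C : ℝ} (hc : 0 < c)
    (hb : ∀ y ∈ uIcc a b, ∀ s : ℝ, ‖g (s + y * Complex.I)‖ ≤ C * Real.exp (-(c * Real.cosh s))) :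
    ∫ s : ℝ, g (s + a * Complex.I) = ∫ s : ℝ, g (s + b * Complex.I) := by
  have hint : ∀ y ∈ uIcc a b, Integrable fun s : ℝ => g (s + y * Complex.I) := fun y hy =>
    ((integrable_exp_neg_cosh hc).const_mul C).mono'
      (Continuous.aestronglyMeasurable (by have := hg.continuous; fun_prop)) (.of_forall (hb y hy))
  have hlim : ∀ y ∈ uIcc a b, Filter.Tendsto (fun T : ℝ => ∫ s in (-T)..T, g (s + y * Complex.I))
      Filter.atTop (nhds (∫ s : ℝ, g (s + y * Complex.I))) := fun y hy =>
    intervalIntegral_tendsto_integral (hint y hy) Filter.tendsto_neg_atTop_atBot Filter.tendsto_id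
  have hexp : Filter.Tendsto (fun T : ℝ => C * Real.exp (-(c * Real.cosh T)) * |b - a|)
      Filter.atTop (nhds 0) := by
    have h1 : Filter.Tendsto Real.cosh Filter.atTop Filter.atTop := by
      refine Filter.tendsto_atTop_mono (fun x => ?_) Filter.tendsto_id
      rw [Real.cosh_eq]
      have h3 := Real.add_one_le_exp x
      have h4 := Real.exp_pos (-x)
      have h5 := Real.quadratic_le_exp_of_nonneg (x := |x|) (abs_nonneg x)
      have h6 : Real.exp |x| ≤ Real.exp x + Real.exp (-x) := by
        rcases abs_cases x with h | h <;> rw [h.1] <;> linarith [Real.exp_pos x]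
      have h7 := le_abs_self x
      simp only [id]
      nlinarith [sq_nonneg (|x| - 1)]
    have h2 := Real.tendsto_exp_neg_atTop_nhds_zero.comp (h1.const_mul_atTop hc)
    simpa [Function.comp_def] using (h2.const_mul C).mul_const |b - a|
  -- Taking for `σ` the identity and the negation treats both vertical sides at once.
  have hvert : ∀ σ : ℝ → ℝ, (∀ T, Real.cosh (σ T) = Real.cosh T) →
      Filter.Tendsto (fun T : ℝ => ∫ y in a..b, g (σ T + y * Complex.I)) Filter.atTop (nhds 0) := by
    intro σ hσ
    refine squeeze_zero_norm (fun T => ?_) hexp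
    refine intervalIntegral.norm_integral_le_of_norm_le_const fun y hy => ?_
    rw [← hσ T]
    exact hb y (uIoc_subset_uIcc hy) _
  have hrect : ∀ T : ℝ, (∫ s in (-T)..T, g (s + a * Complex.I)) -
      (∫ s in (-T)..T, g (s + b * Complex.I)) +
      Complex.I * (∫ y in a..b, g (T + y * Complex.I)) -
      Complex.I * (∫ y in a..b, g ((-T : ℝ) + y * Complex.I)) = 0 := by
    intro T
    have := Complex.integral_boundary_rect_eq_zero_of_differentiableOn g
      ((-T : ℝ) + a * Complex.I) (T + b * Complex.I) hg.differentiableOn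
    simpa using this
  have h1 := (((hlim a left_mem_uIcc).sub (hlim b right_mem_uIcc)).add
    ((hvert id fun _ => rfl).const_mul Complex.I)).sub
    ((hvert (fun T => -T) fun T => Real.cosh_neg T).const_mul Complex.I)
  have h2 := tendsto_nhds_unique (h1.congr hrect) tendsto_const_nhds
  simpa [sub_eq_zero] using h2

/-! ### Factorization of the kernel -/

theorem norm_exp_neg_mul_cosh (r s y : ℝ) :
    ‖Complex.exp (-(r * Complex.cosh (s + y * Complex.I)))‖ =
      Real.exp (-(r * Real.cos y * Real.cosh s)) := by
  rw [Complex.norm_exp, Complex.cosh_add, Complex.cosh_mul_I, Complex.sinh_mul_I]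
  congr 1
  simp [← Complex.ofReal_cosh, ← Complex.ofReal_cos, ← Complex.ofReal_sinh, ← Complex.ofReal_sin]
  ring

/-- With `A + iB = r exp(iψ)` the exponent is `-r cosh(s + iψ)`, so the contour can be moved by `ψ`
to the real line. As `A > 0`, `|ψ| < π/2`, and at all intermediate heights `y` the real part `r cos
y cosh s` stays at least `A cosh s`. -/
theorem integral_exp_cosh_add_sinh {A : ℝ} (hA : 0 < A) (B : ℝ) :
    ∫ s : ℝ, Complex.exp (-(A * Real.cosh s + B * Real.sinh s * Complex.I)) =
      ((∫ s : ℝ, Real.exp (-(√(A ^ 2 + B ^ 2) * Real.cosh s)) : ℝ) : ℂ) := by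
  set w : ℂ := ⟨A, B⟩ with hw
  have hr : √(A ^ 2 + B ^ 2) = ‖w‖ := by
    rw [Complex.norm_def, Complex.normSq_apply, hw]
    simp only [sq]
  set ψ := w.arg with hψ
  have hA' : ‖w‖ * Real.cos ψ = A := Complex.norm_mul_cos_arg w
  have hB' : ‖w‖ * Real.sin ψ = B := Complex.norm_mul_sin_arg w
  have hψ2 : |ψ| < Real.pi / 2 := Complex.abs_arg_lt_pi_div_two_iff.2 (Or.inl hA)
  have hshift := integral_add_mul_I_eq (g := fun z => Complex.exp (-(‖w‖ * Complex.cosh z)))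
    (by fun_prop) (a := 0) (b := ψ) (c := A) (C := 1) hA (fun y hy s => by
      rw [norm_exp_neg_mul_cosh, one_mul, Real.exp_le_exp, neg_le_neg_iff, ← hA']
      have hy' : |y| ≤ |ψ| := by
        rcases le_total 0 ψ with h | h
        · rw [uIcc_of_le h] at hy
          rw [abs_of_nonneg hy.1, abs_of_nonneg h]
          exact hy.2
        · rw [uIcc_of_ge h] at hy
          rw [abs_of_nonpos hy.2, abs_of_nonpos h]
          exact neg_le_neg hy.1
      have hcos : Real.cos ψ ≤ Real.cos y := by
        rw [← Real.cos_abs ψ, ← Real.cos_abs y]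
        exact Real.cos_le_cos_of_nonneg_of_le_pi (abs_nonneg _)
          (by linarith [Real.pi_pos]) hy'
      have := Real.cosh_pos s
      gcongr)
  rw [hr, ← integral_complex_ofReal]
  refine Eq.trans ?_ (hshift.symm.trans ?_)
  · congr with s
    rw [Complex.cosh_add, Complex.cosh_mul_I, Complex.sinh_mul_I, ← hA', ← hB']
    push_cast
    ring_nf
  · congr with s
    push_cast
    simp

/-- The function `z ↦ exp (κ (i x₀ sinh z - x₁ cosh z))`. For fixed `z` it solves `Δ u = κ² u`. -/
def halfWave (κ : ℝ) (z : ℂ) (x : Plane) : ℂ :=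
  Complex.exp (κ * (Complex.I * x 0 * Complex.sinh z - x 1 * Complex.cosh z))

theorem norm_halfWave (κ s β : ℝ) (x : Plane) : ‖halfWave κ (s + β * Complex.I) x‖ =
    Real.exp (-(κ * (x 0 * Real.sin β + x 1 * Real.cos β) * Real.cosh s)) := by
  rw [halfWave, Complex.norm_exp, Complex.cosh_add, Complex.sinh_add, Complex.cosh_mul_I,
    Complex.sinh_mul_I]
  congr 1
  simp [← Complex.ofReal_cosh, ← Complex.ofReal_cos, ← Complex.ofReal_sinh, ← Complex.ofReal_sin]
  ring

theorem differentiable_halfWave (κ : ℝ) (x : Plane) :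
    Differentiable ℂ fun z => halfWave κ z x := by
  unfold halfWave
  fun_prop

theorem continuous_halfWave (κ β : ℝ) :
    Continuous fun p : ℝ × Plane => halfWave κ (p.1 + β * Complex.I) p.2 := by
  unfold halfWave
  fun_prop

theorem halfWave_mul_conj (κ s β : ℝ) (x y : Plane) :
    halfWave κ (s + β * Complex.I) x * starRingEnd ℂ (halfWave κ (s + β * Complex.I) y) =
      Complex.exp (-((κ * (x 0 * Real.sin β + x 1 * Real.cos β +
        (y 0 * Real.sin β + y 1 * Real.cos β)) : ℝ) * Real.cosh s +
        (κ * ((x 1 - y 1) * Real.sin β - (x 0 - y 0) * Real.cos β) : ℝ) * Real.sinh s *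
          Complex.I)) := by
  rw [halfWave, halfWave, ← Complex.exp_conj, ← Complex.exp_add]
  congr 1
  simp only [Complex.cosh_add, Complex.sinh_add, Complex.cosh_mul_I, Complex.sinh_mul_I, map_mul,
    map_sub, map_add, Complex.conj_ofReal, Complex.conj_I, ← Complex.ofReal_cosh,
    ← Complex.ofReal_cos, ← Complex.ofReal_sinh, ← Complex.ofReal_sin]
  push_cast
  ring_nf
  simp only [Complex.I_sq]
  ring

/-- `y ↦ rot (-(2 * β)) (mirror y)` is the reflection in the line of direction `(cos β, -sin β)`.
For `x`, `y` strictly on the same side, the vector from `x` to the image of `y` has normal component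
`A`, the sum of the two distances, and tangential component `±B`. The sum `A` is what separates the
variables: `exp(-κ(A cosh s + iB sinh s))` is a product of a function of `x` and the conjugate of
the same function of `y`, and its integral over `s` depends only on `√(A² + B²)`. -/
theorem kern_sub_rot_mirror {κ : ℝ} (hκ : 0 < κ) {β : ℝ} {x y : Plane}
    (hx : 0 < x 0 * Real.sin β + x 1 * Real.cos β) (hy : 0 < y 0 * Real.sin β + y 1 * Real.cos β) :
    (kern κ (x - rot (-(2 * β)) (mirror y)) : ℂ) = (4 * Real.pi : ℂ)⁻¹ *
      ∫ s : ℝ, halfWave κ (s + β * Complex.I) x *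
        starRingEnd ℂ (halfWave κ (s + β * Complex.I) y) := by
  set A := x 0 * Real.sin β + x 1 * Real.cos β + (y 0 * Real.sin β + y 1 * Real.cos β) with hA
  set B := (x 1 - y 1) * Real.sin β - (x 0 - y 0) * Real.cos β with hB
  have hApos : 0 < A := by positivity
  have hnorm : ‖x - rot (-(2 * β)) (mirror y)‖ ^ 2 = A ^ 2 + B ^ 2 := by
    rw [plane_norm_sq]
    simp only [PiLp.sub_apply, rot_apply_zero, rot_apply_one, mirror_apply_zero, mirror_apply_one,
      Real.cos_neg, Real.sin_neg, Real.sin_two_mul, Real.cos_two_mul', hA, hB]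
    have h1 : Real.cos β ^ 2 = 1 - Real.sin β ^ 2 := by linarith [Real.sin_sq_add_cos_sq β]
    have h4 : Real.cos β ^ 4 = (1 - Real.sin β ^ 2) ^ 2 := by rw [← h1]; ring
    ring_nf
    simp only [h1, h4]
    ring
  have hne : x - rot (-(2 * β)) (mirror y) ≠ 0 := by
    intro h
    rw [h, norm_zero] at hnorm
    nlinarith [sq_nonneg B]
  have hs : √((κ * A) ^ 2 + (κ * B) ^ 2) = κ * ‖x - rot (-(2 * β)) (mirror y)‖ := by
    rw [show (κ * A) ^ 2 + (κ * B) ^ 2 = (κ * ‖x - rot (-(2 * β)) (mirror y)‖) ^ 2 by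
      rw [mul_pow κ ‖_‖, hnorm]; ring]
    exact Real.sqrt_sq (by positivity)
  simp only [halfWave_mul_conj]
  rw [integral_exp_cosh_add_sinh (mul_pos hκ hApos), hs, kern_eq hκ hne]
  push_cast
  ring

/-! ### The interaction of two rotated copies of a density -/

/-- The interaction `⟨f, (-Δ + κ²)⁻¹ f_θ⟩` of `f` with its copy rotated by the angle `-θ`. -/
def angForm (κ : ℝ) (f : Plane → ℝ) (θ : ℝ) : ℝ := kernForm κ f (f ∘ rot θ)

/-- The pairing of `f` with the functions `halfWave κ (s + i β)`. -/
def waveTrace (κ : ℝ) (f : Plane → ℝ) (β s : ℝ) : ℂ :=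
  ∫ x, (f x : ℂ) * halfWave κ (s + β * Complex.I) x

section AngForm

variable {κ R ρ : ℝ} {f : Plane → ℝ}

theorem norm_mul_halfWave_le (hκ : 0 < κ) (hf : ∀ x ∉ ball (polarPoint R 0) ρ, f x = 0) (β s : ℝ)
    (x : Plane) : ‖(f x : ℂ) * halfWave κ (s + β * Complex.I) x‖ ≤
      ‖f x‖ * Real.exp (-(κ * (R * Real.sin β - ρ) * Real.cosh s)) := by
  rw [norm_mul, Complex.norm_real]
  by_cases hx : x ∈ ball (polarPoint R 0) ρ
  · rw [norm_halfWave]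
    have h1 := le_of_mem_ball_polarPoint_zero β hx
    have h2 := Real.cosh_pos s
    gcongr
  · simp [hf x hx]

theorem integrable_mul_halfWave (hκ : 0 < κ) (hf : ∀ x ∉ ball (polarPoint R 0) ρ, f x = 0)
    (hf1 : Integrable f) {β : ℝ} (hβ : ρ < R * Real.sin β) :
    Integrable (fun p : ℝ × Plane => (f p.2 : ℂ) * halfWave κ (p.1 + β * Complex.I) p.2)
      (volume.prod volume) := by
  have hδ : 0 < κ * (R * Real.sin β - ρ) := mul_pos hκ (by linarith)
  refine ((integrable_exp_neg_cosh hδ).mul_prod hf1.norm).mono' ?_ (.of_forall fun p => ?_)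
  · exact ((Complex.continuous_ofReal.comp_aestronglyMeasurable hf1.1).comp_snd).mul
      (continuous_halfWave κ β).aestronglyMeasurable
  · rw [mul_comm (Real.exp _)]
    exact norm_mul_halfWave_le hκ hf β p.1 p.2

theorem integrable_waveTrace (hκ : 0 < κ) (hf : ∀ x ∉ ball (polarPoint R 0) ρ, f x = 0)
    (hf1 : Integrable f) {β : ℝ} (hβ : ρ < R * Real.sin β) : Integrable (waveTrace κ f β) :=
  (integrable_mul_halfWave hκ hf hf1 hβ).integral_prod_left

theorem norm_waveTrace_le (hκ : 0 < κ) (hf : ∀ x ∉ ball (polarPoint R 0) ρ, f x = 0)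
    (hf1 : Integrable f) {β : ℝ} (hβ : ρ < R * Real.sin β) (s : ℝ) :
    ‖waveTrace κ f β s‖ ≤ ∫ x, ‖f x‖ := by
  refine norm_integral_le_of_norm_le hf1.norm (.of_forall fun x => ?_)
  refine (norm_mul_halfWave_le hκ hf β s x).trans (mul_le_of_le_one_right (norm_nonneg _) ?_)
  rw [Real.exp_le_one_iff]
  have := Real.cosh_pos s
  have : 0 < R * Real.sin β - ρ := by linarith
  simp only [Left.neg_nonpos_iff]
  positivity

theorem memLp_waveTrace (hκ : 0 < κ) (hf : ∀ x ∉ ball (polarPoint R 0) ρ, f x = 0)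
    (hf1 : Integrable f) {β : ℝ} (hβ : ρ < R * Real.sin β) : MemLp (waveTrace κ f β) 2 volume := by
  have h := integrable_waveTrace hκ hf hf1 hβ
  rw [memLp_two_iff_integrable_sq_norm h.1]
  refine (h.norm.const_mul (∫ x, ‖f x‖)).mono' (h.1.norm.pow 2) (.of_forall fun s => ?_)
  rw [norm_pow, norm_norm, sq]
  exact mul_le_mul_of_nonneg_right (norm_waveTrace_le hκ hf hf1 hβ s) (norm_nonneg _)

/-- Since `f` equals its mirror image, rotating a copy amounts to reflecting it in a line; the
strict bound on `R sin β` keeps the disk off that line. The factorized kernel then makes the form a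
superposition over `s` of `waveTrace` times its conjugate. -/
theorem angForm_two_mul (hκ : 0 < κ) (hf : ∀ x ∉ ball (polarPoint R 0) ρ, f x = 0)
    (hf1 : Integrable f) (hfm : f ∘ mirror = f) {β : ℝ} (hβ : ρ < R * Real.sin β) :
    angForm κ f (2 * β) = (4 * Real.pi)⁻¹ * ∫ s, ‖waveTrace κ f β s‖ ^ 2 := by
  set e : Plane ≃ₗᵢ[ℝ] Plane := mirror.trans (rot (-(2 * β))) with he
  have hδ : 0 < R * Real.sin β - ρ := by linarith
  have h1 : angForm κ f (2 * β) =
      ∫ p : Plane × Plane, kern κ (p.1 - e p.2) * (f p.1 * f p.2) ∂(volume.prod volume) := by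
    unfold angForm kernForm
    rw [Measure.volume_eq_prod]
    refine Eq.trans (((MeasurePreserving.id (volume : Measure Plane)).prod
      e.measurePreserving).integral_comp
      (MeasurableEmbedding.id.prodMap e.toHomeomorph.measurableEmbedding) _).symm ?_
    congr with p
    have : f (rot (2 * β) (e p.2)) = f p.2 := by
      simp only [he, LinearIsometryEquiv.trans_apply, rot_rot, add_neg_cancel, rot_zero]
      exact congrFun hfm p.2
    simp [this]
  have h2 : ∀ p : Plane × Plane, ((kern κ (p.1 - e p.2) * (f p.1 * f p.2) : ℝ) : ℂ) =
      (4 * Real.pi : ℂ)⁻¹ * ∫ s : ℝ, (f p.1 * halfWave κ (s + β * Complex.I) p.1) *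
        starRingEnd ℂ (f p.2 * halfWave κ (s + β * Complex.I) p.2) := by
    intro p
    by_cases hp1 : p.1 ∈ ball (polarPoint R 0) ρ
    · by_cases hp2 : p.2 ∈ ball (polarPoint R 0) ρ
      · push_cast
        rw [he, LinearIsometryEquiv.trans_apply, kern_sub_rot_mirror hκ
          (hδ.trans_le (le_of_mem_ball_polarPoint_zero β hp1))
          (hδ.trans_le (le_of_mem_ball_polarPoint_zero β hp2)), mul_assoc, ← integral_mul_const]
        congr 2 with s
        rw [map_mul, Complex.conj_ofReal]
        ring
      · simp [hf _ hp2]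
    · simp [hf _ hp1]
  have h3 : Integrable (Function.uncurry fun (p : Plane × Plane) (s : ℝ) =>
      ((f p.1 : ℂ) * halfWave κ (s + β * Complex.I) p.1) *
        starRingEnd ℂ (f p.2 * halfWave κ (s + β * Complex.I) p.2))
      ((volume.prod volume).prod volume) := by
    have hc : Continuous fun q : (Plane × Plane) × ℝ => halfWave κ (q.2 + β * Complex.I) q.1.1 := by
      unfold halfWave
      fun_prop
    have hc' : Continuous fun q : (Plane × Plane) × ℝ => halfWave κ (q.2 + β * Complex.I) q.1.2 := by
      unfold halfWave
      fun_prop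
    have hm : AEStronglyMeasurable (fun x => (f x : ℂ)) volume :=
      Complex.continuous_ofReal.comp_aestronglyMeasurable hf1.1
    have hm1 : AEStronglyMeasurable (fun q : (Plane × Plane) × ℝ => (f q.1.1 : ℂ))
      ((volume.prod volume).prod volume) := hm.comp_quasiMeasurePreserving
        (Measure.quasiMeasurePreserving_fst.comp Measure.quasiMeasurePreserving_fst)
    have hm2 : AEStronglyMeasurable (fun q : (Plane × Plane) × ℝ => (f q.1.2 : ℂ))
      ((volume.prod volume).prod volume) := hm.comp_quasiMeasurePreserving
        (Measure.quasiMeasurePreserving_snd.comp Measure.quasiMeasurePreserving_fst)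
    refine ((hf1.norm.mul_prod hf1.norm).mul_prod
      (integrable_exp_neg_cosh (mul_pos hκ hδ))).mono' ?_ (.of_forall fun q => ?_)
    · exact (hm1.mul hc.aestronglyMeasurable).mul
        (Complex.continuous_conj.comp_aestronglyMeasurable (hm2.mul hc'.aestronglyMeasurable))
    · have b1 := norm_mul_halfWave_le hκ hf β q.2 q.1.1
      have b2 := norm_mul_halfWave_le hκ hf β q.2 q.1.2
      have b3 : ‖f q.1.2‖ * Real.exp (-(κ * (R * Real.sin β - ρ) * Real.cosh q.2)) ≤ ‖f q.1.2‖ := by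
        refine mul_le_of_le_one_right (norm_nonneg _) (Real.exp_le_one_iff.2 ?_)
        have := Real.cosh_pos q.2
        simp only [Left.neg_nonpos_iff]
        positivity
      simp only [Function.uncurry]
      rw [norm_mul, RCLike.norm_conj]
      calc _ ≤ ‖f q.1.1‖ * Real.exp (-(κ * (R * Real.sin β - ρ) * Real.cosh q.2)) * ‖f q.1.2‖ :=
            mul_le_mul b1 (b2.trans b3) (norm_nonneg _) (by positivity)
        _ = _ := by ring
  have h4 : ∀ s : ℝ, ∫ p : Plane × Plane, ((f p.1 : ℂ) * halfWave κ (s + β * Complex.I) p.1) *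
        starRingEnd ℂ (f p.2 * halfWave κ (s + β * Complex.I) p.2) ∂(volume.prod volume) =
      ((‖waveTrace κ f β s‖ ^ 2 : ℝ) : ℂ) := by
    intro s
    rw [integral_prod_mul (fun x => (f x : ℂ) * halfWave κ (s + β * Complex.I) x)
      (fun x => starRingEnd ℂ (f x * halfWave κ (s + β * Complex.I) x)), integral_conj]
    change waveTrace κ f β s * starRingEnd ℂ (waveTrace κ f β s) = _
    rw [Complex.mul_conj']
    push_cast
    rfl
  apply Complex.ofReal_injective
  rw [h1, ← integral_complex_ofReal]
  simp only [h2]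
  rw [integral_const_mul, integral_integral_swap h3]
  simp only [h4]
  rw [integral_complex_ofReal]
  push_cast
  rfl

/-- The spectral amplitude of `f` with respect to hyperbolic translations. -/
def amplitude (κ : ℝ) (f : Plane → ℝ) (p : ℝ) : ℂ :=
  ∫ x, (f x : ℂ) * ∫ s : ℝ, Complex.exp (-(2 * Real.pi * p * Complex.I) *
    (s + (Real.pi / 2 : ℝ) * Complex.I)) * halfWave κ (s + (Real.pi / 2 : ℝ) * Complex.I) x

theorem sin_le_sin_of_mem_uIcc {β y : ℝ} (h0 : 0 < β) (h1 : β < Real.pi)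
    (hy : y ∈ uIcc β (Real.pi / 2)) : Real.sin β ≤ Real.sin y := by
  rcases le_total β (Real.pi / 2) with h | h
  · rw [uIcc_of_le h] at hy
    exact Real.sin_le_sin_of_le_of_le_pi_div_two (by linarith [Real.pi_pos]) hy.2 hy.1
  · rw [uIcc_of_ge h] at hy
    rw [← Real.sin_pi_sub β, ← Real.sin_pi_sub y]
    exact Real.sin_le_sin_of_le_of_le_pi_div_two (by linarith) (by linarith [hy.1])
      (by linarith [hy.2])

/-- `exp(-2πips)` equals `exp(-2πpβ)` times `exp(-2πipz)` at `z = s + iβ`, and the remaining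
integral is entire in `z`, so its contour may be moved from height `β` to the reference height
`π/2`. In between the sine is at least `sin β`, so the decay persists. Hence `amplitude` carries no
dependence on `β`. -/
theorem fourier_waveTrace (hR : 0 < R) (hκ : 0 < κ)
    (hf : ∀ x ∉ ball (polarPoint R 0) ρ, f x = 0)
    (hf1 : Integrable f) {β : ℝ} (h0 : 0 < β) (h1 : β < Real.pi) (hβ : ρ < R * Real.sin β) (p : ℝ) :
    𝓕 (waveTrace κ f β) p = Real.exp (-(2 * Real.pi * p * β)) * amplitude κ f p := by
  have hδ : 0 < R * Real.sin β - ρ := by linarith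
  have hshift : ∀ x, (f x : ℂ) * ∫ s : ℝ, Complex.exp (-(2 * Real.pi * p * Complex.I) *
        (s + β * Complex.I)) * halfWave κ (s + β * Complex.I) x =
      (f x : ℂ) * ∫ s : ℝ, Complex.exp (-(2 * Real.pi * p * Complex.I) *
        (s + (Real.pi / 2 : ℝ) * Complex.I)) *
          halfWave κ (s + (Real.pi / 2 : ℝ) * Complex.I) x := by
    intro x
    by_cases hx : x ∈ ball (polarPoint R 0) ρ
    · congr 1
      refine integral_add_mul_I_eq (g := fun z => Complex.exp (-(2 * Real.pi * p * Complex.I) * z) *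
        halfWave κ z x) (c := κ * (R * Real.sin β - ρ))
        (C := Real.exp (2 * Real.pi * |p| * Real.pi))
        (Differentiable.mul (by fun_prop) (differentiable_halfWave κ x)) (by positivity) ?_
      intro y hy s
      have hsin := sin_le_sin_of_mem_uIcc h0 h1 hy
      rw [norm_mul, norm_halfWave, Complex.norm_exp]
      have hre : (-(2 * Real.pi * p * Complex.I) * (s + y * Complex.I)).re =
          2 * Real.pi * p * y := by
        simp
      have hy0 : |y| ≤ Real.pi := by
        have := hy.1
        have := hy.2
        rw [abs_of_nonneg (by
          refine le_trans ?_ hy.1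
          exact le_min h0.le (by positivity))]
        exact hy.2.trans (max_le h1.le (by linarith [Real.pi_pos]))
      rw [hre]
      have hpy : p * y ≤ |p| * Real.pi := by
        calc p * y ≤ |p * y| := le_abs_self _
          _ = |p| * |y| := abs_mul _ _
          _ ≤ _ := by gcongr
      refine mul_le_mul (Real.exp_le_exp.2 ?_) (Real.exp_le_exp.2 ?_) (Real.exp_pos _).le
        (Real.exp_pos _).le
      · rw [mul_assoc, mul_assoc (2 * Real.pi)]
        exact mul_le_mul_of_nonneg_left hpy (by positivity)
      · have hb := le_of_mem_ball_polarPoint_zero y hx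
        have := Real.cosh_pos s
        have : R * Real.sin β - ρ ≤ x 0 * Real.sin y + x 1 * Real.cos y :=
          le_trans (by gcongr) hb
        rw [neg_le_neg_iff]
        gcongr
    · simp [hf x hx]
  have hint : Integrable (Function.uncurry fun (s : ℝ) (x : Plane) =>
      Complex.exp (((-2 * Real.pi * s * p : ℝ) : ℂ) * Complex.I) *
        ((f x : ℂ) * halfWave κ (s + β * Complex.I) x)) (volume.prod volume) := by
    refine (integrable_mul_halfWave hκ hf hf1 hβ).bdd_mul (c := 1) ?_ (.of_forall fun q => ?_)
    · exact Continuous.aestronglyMeasurable (by fun_prop)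
    · rw [Complex.norm_exp_ofReal_mul_I]
  rw [Real.fourier_real_eq_integral_exp_smul]
  have e1 : ∀ s : ℝ, Complex.exp (((-2 * Real.pi * s * p : ℝ) : ℂ) * Complex.I) •
      waveTrace κ f β s = ∫ x, Complex.exp (((-2 * Real.pi * s * p : ℝ) : ℂ) * Complex.I) *
        ((f x : ℂ) * halfWave κ (s + β * Complex.I) x) := fun s => by
    rw [integral_const_mul, smul_eq_mul, waveTrace]
  simp only [e1]
  rw [integral_integral_swap hint, amplitude, ← integral_const_mul]
  congr with x
  rw [← hshift x, ← mul_assoc, mul_comm _ (f x : ℂ), mul_assoc, ← integral_const_mul,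
    ← integral_const_mul]
  congr with s
  have e2 : Complex.exp (((-2 * Real.pi * s * p : ℝ) : ℂ) * Complex.I) =
      (Real.exp (-(2 * Real.pi * p * β)) : ℂ) *
        Complex.exp (-(2 * Real.pi * p * Complex.I) * (s + β * Complex.I)) := by
    push_cast
    rw [← Complex.exp_add]
    congr 1
    ring_nf
    simp only [Complex.I_sq]
    ring
  rw [e2]
  ring

/-- Plancherel in `s`: squaring the factor `exp(-2πpβ)` with `β = θ / 2` gives `exp(-2πpθ)`. -/
theorem angForm_eq_integral (hR : 0 < R) (hκ : 0 < κ)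
    (hf : ∀ x ∉ ball (polarPoint R 0) ρ, f x = 0) (hf1 : Integrable f) (hfm : f ∘ mirror = f)
    {θ : ℝ} (h0 : 0 < θ) (h1 : θ < 2 * Real.pi) (hθ : ρ < R * Real.sin (θ / 2)) :
    Integrable (fun p => Real.exp (-(2 * Real.pi * p * θ)) * ‖amplitude κ f p‖ ^ 2) ∧
    angForm κ f θ = (4 * Real.pi)⁻¹ *
      ∫ p, Real.exp (-(2 * Real.pi * p * θ)) * ‖amplitude κ f p‖ ^ 2 := by
  obtain ⟨h2, h3⟩ := integral_norm_sq_fourier_eq (integrable_waveTrace hκ hf hf1 hθ)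
    (memLp_waveTrace hκ hf hf1 hθ)
  have h4 : ∀ p, ‖𝓕 (waveTrace κ f (θ / 2)) p‖ ^ 2 =
      Real.exp (-(2 * Real.pi * p * θ)) * ‖amplitude κ f p‖ ^ 2 := by
    intro p
    rw [fourier_waveTrace hR hκ hf hf1 (by linarith) (by linarith) hθ, norm_mul, mul_pow,
      Complex.norm_real, Real.norm_of_nonneg (Real.exp_pos _).le, ← Real.exp_nat_mul]
    congr 2
    push_cast
    ring
  have h5 := (memLp_two_iff_integrable_sq_norm h2.1).1 h2
  simp only [h4] at h5 h3
  refine ⟨h5, ?_⟩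
  rw [h3, ← angForm_two_mul hκ hf hf1 hfm hθ]
  congr 1
  ring

end AngForm

/-! ### Strict convexity of the interaction -/

theorem strictConvexOn_integral_exp {G : ℝ → ℝ} (hG : ∀ p, 0 ≤ G p) (hG0 : ¬ G =ᵐ[volume] 0)
    {S : Set ℝ} (hS : Convex ℝ S)
    (hint : ∀ θ ∈ S, Integrable fun p => Real.exp (-(2 * Real.pi * p * θ)) * G p) :
    StrictConvexOn ℝ S fun θ => ∫ p, Real.exp (-(2 * Real.pi * p * θ)) * G p := by
  refine ⟨hS, fun x hx y hy hxy a b ha hb hab => ?_⟩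
  have hm := hint _ (hS hx hy ha.le hb.le hab)
  simp only [smul_eq_mul] at hm ⊢
  have hpt : ∀ p : ℝ, p ≠ 0 → Real.exp (-(2 * Real.pi * p * (a * x + b * y))) <
      a * Real.exp (-(2 * Real.pi * p * x)) + b * Real.exp (-(2 * Real.pi * p * y)) := by
    intro p hp
    have hne : -(2 * Real.pi * p * x) ≠ -(2 * Real.pi * p * y) := by
      have : 2 * Real.pi * p ≠ 0 := by
        have := Real.pi_ne_zero
        positivity
      simpa [this] using hxy
    have := strictConvexOn_exp.2 (mem_univ _) (mem_univ _) hne ha hb hab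
    simp only [smul_eq_mul] at this
    rw [show -(2 * Real.pi * p * (a * x + b * y)) =
      a * -(2 * Real.pi * p * x) + b * -(2 * Real.pi * p * y) by ring]
    exact this
  have hp0 : ∀ᵐ p : ℝ, p ≠ 0 := by simp [ae_iff]
  have hi1 : Integrable fun p => a * (Real.exp (-(2 * Real.pi * p * x)) * G p) +
      b * (Real.exp (-(2 * Real.pi * p * y)) * G p) :=
    ((hint x hx).const_mul a).add ((hint y hy).const_mul b)
  have hi := hi1.sub hm
  have hnn : 0 ≤ᵐ[volume] fun p => a * (Real.exp (-(2 * Real.pi * p * x)) * G p) +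
      b * (Real.exp (-(2 * Real.pi * p * y)) * G p) -
      Real.exp (-(2 * Real.pi * p * (a * x + b * y))) * G p := by
    filter_upwards [hp0] with p hp
    have := mul_le_mul_of_nonneg_right (hpt p hp).le (hG p)
    simp only [Pi.zero_apply]
    linarith
  have hpos : 0 < ∫ p, (a * (Real.exp (-(2 * Real.pi * p * x)) * G p) +
      b * (Real.exp (-(2 * Real.pi * p * y)) * G p) -
      Real.exp (-(2 * Real.pi * p * (a * x + b * y))) * G p) := by
    refine lt_of_le_of_ne (integral_nonneg_of_ae hnn) fun h => hG0 ?_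
    have h0 := (integral_eq_zero_iff_of_nonneg_ae hnn hi).1 h.symm
    filter_upwards [h0, hp0] with p h1 hp
    have h2 : (a * Real.exp (-(2 * Real.pi * p * x)) + b * Real.exp (-(2 * Real.pi * p * y)) -
      Real.exp (-(2 * Real.pi * p * (a * x + b * y)))) * G p = 0 := by
      refine Eq.trans ?_ h1
      ring
    rcases mul_eq_zero.1 h2 with h3 | h3
    · linarith [hpt p hp]
    · exact h3
  rw [integral_sub hi1 hm,
    integral_add ((hint x hx).const_mul a) ((hint y hy).const_mul b), integral_const_mul,
    integral_const_mul] at hpos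
  linarith

/-- Needed because touching disks sit at the end points, where the integral representation is not
available. Convexity extends by continuity. For strictness at `m = (1-b)x + by`, apply strict
convexity to the midpoints of `x, m` and of `y, m`, which are interior and average to `m`, then
bound the values there by convexity; half of `F m` is absorbed. -/
theorem strictConvexOn_Icc_of_Ioo {c d : ℝ} {F : ℝ → ℝ} (h : StrictConvexOn ℝ (Ioo c d) F)
    (hc : Continuous F) : StrictConvexOn ℝ (Icc c d) F := by
  have key : ∀ x ∈ Icc c d, ∀ m ∈ Ioo c d, ∀ t ∈ Ico (0 : ℝ) 1, m + t * (x - m) ∈ Ioo c d := by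
    intro x hx m hm t ht
    have := hx.1
    have := hx.2
    have := hm.1
    have := hm.2
    have := ht.1
    have := ht.2
    constructor <;> nlinarith
  refine ⟨convex_Icc _ _, fun x hx y hy hxy a b ha hb hab => ?_⟩
  simp only [smul_eq_mul]
  set m := a * x + b * y with hmdef
  obtain rfl : a = 1 - b := by linarith
  have hm : m ∈ Ioo c d := by
    have := hx.1
    have := hx.2
    have := hy.1
    have := hy.2
    rcases lt_or_gt_of_ne hxy with h1 | h1
    · constructor <;> nlinarith
    · constructor <;> nlinarith
  have hcomb : ∀ t : ℝ, (1 - b) * (m + t * (x - m)) + b * (m + t * (y - m)) = m := by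
    intro t
    rw [hmdef]
    ring
  have hlim : ∀ z ∈ Icc c d, ∀ s ∈ Icc (0 : ℝ) 1,
      F ((1 - s) * m + s * z) ≤ (1 - s) * F m + s * F z := by
    intro z hz s hs
    have h1 : ∀ t ∈ Ico (0 : ℝ) 1, F ((1 - s) * m + s * (m + t * (z - m))) ≤
        (1 - s) * F m + s * F (m + t * (z - m)) := fun t ht =>
      h.convexOn.2 hm (key z hz m hm t ht) (by linarith [hs.2]) hs.1 (by ring)
    have hcl : (1 : ℝ) ∈ closure (Ico (0 : ℝ) 1) := by
      rw [closure_Ico zero_ne_one]; simp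
    have hclosed : IsClosed {t : ℝ | F ((1 - s) * m + s * (m + t * (z - m))) ≤
        (1 - s) * F m + s * F (m + t * (z - m))} := isClosed_le (by fun_prop) (by fun_prop)
    have h2 : F ((1 - s) * m + s * (m + 1 * (z - m))) ≤
        (1 - s) * F m + s * F (m + 1 * (z - m)) := hclosed.closure_subset_iff.2 h1 hcl
    simpa using h2
  have h1 := h.2 (key x hx m hm (1 / 2) (by norm_num)) (key y hy m hm (1 / 2) (by norm_num))
    (by intro h; apply hxy; linarith) ha hb hab
  simp only [smul_eq_mul] at h1
  rw [hcomb] at h1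
  have h2 := hlim x hx (1 / 2) (by norm_num)
  have h3 := hlim y hy (1 / 2) (by norm_num)
  rw [show m + 1 / 2 * (x - m) = (1 - 1 / 2) * m + 1 / 2 * x by ring,
    show m + 1 / 2 * (y - m) = (1 - 1 / 2) * m + 1 / 2 * y by ring] at h1
  nlinarith

/-! ### Positivity and continuity of the interaction. -/

theorem kern_pos {κ : ℝ} (hκ : 0 < κ) {z : Plane} (hz : z ≠ 0) : 0 < kern κ z := by
  rw [kern_eq hκ hz]
  have hi : Integrable fun s : ℝ => Real.exp (-(κ * ‖z‖ * Real.cosh s)) :=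
    integrable_exp_neg_cosh (mul_pos hκ (norm_pos_iff.2 hz))
  have := integral_exp_pos hi
  positivity

theorem kernForm_pos {κ : ℝ} (hκ : 0 < κ) {f g : Plane → ℝ} (hf : MemLp f 2 volume)
    (hg : MemLp g 2 volume) (hf1 : Integrable f) (hg1 : Integrable g) (hf0 : ∀ᵐ x, 0 ≤ f x)
    (hg0 : ∀ᵐ x, 0 ≤ g x)
    (hfne : ¬ f =ᵐ[volume] 0) (hgne : ¬ g =ᵐ[volume] 0) : 0 < kernForm κ f g := by
  have hpos : ∀ {h : Plane → ℝ}, Integrable h → (∀ᵐ x, 0 ≤ h x) → ¬ h =ᵐ[volume] 0 →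
      0 < ∫ x, h x := fun {h} h1 h0 hne => by
    refine lt_of_le_of_ne (integral_nonneg_of_ae h0) fun h => hne ?_
    exact (integral_eq_zero_iff_of_nonneg_ae h0 h1).1 h.symm
  have hi := integrable_kern_mul_real hκ hf hg
  have hfp : ∀ᵐ p : Plane × Plane ∂(volume.prod volume), 0 ≤ f p.1 :=
    Measure.quasiMeasurePreserving_fst.ae hf0
  have hgp : ∀ᵐ p : Plane × Plane ∂(volume.prod volume), 0 ≤ g p.2 :=
    Measure.quasiMeasurePreserving_snd.ae hg0
  have hnn : 0 ≤ᵐ[(volume : Measure Plane).prod volume]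
      fun p => kern κ (p.1 - p.2) * (f p.1 * g p.2) := by
    filter_upwards [ae_ne_prod, hfp, hgp] with p h1 h2 h3
    exact mul_nonneg (kern_pos hκ (sub_ne_zero.2 h1)).le (mul_nonneg h2 h3)
  unfold kernForm
  rw [Measure.volume_eq_prod]
  refine lt_of_le_of_ne (integral_nonneg_of_ae hnn) fun h => ?_
  have h0 := (integral_eq_zero_iff_of_nonneg_ae hnn hi).1 h.symm
  have h2 : ∫ p : Plane × Plane, f p.1 * g p.2 ∂(volume.prod volume) = 0 := by
    refine integral_eq_zero_of_ae ?_
    filter_upwards [h0, ae_ne_prod] with p h1 hp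
    exact (mul_eq_zero.1 h1).resolve_left (kern_pos hκ (sub_ne_zero.2 hp)).ne'
  rw [integral_prod_mul] at h2
  exact (mul_pos (hpos hf1 hf0 hfne) (hpos hg1 hg0 hgne)).ne' h2

section

variable {κ R ρ : ℝ} {f : Plane → ℝ}

theorem integrable_comp_isometry (hf1 : Integrable f) (e : Plane ≃ₗᵢ[ℝ] Plane) :
    Integrable (f ∘ e) :=
  (e.measurePreserving.integrable_comp_emb e.toHomeomorph.measurableEmbedding).2 hf1

theorem ae_comp_isometry {P : Plane → Prop} (h : ∀ᵐ x, P x) (e : Plane ≃ₗᵢ[ℝ] Plane) :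
    ∀ᵐ x, P (e x) := e.measurePreserving.quasiMeasurePreserving.ae h

theorem not_ae_comp_isometry (h : ¬ f =ᵐ[volume] 0) (e : Plane ≃ₗᵢ[ℝ] Plane) :
    ¬ f ∘ e =ᵐ[volume] 0 := fun h' => h <| by
  have := ae_comp_isometry h' e.symm
  filter_upwards [this] with x hx
  simpa using hx

theorem continuous_rot_apply (x : Plane) : Continuous fun θ => rot θ x := by
  have : (fun θ => rot θ x) = fun θ => !₂[x 0 * Real.cos θ - x 1 * Real.sin θ,
      x 0 * Real.sin θ + x 1 * Real.cos θ] := by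
    ext θ i
    fin_cases i
    · exact rot_apply_zero θ x
    · exact rot_apply_one θ x
  rw [this]
  refine (PiLp.continuous_toLp 2 _).comp (continuous_pi fun i => ?_)
  fin_cases i <;> simp <;> fun_prop

/-- In position space rotation acts on a merely integrable function; on the Fourier side the angle
enters only through `𝓕 f (rot θ ξ)`, which is continuous and bounded as `f` is integrable, so
dominated convergence applies. -/
theorem continuous_angForm (hκ : 0 < κ) (hf : MemLp f 2 volume) (hf1 : Integrable f) :
    Continuous (angForm κ f) := by
  set g : L2 := (hf.ofReal (K := ℂ)).toLp with hg
  set fC : Plane → ℂ := fun x => (f x : ℂ) with hfC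
  have hfC1 : Integrable fC := hf1.ofReal
  have key : ∀ θ, (angForm κ f θ : ℂ) =
      ∫ ξ, (symbol κ ξ : ℂ) * (𝓕 fC (rot θ ξ) * starRingEnd ℂ (fourierL2 g ξ)) := by
    intro θ
    have hfr := memLp_comp_isometry hf (rot θ)
    have hfr1 := integrable_comp_isometry hf1 (rot θ)
    rw [angForm, kernForm_comm, ← inner_freeRes_ofReal hκ hf hfr hf1 hfr1, inner_freeRes_eq]
    refine integral_congr_ae ?_
    have h1 := (hfr.ofReal (K := ℂ)).coeFn_toLp
    have h2 := fourierL2_ae_eq _ (hfr1.ofReal.congr h1.symm)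
    filter_upwards [h2] with ξ hξ
    rw [hξ]
    congr 2
    rw [← Real.fourier_comp_linearIsometry (rot θ) fC ξ, Real.fourier_eq, Real.fourier_eq]
    refine integral_congr_ae ?_
    filter_upwards [h1] with x hx
    rw [hx]
    rfl
  have hcont : Continuous fun θ => ∫ ξ, (symbol κ ξ : ℂ) *
      (𝓕 fC (rot θ ξ) * starRingEnd ℂ (fourierL2 g ξ)) := by
    have hcF := continuous_fourier_plane hfC1
    refine continuous_of_dominated
      (bound := fun ξ => (∫ x, ‖fC x‖) * ‖(symbol κ ξ : ℂ) * fourierL2 g ξ‖) (fun θ => ?_)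
      (fun θ => .of_forall fun ξ => ?_) ?_ (.of_forall fun ξ => ?_)
    · have hs := continuous_symbol hκ
      exact Continuous.aestronglyMeasurable (by fun_prop) |>.mul
        ((hcF.comp (rot θ).continuous).aestronglyMeasurable.mul
          (Complex.continuous_conj.comp_aestronglyMeasurable (Lp.aestronglyMeasurable _)))
    · rw [norm_mul, norm_mul, norm_mul, RCLike.norm_conj]
      have := norm_fourier_le_integral fC (rot θ ξ)
      calc _ ≤ ‖(symbol κ ξ : ℂ)‖ * ((∫ x, ‖fC x‖) * ‖fourierL2 g ξ‖) := by gcongr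
        _ = _ := by ring
    · have hm : MemLp (fun ξ => (symbol κ ξ : ℂ)) 2 volume := (memLp_symbol hκ).ofReal
      exact ((memLp_one_iff_integrable.1 ((Lp.memLp (fourierL2 g)).mul hm (r := 1))).norm).const_mul _
    · exact continuous_const.mul ((hcF.comp (continuous_rot_apply ξ)).mul continuous_const)
  have : angForm κ f = fun θ => (∫ ξ, (symbol κ ξ : ℂ) *
      (𝓕 fC (rot θ ξ) * starRingEnd ℂ (fourierL2 g ξ))).re := by
    ext θ
    rw [← key, Complex.ofReal_re]
  rw [this]
  exact Complex.continuous_re.comp hcont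

theorem strictConvexOn_angForm (hR : 0 < R) (hκ : 0 < κ) (hf2 : MemLp f 2 volume)
    (hf1 : Integrable f) (hf : ∀ x ∉ ball (polarPoint R 0) ρ, f x = 0) (hfm : f ∘ mirror = f)
    (hf0 : ∀ᵐ x, 0 ≤ f x) (hfne : ¬ f =ᵐ[volume] 0) {a : ℝ} (ha : 0 ≤ a)
    (hsin : ∀ β ∈ Ioo a (Real.pi - a), ρ < R * Real.sin β) :
    StrictConvexOn ℝ (Icc (2 * a) (2 * Real.pi - 2 * a)) (angForm κ f) := by
  refine strictConvexOn_Icc_of_Ioo ?_ (continuous_angForm hκ hf2 hf1)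
  have hrep : ∀ θ ∈ Ioo (2 * a) (2 * Real.pi - 2 * a),
      Integrable (fun p => Real.exp (-(2 * Real.pi * p * θ)) *
        ((4 * Real.pi)⁻¹ * ‖amplitude κ f p‖ ^ 2)) ∧
      angForm κ f θ = ∫ p, Real.exp (-(2 * Real.pi * p * θ)) *
        ((4 * Real.pi)⁻¹ * ‖amplitude κ f p‖ ^ 2) := by
    intro θ hθ
    obtain ⟨h1, h2⟩ := angForm_eq_integral hR hκ hf hf1 hfm (θ := θ) (by linarith [hθ.1])
      (by linarith [hθ.2]) (hsin _ ⟨by linarith [hθ.1], by linarith [hθ.2]⟩)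
    constructor
    · refine (h1.const_mul (4 * Real.pi)⁻¹).congr (.of_forall fun p => ?_)
      simp only
      ring
    · rw [h2, ← integral_const_mul]
      congr with p
      ring
  -- The open interval is empty when `a ≥ π/2`; this occurs for two disks with `ρ = R`.
  rcases (Ioo (2 * a) (2 * Real.pi - 2 * a)).eq_empty_or_nonempty with he | ⟨θ, hθ⟩
  · rw [he]
    exact ⟨convex_empty, fun x hx => absurd hx (notMem_empty x)⟩
  · refine (strictConvexOn_integral_exp (fun p => by positivity) ?_ (convex_Ioo _ _)
      fun θ hθ => (hrep θ hθ).1).congr fun θ hθ => ((hrep θ hθ).2).symm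
    -- An amplitude vanishing almost everywhere would make the interaction zero, but it is positive
    -- because the kernel is positive and `f` is nonnegative and nontrivial.
    intro h0
    have hpos : 0 < angForm κ f θ := kernForm_pos hκ hf2 (memLp_comp_isometry hf2 _) hf1
      (integrable_comp_isometry hf1 _) hf0 (ae_comp_isometry hf0 _) hfne
      (not_ae_comp_isometry hfne _)
    rw [(hrep θ hθ).2, integral_eq_zero_of_ae] at hpos
    · exact lt_irrefl _ hpos
    · filter_upwards [h0] with p hp
      rw [hp]
      simp

end

/-! ### Angles of circle arrays -/

theorem norm_polarPoint {R : ℝ} (hR : 0 ≤ R) (θ : ℝ) : ‖polarPoint R θ‖ = R := by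
  have h : ‖polarPoint R θ‖ ^ 2 = R ^ 2 := by
    rw [plane_norm_sq]
    simp only [polarPoint, PiLp.toLp_apply, Matrix.cons_val_zero, Matrix.cons_val_one,
      Matrix.cons_val_fin_one]
    linear_combination R ^ 2 * Real.sin_sq_add_cos_sq θ
  exact (pow_left_inj₀ (norm_nonneg _) hR two_ne_zero).1 h

theorem dist_polarPoint {R : ℝ} (hR : 0 ≤ R) (θ φ : ℝ) :
    dist (polarPoint R θ) (polarPoint R φ) = 2 * R * |Real.sin ((θ - φ) / 2)| := by
  have h : ‖polarPoint R θ - polarPoint R φ‖ ^ 2 = (2 * R * |Real.sin ((θ - φ) / 2)|) ^ 2 := by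
    rw [plane_norm_sq, mul_pow, sq_abs]
    simp only [polarPoint, PiLp.sub_apply, Matrix.cons_val_zero,
      Matrix.cons_val_one, Matrix.cons_val_fin_one, ← mul_sub, Real.cos_sub_cos, Real.sin_sub_sin]
    linear_combination 4 * R ^ 2 * Real.sin ((θ - φ) / 2) ^ 2 *
      Real.sin_sq_add_cos_sq ((θ + φ) / 2)
  rw [dist_eq_norm]
  exact (pow_left_inj₀ (norm_nonneg _) (by positivity) two_ne_zero).1 h

theorem polarPoint_add_int (R θ : ℝ) (k : ℤ) :
    polarPoint R (θ + 2 * Real.pi * k) = polarPoint R θ := by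
  rw [add_comm, ← rot_polarPoint, rot_two_pi_mul_int]

theorem exists_polarPoint_eq {R : ℝ} {y : Plane} (hy : ‖y‖ = R) :
    polarPoint R (toC y).arg = y := by
  have h : ‖toC y‖ = R := by rw [LinearIsometryEquiv.norm_map, hy]
  apply plane_ext
  · simp [polarPoint, ← h, Complex.norm_mul_cos_arg, toC_apply]
  · simp [polarPoint, ← h, Complex.norm_mul_sin_arg, toC_apply]

/-- `θ` lists the polar angles of the points of `Y` in increasing order, going around the circle
of radius `R` indefinitely. -/
structure IsAngleSeq (N : ℕ) (R : ℝ) (Y : Finset Plane) (θ : ℕ → ℝ) : Prop where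
  add_period : ∀ n, θ (n + N) = θ n + 2 * Real.pi
  strictMono : StrictMono θ
  image_eq : (Finset.range N).image (fun n => polarPoint R (θ n)) = Y

namespace IsAngleSeq

variable {N : ℕ} {R ρ : ℝ} {Y : Finset Plane} {θ : ℕ → ℝ}

theorem sub_lt (h : IsAngleSeq N R Y θ) {m n : ℕ} (hmn : n < m + N) :
    θ n - θ m < 2 * Real.pi := by
  have := h.strictMono hmn
  rw [h.add_period] at this
  linarith

theorem mem (h : IsAngleSeq N R Y θ) (hN : 0 < N) (n : ℕ) : polarPoint R (θ n) ∈ Y := by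
  induction n using Nat.strong_induction_on with
  | _ n ih =>
    rcases lt_or_ge n N with hn | hn
    · rw [← h.image_eq]
      exact Finset.mem_image_of_mem _ (Finset.mem_range.2 hn)
    · obtain ⟨m, rfl⟩ := Nat.exists_eq_add_of_le' hn
      have h1 := polarPoint_add_int R (θ m) 1
      rw [h.add_period]
      simp only [Int.cast_one, mul_one] at h1
      rw [h1]
      exact ih m (by omega)

theorem dist_eq (h : IsAngleSeq N R Y θ) (hR : 0 ≤ R) {m n : ℕ} (h1 : m < n) (h2 : n < m + N) :
    dist (polarPoint R (θ n)) (polarPoint R (θ m)) = 2 * R * Real.sin ((θ n - θ m) / 2) ∧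
      0 < Real.sin ((θ n - θ m) / 2) := by
  have h3 := h.strictMono h1
  have h4 := h.sub_lt h2
  have h5 : 0 < Real.sin ((θ n - θ m) / 2) :=
    Real.sin_pos_of_pos_of_lt_pi (by linarith) (by linarith)
  rw [dist_polarPoint hR, abs_of_pos h5]
  exact ⟨rfl, h5⟩

theorem ne (h : IsAngleSeq N R Y θ) (hR : 0 < R) {m n : ℕ} (h1 : m < n) (h2 : n < m + N) :
    polarPoint R (θ n) ≠ polarPoint R (θ m) := by
  obtain ⟨h3, h4⟩ := h.dist_eq hR.le h1 h2
  rw [← dist_pos, h3]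
  positivity

theorem injOn (h : IsAngleSeq N R Y θ) (hR : 0 < R) :
    InjOn (fun n => polarPoint R (θ n)) (Finset.range N) := by
  intro m hm n hn hmn
  simp only [Finset.coe_range, mem_Iio] at hm hn
  rcases lt_trichotomy m n with h1 | h1 | h1
  · exact absurd hmn.symm (h.ne hR h1 (by omega))
  · exact h1
  · exact absurd hmn (h.ne hR h1 (by omega))

theorem le_mul_sin (h : IsAngleSeq N R Y θ) (hR : 0 < R) (hY : IsCircleArray N R ρ Y) {m n : ℕ}
    (h1 : m < n) (h2 : n < m + N) : ρ ≤ R * Real.sin ((θ n - θ m) / 2) := by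
  have h3 := hY.two_mul_le_dist _ (h.mem (by omega) n) _ (h.mem (by omega) m) (h.ne hR h1 h2)
  rw [(h.dist_eq hR.le h1 h2).1] at h3
  linarith

/-- The chord condition `sin a ≤ sin (t / 2)` on `0 < t < 2π` means `a ≤ t / 2 ≤ π - a`. It holds
for every pair of distinct points, so Jensen's inequality is available for all neighbours and not
only the nearest. -/
theorem sub_mem_Icc (h : IsAngleSeq N R Y θ) (hR : 0 < R) (hY : IsCircleArray N R ρ Y)
    {a : ℝ} (ha : a ≤ Real.pi / 2) (ha' : R * Real.sin a = ρ) {m n : ℕ}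
    (h1 : m < n) (h2 : n < m + N) : θ n - θ m ∈ Icc (2 * a) (2 * Real.pi - 2 * a) := by
  have h3 := h.le_mul_sin hR hY h1 h2
  have h4 := h.strictMono h1
  have h5 := h.sub_lt h2
  rw [← ha'] at h3
  have h6 : Real.sin a ≤ Real.sin ((θ n - θ m) / 2) := le_of_mul_le_mul_left h3 hR
  constructor
  · by_contra! hlt
    have := Real.sin_lt_sin_of_lt_of_le_pi_div_two (x := (θ n - θ m) / 2) (y := a)
      (by linarith [Real.pi_pos]) ha (by linarith)
    linarith
  · by_contra! hlt
    have := Real.sin_lt_sin_of_lt_of_le_pi_div_two (x := Real.pi - (θ n - θ m) / 2) (y := a)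
      (by linarith [Real.pi_pos]) ha (by linarith)
    rw [Real.sin_pi_sub] at this
    linarith

/-- Each unit increase of the step `k` adds a telescoping sum over one full turn. -/
theorem sum_sub (h : IsAngleSeq N R Y θ) (k : ℕ) :
    ∑ i ∈ Finset.range N, (θ (i + k) - θ i) = 2 * Real.pi * k := by
  induction k with
  | zero => simp
  | succ k ih =>
    have h1 : ∑ i ∈ Finset.range N, (θ (i + 1 + k) - θ (i + k)) = 2 * Real.pi := by
      rw [Finset.sum_range_sub (fun i => θ (i + k)), zero_add, add_comm N k, h.add_period]
      ring
    have h2 : ∀ i ∈ Finset.range N, θ (i + (k + 1)) - θ i =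
        (θ (i + 1 + k) - θ (i + k)) + (θ (i + k) - θ i) := by
      intro i _
      rw [show i + (k + 1) = i + 1 + k by ring]
      ring
    rw [Finset.sum_congr rfl h2, Finset.sum_add_distrib, h1, ih]
    push_cast
    ring

end IsAngleSeq

theorem exists_isAngleSeq {N : ℕ} (hN : 0 < N) {R ρ : ℝ} {Y : Finset Plane}
    (hY : IsCircleArray N R ρ Y) : ∃ θ, IsAngleSeq N R Y θ := by
  have hinj : InjOn (fun y : Plane => (toC y).arg) Y := by
    intro y hy z hz hyz
    rw [← exists_polarPoint_eq (hY.norm_eq y hy), ← exists_polarPoint_eq (hY.norm_eq z hz)]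
    exact congrArg _ hyz
  set A := Y.image fun y => (toC y).arg with hA
  have hcard : A.card = N := by rw [hA, Finset.card_image_of_injOn hinj, hY.card_eq]
  set o := A.orderEmbOfFin hcard with ho
  have homem : ∀ i, o i ∈ Ioc (-Real.pi) Real.pi := by
    intro i
    obtain ⟨y, _, hy⟩ := Finset.mem_image.1 (A.orderEmbOfFin_mem hcard i)
    rw [ho, ← hy]
    exact Complex.arg_mem_Ioc _
  set θ : ℕ → ℝ := fun n => o ⟨n % N, Nat.mod_lt _ hN⟩ + 2 * Real.pi * (n / N : ℕ) with hθ
  have hθlt : ∀ n (hn : n < N), θ n = o ⟨n, hn⟩ := by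
    intro n hn
    simp only [hθ, Nat.mod_eq_of_lt hn, Nat.div_eq_of_lt hn]
    simp
  have hper : ∀ n, θ (n + N) = θ n + 2 * Real.pi := by
    intro n
    simp only [hθ, Nat.add_mod_right, Nat.add_div_right n hN]
    push_cast
    ring
  refine ⟨θ, hper, strictMono_nat_of_lt_succ fun n => ?_, ?_⟩
  · induction n using Nat.strong_induction_on with
    | _ n ih =>
      rcases lt_or_ge n N with hn | hn
      · rcases lt_or_ge (n + 1) N with hn' | hn'
        · rw [hθlt n hn, hθlt _ hn']
          exact o.strictMono (Fin.mk_lt_mk.2 (Nat.lt_succ_self n))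
        -- From the last point of a turn to the first of the next: all arguments lie in `(-π, π]`,
        -- so adding `2π` to the smallest exceeds the largest.
        · obtain rfl : n + 1 = N := by omega
          have h1 := hper 0
          rw [zero_add] at h1
          rw [h1, hθlt n hn, hθlt 0 hN]
          have := (homem ⟨n, hn⟩).2
          have := (homem ⟨0, hN⟩).1
          linarith
      · obtain ⟨m, rfl⟩ := Nat.exists_eq_add_of_le' hn
        rw [show m + N + 1 = m + 1 + N by ring, hper, hper]
        have := ih m (by omega)
        linarith
  · ext y
    simp only [Finset.mem_image, Finset.mem_range]
    constructor
    · rintro ⟨n, hn, rfl⟩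
      obtain ⟨z, hz, hz'⟩ := Finset.mem_image.1 (A.orderEmbOfFin_mem hcard ⟨n, hn⟩)
      rw [hθlt n hn, ho, ← hz', exists_polarPoint_eq (hY.norm_eq z hz)]
      exact hz
    · intro hy
      have h1 : (toC y).arg ∈ A := Finset.mem_image_of_mem _ hy
      have h2 : (toC y).arg ∈ Set.range o := by
        rw [ho, Finset.range_orderEmbOfFin]
        exact h1
      obtain ⟨⟨n, hn⟩, h3⟩ := h2
      exact ⟨n, hn, by rw [hθlt n hn, h3, exists_polarPoint_eq (hY.norm_eq y hy)]⟩

/-! ### Equiangular configurations -/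

theorem isAngleSeq_of_equiangular {N : ℕ} (hN : 0 < N) {R α : ℝ} {Y : Finset Plane}
    (hY : (Y : Set Plane) = Set.range fun k : Fin N =>
      polarPoint R (α + 2 * Real.pi * (k : ℕ) / N)) :
    IsAngleSeq N R Y fun n => α + 2 * Real.pi * n / N := by
  have hN' : (0 : ℝ) < N := Nat.cast_pos.2 hN
  refine ⟨fun n => ?_, strictMono_nat_of_lt_succ fun n => ?_, ?_⟩
  · push_cast
    field_simp
    ring
  · have := Real.pi_pos
    push_cast
    gcongr
    linarith
  · ext y
    rw [← Finset.mem_coe (s := Y), hY]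
    simp only [Finset.mem_image, Finset.mem_range, Set.mem_range]
    exact ⟨fun ⟨n, hn, h⟩ => ⟨⟨n, hn⟩, h⟩, fun ⟨n, h⟩ => ⟨n, n.2, h⟩⟩

theorem exists_isEquiangular (N : ℕ) (R : ℝ) : ∃ Y, IsEquiangular N R Y :=
  ⟨Finset.univ.image fun k : Fin N => polarPoint R (0 + 2 * Real.pi * (k : ℕ) / N), 0, by simp⟩

theorem IsEquiangular.isCircleArray {N : ℕ} (hN : 2 ≤ N) {R ρ : ℝ} (hR : 0 < R)
    (hρR : ρ ≤ R * Real.sin (Real.pi / N)) {Y : Finset Plane} (hY : IsEquiangular N R Y) :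
    IsCircleArray N R ρ Y := by
  obtain ⟨α, hα⟩ := hY
  have hN' : (2 : ℝ) ≤ N := by exact_mod_cast hN
  have hθ := isAngleSeq_of_equiangular (by omega) hα
  have hlow : ∀ {m n : ℕ}, m < n → n < m + N →
      2 * ρ ≤ dist (polarPoint R (α + 2 * Real.pi * n / N))
        (polarPoint R (α + 2 * Real.pi * m / N)) := by
    intro m n h1 h2
    rw [(hθ.dist_eq hR.le h1 h2).1, mul_assoc]
    gcongr
    refine hρR.trans ?_
    gcongr
    have e : (α + 2 * Real.pi * n / N - (α + 2 * Real.pi * m / N)) / 2 =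
        Real.pi / N * (n - m) := by
      field_simp
      ring
    rw [e]
    have h3 : (m : ℝ) + 1 ≤ n := by exact_mod_cast h1
    have h4 : (n : ℝ) + 1 ≤ m + N := by exact_mod_cast h2
    have hpN : 0 < Real.pi / N := by
      have := Real.pi_pos
      positivity
    have hpN2 : Real.pi / N * N = Real.pi := by field_simp
    rcases le_total (Real.pi / N * (n - m)) (Real.pi / 2) with h5 | h5
    · exact Real.sin_le_sin_of_le_of_le_pi_div_two (by linarith [Real.pi_pos]) h5 (by nlinarith)
    · rw [← Real.sin_pi_sub (Real.pi / N * (n - m))]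
      exact Real.sin_le_sin_of_le_of_le_pi_div_two (by linarith [Real.pi_pos]) (by linarith)
        (by nlinarith)
  refine ⟨?_, ?_, ?_⟩
  · rw [← hθ.image_eq, Finset.card_image_of_injOn (hθ.injOn hR), Finset.card_range]
  · intro y hy
    rw [← hθ.image_eq] at hy
    obtain ⟨n, _, rfl⟩ := Finset.mem_image.1 hy
    exact norm_polarPoint hR.le _
  · intro y hy z hz hyz
    rw [← hθ.image_eq] at hy hz
    obtain ⟨n, hn, rfl⟩ := Finset.mem_image.1 hy
    obtain ⟨m, hm, rfl⟩ := Finset.mem_image.1 hz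
    rw [Finset.mem_range] at hn hm
    rcases lt_trichotomy m n with h | h | h
    · exact hlow h (by omega)
    · exact absurd (by rw [h]) hyz
    · rw [dist_comm]
      exact hlow h (by omega)

/-! ### Jensen's inequality for the angular distances -/

theorem sum_range_add_of_periodic {N : ℕ} {h : ℕ → ℝ} (hper : ∀ n, h (n + N) = h n) (i : ℕ) :
    ∑ k ∈ Finset.range N, h (i + k) = ∑ k ∈ Finset.range N, h k := by
  induction i with
  | zero => simp
  | succ i ih =>
    rw [← ih]
    have h1 := Finset.sum_range_succ' (fun k => h (i + k)) N
    rw [Finset.sum_range_succ, hper i, add_zero] at h1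
    have h2 := add_right_cancel h1
    rw [h2]
    exact Finset.sum_congr rfl fun k _ => by rw [add_assoc, add_comm 1 k]

section Jensen

variable {N : ℕ} {R ρ : ℝ} {Y : Finset Plane} {θ : ℕ → ℝ} {F : ℝ → ℝ}

/-- Pairs are regrouped by the number `k` of steps between them around the circle, so that all
arguments with `k > 0` fall in one period, where convexity is known. -/
theorem sum_sum_eq (hθ : IsAngleSeq N R Y θ) (hF : ∀ t, F (t + 2 * Real.pi) = F t) :
    ∑ i ∈ Finset.range N, ∑ j ∈ Finset.range N, F (θ j - θ i) =
      ∑ k ∈ Finset.range N, ∑ i ∈ Finset.range N, F (θ (i + k) - θ i) := by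
  rw [Finset.sum_comm (s := Finset.range N) (t := Finset.range N)
    (f := fun k i => F (θ (i + k) - θ i))]
  refine Finset.sum_congr rfl fun i _ => ?_
  refine (sum_range_add_of_periodic (h := fun j => F (θ j - θ i)) (fun n => ?_) i).symm
  rw [hθ.add_period, ← hF (θ n - θ i)]
  congr 1
  ring

theorem mul_le_sum_angle (hR : 0 < R) (hθ : IsAngleSeq N R Y θ) (hY : IsCircleArray N R ρ Y)
    {a : ℝ} (ha : a ≤ Real.pi / 2) (ha' : R * Real.sin a = ρ)
    (hF : StrictConvexOn ℝ (Icc (2 * a) (2 * Real.pi - 2 * a)) F) {k : ℕ} (hk : k < N) :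
    N * F (2 * Real.pi * k / N) ≤ ∑ i ∈ Finset.range N, F (θ (i + k) - θ i) := by
  -- For `k = 0` the terms are self-interactions: equality holds, whereas the argument `0` need not
  -- lie in the interval of convexity.
  rcases Nat.eq_zero_or_pos k with rfl | hk0
  · simp
  have hN : (0 : ℝ) < N := Nat.cast_pos.2 (by omega)
  have h1 := hF.convexOn.map_sum_le (t := Finset.range N) (w := fun _ => (N : ℝ)⁻¹)
    (p := fun i => θ (i + k) - θ i) (fun _ _ => by positivity) (by simp [hN.ne'])
    (fun i _ => hθ.sub_mem_Icc hR hY ha ha' (by omega) (by omega))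
  simp only [smul_eq_mul, ← Finset.mul_sum] at h1
  rw [hθ.sum_sub, inv_mul_eq_div, inv_mul_eq_div, le_div_iff₀ hN] at h1
  linarith

/-- Strict Jensen applies as soon as two successive gaps differ; if all agree, each is `2π / N` and
the array is equiangular. -/
theorem mul_lt_sum_angle (hR : 0 < R) (hN2 : 2 ≤ N) (hθ : IsAngleSeq N R Y θ)
    (hY : IsCircleArray N R ρ Y)
    {a : ℝ} (ha : a ≤ Real.pi / 2) (ha' : R * Real.sin a = ρ)
    (hF : StrictConvexOn ℝ (Icc (2 * a) (2 * Real.pi - 2 * a)) F) (hne : ¬ IsEquiangular N R Y) :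
    N * F (2 * Real.pi * (1 : ℕ) / N) < ∑ i ∈ Finset.range N, F (θ (i + 1) - θ i) := by
  have hN : (0 : ℝ) < N := Nat.cast_pos.2 (by omega)
  have h0 : ∃ j ∈ Finset.range N, ∃ k ∈ Finset.range N, θ (j + 1) - θ j ≠ θ (k + 1) - θ k := by
    by_contra! hall
    apply hne
    have hgap : ∀ i < N, θ (i + 1) - θ i = 2 * Real.pi / N := by
      intro i hi
      have h1 := hθ.sum_sub 1
      rw [Finset.sum_congr rfl fun j hj => hall j hj i (Finset.mem_range.2 hi)] at h1
      simp only [Finset.sum_const, Finset.card_range, nsmul_eq_mul, Nat.cast_one, mul_one] at h1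
      rw [eq_div_iff hN.ne', mul_comm]
      exact h1
    have hθi : ∀ i ≤ N, θ i = θ 0 + 2 * Real.pi * i / N := by
      intro i
      induction i with
      | zero => simp
      | succ i ih =>
        intro hi
        have h1 := hgap i (by omega)
        have h2 := ih (by omega)
        push_cast
        have h3 : 2 * Real.pi * ((i : ℝ) + 1) / N = 2 * Real.pi * i / N + 2 * Real.pi / N := by
          ring
        linarith
    refine ⟨θ 0, ?_⟩
    ext y
    rw [Finset.mem_coe, ← hθ.image_eq]
    simp only [Finset.mem_image, Finset.mem_range, Set.mem_range]
    constructor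
    · rintro ⟨n, hn, rfl⟩
      exact ⟨⟨n, hn⟩, by rw [hθi n hn.le]⟩
    · rintro ⟨n, rfl⟩
      exact ⟨n, n.2, by rw [hθi n n.2.le]⟩
  have h1 := hF.map_sum_lt (t := Finset.range N) (w := fun _ => (N : ℝ)⁻¹)
    (p := fun i => θ (i + 1) - θ i) (fun _ _ => by positivity) (by simp [hN.ne'])
    (fun i _ => hθ.sub_mem_Icc hR hY ha ha' (by omega) (by omega)) h0
  simp only [smul_eq_mul, ← Finset.mul_sum] at h1
  rw [hθ.sum_sub, inv_mul_eq_div, inv_mul_eq_div, lt_div_iff₀ hN] at h1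
  linarith

end Jensen

/-! ### Symmetries of wells and arrays -/

theorem well_isometry (V : ℝ → ℝ) (ρ : ℝ) (e : Plane ≃ₗᵢ[ℝ] Plane) (y x : Plane) :
    well V ρ (e y) (e x) = well V ρ y x := by
  simp only [well, indicator, mem_ball, e.dist_map]

theorem arrayPotential_comp (V : ℝ → ℝ) (ρ : ℝ) {Y : Finset Plane} (e : Plane ≃ₗᵢ[ℝ] Plane)
    (he : ∀ y ∈ Y, e y ∈ Y) : arrayPotential V ρ Y ∘ e = arrayPotential V ρ Y := by
  have hY : Y.map e.toEquiv.toEmbedding = Y := by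
    refine Finset.eq_of_subset_of_card_le (fun z hz => ?_) (Finset.card_map _).ge
    obtain ⟨y, hy, rfl⟩ := Finset.mem_map.1 hz
    exact he y hy
  ext x
  rw [Function.comp_apply, arrayPotential_eq]
  nth_rw 1 [← hY]
  rw [Finset.sum_map, Finset.sum_apply, Finset.sum_apply]
  exact Finset.sum_congr rfl fun y _ => well_isometry V ρ e y x

theorem well_polarPoint (V : ℝ → ℝ) (R ρ θ : ℝ) :
    well V ρ (polarPoint R θ) = well V ρ (polarPoint R 0) ∘ rot (-θ) := by
  ext x
  have := well_isometry V ρ (rot (-θ)) (polarPoint R θ) x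
  rw [rot_polarPoint, neg_add_cancel] at this
  exact this.symm

theorem well_comp_mirror (V : ℝ → ℝ) (R ρ : ℝ) :
    well V ρ (polarPoint R 0) ∘ mirror = well V ρ (polarPoint R 0) := by
  ext x
  have := well_isometry V ρ mirror (polarPoint R 0) x
  rw [mirror_polarPoint, neg_zero] at this
  exact this

/-! ### Trial functions composed of rotated copies -/

/-- The superposition of the copies of `w`, restricted to the disk of radius `ρ` about `(R, 0)`,
rotated by the angles `θ 0, …, θ (N - 1)`. -/
def copies (N : ℕ) (R ρ : ℝ) (θ : ℕ → ℝ) (w : Plane → ℝ) : Plane → ℝ :=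
  ∑ i ∈ Finset.range N, (ball (polarPoint R 0) ρ).indicator w ∘ rot (-θ i)

section Copies

variable {N : ℕ} {R ρ : ℝ} {Y : Finset Plane} {θ : ℕ → ℝ} {V : ℝ → ℝ} {w : Plane → ℝ}

theorem memLp_copies (hw : MemLp w ∞ volume) : MemLp (copies N R ρ θ w) ∞ volume :=
  memLp_finsetSum' _ fun _ _ => memLp_comp_isometry (hw.indicator measurableSet_ball) _

theorem arrayPotential_eq_sum (hR : 0 < R) (hθ : IsAngleSeq N R Y θ) :
    arrayPotential V ρ Y = ∑ i ∈ Finset.range N, well V ρ (polarPoint R 0) ∘ rot (-θ i) := by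
  rw [arrayPotential_eq, ← hθ.image_eq, Finset.sum_image (hθ.injOn hR)]
  exact Finset.sum_congr rfl fun i _ => well_polarPoint V R ρ (θ i)

theorem rot_neg_mem_ball {x : Plane} {φ : ℝ} :
    rot (-φ) x ∈ ball (polarPoint R 0) ρ ↔ x ∈ ball (polarPoint R φ) ρ := by
  rw [mem_ball, mem_ball, ← (rot (-φ)).dist_map x, rot_polarPoint, neg_add_cancel]

theorem ball_unique (hR : 0 < R) (hθ : IsAngleSeq N R Y θ) (hY : IsCircleArray N R ρ Y) {i j : ℕ}
    (hi : i < N) (hj : j < N) {x : Plane} (h1 : rot (-θ i) x ∈ ball (polarPoint R 0) ρ)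
    (h2 : rot (-θ j) x ∈ ball (polarPoint R 0) ρ) : i = j := by
  rw [rot_neg_mem_ball, mem_ball] at h1 h2
  by_contra hij
  have hne : polarPoint R (θ i) ≠ polarPoint R (θ j) := fun h =>
    hij (hθ.injOn hR (by simpa using hi) (by simpa using hj) h)
  have h3 := hY.two_mul_le_dist _ (hθ.mem (by omega) i) _ (hθ.mem (by omega) j) hne
  have h4 := dist_triangle_left (polarPoint R (θ i)) (polarPoint R (θ j)) x
  linarith

theorem sum_eq_single_of_mem_ball (hR : 0 < R) (hθ : IsAngleSeq N R Y θ)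
    (hY : IsCircleArray N R ρ Y) {g : Plane → ℝ} (hg : ∀ x ∉ ball (polarPoint R 0) ρ, g x = 0)
    {i : ℕ} (hi : i < N) {x : Plane} (hx : rot (-θ i) x ∈ ball (polarPoint R 0) ρ) :
    (∑ j ∈ Finset.range N, g ∘ rot (-θ j)) x = g (rot (-θ i) x) := by
  rw [Finset.sum_apply]
  refine Finset.sum_eq_single_of_mem i (Finset.mem_range.2 hi) fun j hj hji => hg _ fun h => ?_
  exact hji (ball_unique hR hθ hY (Finset.mem_range.1 hj) hi h hx)

theorem sum_eq_zero_of_notMem_ball {g : Plane → ℝ} (hg : ∀ x ∉ ball (polarPoint R 0) ρ, g x = 0)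
    {x : Plane} (hx : ∀ i < N, rot (-θ i) x ∉ ball (polarPoint R 0) ρ) :
    (∑ j ∈ Finset.range N, g ∘ rot (-θ j)) x = 0 := by
  rw [Finset.sum_apply]
  exact Finset.sum_eq_zero fun j hj => hg _ (hx j (Finset.mem_range.1 hj))

theorem well_eq_zero {y x : Plane} (hx : x ∉ ball y ρ) : well V ρ y x = 0 :=
  indicator_of_notMem hx _

/-- The disks do not overlap, so at each point at most one summand of each factor survives and the
cross terms vanish. Power `1` gives the density in the kernel form, power `2` the potential term. -/
theorem arrayPotential_mul_pow_copies (hR : 0 < R) (hθ : IsAngleSeq N R Y θ)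
    (hY : IsCircleArray N R ρ Y) (k : ℕ) :
    arrayPotential V ρ Y * copies N R ρ θ w ^ k =
      ∑ i ∈ Finset.range N, (well V ρ (polarPoint R 0) * w ^ k) ∘ rot (-θ i) := by
  have hg1 : ∀ x ∉ ball (polarPoint R 0) ρ, well V ρ (polarPoint R 0) x = 0 :=
    fun x hx => well_eq_zero hx
  have hg2 : ∀ x ∉ ball (polarPoint R 0) ρ, (ball (polarPoint R 0) ρ).indicator w x = 0 :=
    fun x hx => indicator_of_notMem hx _
  have hg3 : ∀ x ∉ ball (polarPoint R 0) ρ, (well V ρ (polarPoint R 0) * w ^ k) x = 0 :=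
    fun x hx => by simp [well_eq_zero hx]
  rw [arrayPotential_eq_sum hR hθ]
  ext x
  by_cases hx : ∃ i < N, rot (-θ i) x ∈ ball (polarPoint R 0) ρ
  · obtain ⟨i, hi, hx⟩ := hx
    rw [Pi.mul_apply, Pi.pow_apply, copies, sum_eq_single_of_mem_ball hR hθ hY hg1 hi hx,
      sum_eq_single_of_mem_ball hR hθ hY hg2 hi hx, sum_eq_single_of_mem_ball hR hθ hY hg3 hi hx,
      indicator_of_mem hx]
    rfl
  · push Not at hx
    rw [Pi.mul_apply, sum_eq_zero_of_notMem_ball hg1 hx, sum_eq_zero_of_notMem_ball hg3 hx,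
      zero_mul]

theorem integral_sum_comp_rot {g : Plane → ℝ} (hg : Integrable g) :
    ∫ x, (∑ i ∈ Finset.range N, g ∘ rot (-θ i)) x = N * ∫ x, g x := by
  simp only [Finset.sum_apply, Function.comp_apply]
  have hi : ∀ i ∈ Finset.range N, Integrable fun x => g (rot (-θ i) x) := fun i _ =>
    integrable_comp_isometry hg (rot (-θ i))
  rw [integral_finsetSum _ hi]
  have : ∀ i ∈ Finset.range N, ∫ x, g (rot (-θ i) x) = ∫ x, g x := fun i _ =>
    (rot (-θ i)).measurePreserving.integral_comp
      (rot (-θ i)).toHomeomorph.measurableEmbedding _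
  rw [Finset.sum_congr rfl this]
  simp

theorem angForm_add_two_pi (κ : ℝ) (f : Plane → ℝ) (t : ℝ) :
    angForm κ f (t + 2 * Real.pi) = angForm κ f t := by
  have : ∀ x, rot (t + 2 * Real.pi) x = rot t x := fun x => by
    rw [← rot_rot]
    have := rot_two_pi_mul_int 1 x
    simp only [Int.cast_one, mul_one] at this
    rw [this]
  unfold angForm
  congr 1
  ext x
  simp [this]

theorem kernForm_rot (κ : ℝ) (f : Plane → ℝ) (s t : ℝ) :
    kernForm κ (f ∘ rot (-s)) (f ∘ rot (-t)) = angForm κ f (s - t) := by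
  rw [← kernForm_comp κ (rot s), angForm]
  congr 1
  · ext x
    simp [rot_rot, rot_zero]
  · ext x
    simp [rot_rot, neg_add_eq_sub]

theorem kernForm_sum_rot {κ : ℝ} (hκ : 0 < κ) {f : Plane → ℝ} (hf : MemLp f 2 volume)
    (hθ : IsAngleSeq N R Y θ) :
    kernForm κ (∑ i ∈ Finset.range N, f ∘ rot (-θ i)) (∑ i ∈ Finset.range N, f ∘ rot (-θ i)) =
      ∑ k ∈ Finset.range N, ∑ i ∈ Finset.range N, angForm κ f (θ (i + k) - θ i) := by
  rw [← sum_sum_eq hθ (angForm_add_two_pi κ f), kernForm_sum_right hκ _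
    (memLp_finsetSum' _ fun i _ => memLp_comp_isometry hf _)
    (fun i _ => memLp_comp_isometry hf _)]
  refine Finset.sum_congr rfl fun i _ => ?_
  rw [kernForm_sum_left hκ _ (fun i _ => memLp_comp_isometry hf _) (memLp_comp_isometry hf _)]
  exact Finset.sum_congr rfl fun j _ => kernForm_rot κ f _ _

end Copies

/-! ### Symmetrization of the ground state of an equiangular array -/

/-- The sum of `v` over the rotations by multiples of `2π / N`. -/
def rotSum (N : ℕ) (v : Plane → ℝ) : Plane → ℝ :=
  ∑ m ∈ Finset.range N, v ∘ rot (2 * Real.pi * m / N)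

theorem rotSum_periodic {N : ℕ} (hN : 0 < N) (v : Plane → ℝ) (x : Plane) (n : ℕ) :
    v (rot (2 * Real.pi * (n + N : ℕ) / N) x) = v (rot (2 * Real.pi * n / N) x) := by
  have hN' : (N : ℝ) ≠ 0 := Nat.cast_ne_zero.2 hN.ne'
  have h1 : 2 * Real.pi * (n + N : ℕ) / N = 2 * Real.pi * n / N + 2 * Real.pi * (1 : ℤ) := by
    push_cast
    field_simp
  rw [h1, ← rot_rot, rot_two_pi_mul_int]

theorem rotSum_rot {N : ℕ} (hN : 0 < N) (v : Plane → ℝ) (i : ℕ) (x : Plane) :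
    rotSum N v (rot (2 * Real.pi * i / N) x) = rotSum N v x := by
  simp only [rotSum, Finset.sum_apply, Function.comp_apply, rot_rot]
  rw [← sum_range_add_of_periodic (h := fun n : ℕ => v (rot (2 * Real.pi * n / N) x))
    (rotSum_periodic hN v x) i]
  refine Finset.sum_congr rfl fun m _ => ?_
  congr 2
  push_cast
  ring_nf

/-- The reflection conjugates each rotation to its inverse, sending index `m` to `N - m`. These
indices run over `1, …, N`, whence the final shift by one. -/
theorem rotSum_reflect {N : ℕ} (hN : 0 < N) {v : Plane → ℝ} {α : ℝ}
    (hv : ∀ x, v (rot (2 * α) (mirror x)) = v x) (x : Plane) :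
    rotSum N v (rot (2 * α) (mirror x)) = rotSum N v x := by
  have hN' : (N : ℝ) ≠ 0 := Nat.cast_ne_zero.2 hN.ne'
  have h1 : ∀ m ∈ Finset.range N, v (rot (2 * Real.pi * m / N) (rot (2 * α) (mirror x))) =
      (fun j : ℕ => v (rot (2 * Real.pi * (1 + j : ℕ) / N) x)) (N - 1 - m) := by
    intro m hm
    have hm' := Finset.mem_range.1 hm
    have h2 : rot (2 * Real.pi * m / N) (rot (2 * α) (mirror x)) =
        rot (2 * α) (mirror (rot (-(2 * Real.pi * m / N)) x)) := by
      rw [mirror_rot, rot_rot, rot_rot, neg_neg, add_comm]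
    have h3 : (2 * Real.pi * (1 + (N - 1 - m) : ℕ) / N) =
        -(2 * Real.pi * m / N) + 2 * Real.pi * (1 : ℤ) := by
      rw [show 1 + (N - 1 - m) = N - m by omega, Nat.cast_sub hm'.le]
      push_cast
      field_simp
      ring
    simp only
    rw [h2, hv, h3, ← rot_rot, rot_two_pi_mul_int]
  simp only [rotSum, Finset.sum_apply, Function.comp_apply]
  exact (Finset.sum_congr rfl h1).trans ((Finset.sum_range_reflect _ N).trans
    (sum_range_add_of_periodic (h := fun n : ℕ => v (rot (2 * Real.pi * n / N) x))
      (rotSum_periodic hN v x) 1))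

section Symmetrization

variable {N : ℕ} {R ρ α : ℝ} {Y : Finset Plane} {V : ℝ → ℝ}

theorem arrayPotential_comp_rot (hN : 0 < N)
    (hθ : IsAngleSeq N R Y fun n => α + 2 * Real.pi * n / N) (m : ℕ) :
    arrayPotential V ρ Y ∘ rot (2 * Real.pi * m / N) = arrayPotential V ρ Y := by
  refine arrayPotential_comp V ρ _ fun y hy => ?_
  rw [← hθ.image_eq] at hy
  obtain ⟨k, _, rfl⟩ := Finset.mem_image.1 hy
  rw [rot_polarPoint]
  convert hθ.mem hN (m + k) using 2
  push_cast
  ring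

theorem arrayPotential_comp_reflect (hN : 0 < N)
    (hθ : IsAngleSeq N R Y fun n => α + 2 * Real.pi * n / N) :
    arrayPotential V ρ Y ∘ (mirror.trans (rot (2 * α))) = arrayPotential V ρ Y := by
  have hN' : (N : ℝ) ≠ 0 := Nat.cast_ne_zero.2 hN.ne'
  refine arrayPotential_comp V ρ _ fun y hy => ?_
  rw [← hθ.image_eq] at hy
  obtain ⟨k, hk, rfl⟩ := Finset.mem_image.1 hy
  have hk' := Finset.mem_range.1 hk
  rw [LinearIsometryEquiv.trans_apply, mirror_polarPoint, rot_polarPoint,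
    ← polarPoint_add_int _ _ 1]
  convert hθ.mem hN (N - k) using 2
  rw [Nat.cast_sub hk'.le]
  push_cast
  field_simp
  ring

/-- An equiangular array has a ground state density which is composed of rotated copies of a
single reflection symmetric density. -/
theorem exists_symmetric_profile (hV : MemLp V 2 (volume.restrict (Ioo 0 ρ))) (hR : 0 < R)
    (hN : 0 < N) (hV0 : ∀ᵐ r ∂(volume.restrict (Ioo 0 ρ)), 0 ≤ V r) (hY : IsCircleArray N R ρ Y)
    (hθ : IsAngleSeq N R Y fun n => α + 2 * Real.pi * n / N) {κ : ℝ} (hκ : 0 < κ)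
    (hgr : groundEnergy hV Y = -κ ^ 2) :
    ∃ g : Plane → ℝ, MemLp g ∞ volume ∧ (∀ x, 0 ≤ g x) ∧ g ∘ mirror = g ∧
      ¬ well V ρ (polarPoint R 0) * g =ᵐ[volume] 0 ∧
      IsNullVector κ (arrayPotential V ρ Y)
        (copies N R ρ (fun n => α + 2 * Real.pi * n / N) g) := by
  set q := arrayPotential V ρ Y with hq
  have hq2 : MemLp q 2 volume := memLp_arrayPotential hV Y
  have hq1 : Integrable q := integrable_arrayPotential hV Y
  have hq0 : ∀ᵐ x, 0 ≤ q x := arrayPotential_nonneg hV0 Y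
  have heig := isEigenvalue_groundEnergy hV hY.norm_eq (by rw [hgr]; nlinarith)
  rw [hgr] at heig
  obtain ⟨u, hu, hu0, hune, hule⟩ := exists_integral_le_kernForm hq2 hq1 hq0 hκ heig
  have hform := (isLeast_groundEnergy hV Y).2
  rw [hgr] at hform
  have hle : ∀ w : Plane → ℝ, MemLp w ∞ volume →
      kernForm κ (q * w) (q * w) ≤ ∫ x, q x * w x ^ 2 := fun w hw =>
    kernForm_le_of_isLeast hq2 hq1 hq0 hκ hform hw
  have hun : IsNullVector κ q u := ⟨hu, le_antisymm (hle u hu) hule⟩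
  -- The reflection in the line at angle `α`, a symmetry of the array. All functions summed below
  -- are nonnegative, so nothing can cancel and the sum dominates `u`.
  set τ := mirror.trans (rot (2 * α)) with hτ
  set v := u + u ∘ τ with hv
  have hvn : IsNullVector κ q v := hun.add hq2 hq1 hκ hle
    (hun.comp τ (arrayPotential_comp_reflect hN hθ))
  have hvτ : ∀ x, v (rot (2 * α) (mirror x)) = v x := by
    intro x
    have : τ (rot (2 * α) (mirror x)) = x := by
      simp only [hτ, LinearIsometryEquiv.trans_apply, mirror_rot, mirror_mirror, rot_rot,
        add_neg_cancel, rot_zero]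
    simp only [hv, Pi.add_apply, Function.comp_apply, this]
    rw [add_comm]
    rfl
  set W := rotSum N v with hW
  have hWn : IsNullVector κ q W := IsNullVector.sum hq2 hq1 hκ hle _ fun m _ =>
    hvn.comp _ (arrayPotential_comp_rot hN hθ m)
  have hv0 : ∀ x, 0 ≤ v x := fun x => add_nonneg (hu0 x) (hu0 _)
  have huW : ∀ x, u x ≤ W x := by
    intro x
    have h1 : u x ≤ v x := le_add_of_nonneg_right (hu0 (τ x))
    have h2 : v x ≤ W x := by
      have := Finset.single_le_sum (f := fun m : ℕ => v (rot (2 * Real.pi * m / N) x))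
        (fun m _ => hv0 _) (Finset.mem_range.2 hN)
      simp only [Nat.cast_zero, mul_zero, zero_div, rot_zero] at this
      rw [hW, rotSum, Finset.sum_apply]
      exact this
    exact h1.trans h2
  -- Turns the disk at angle `α` to the one about `(R, 0)` and the symmetry line to the first axis.
  -- By rotation invariance every copy of `g` agrees with `W`, so `copies` reproduces `W` wherever
  -- `q` is nonzero.
  set g := W ∘ rot α with hg
  have hgrot : ∀ (i : ℕ) x, g (rot (-(α + 2 * Real.pi * i / N)) x) = W x := by
    intro i x
    have := rotSum_rot hN v i (rot (α + -(α + 2 * Real.pi * i / N)) x)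
    rw [rot_rot, show 2 * Real.pi * i / N + (α + -(α + 2 * Real.pi * i / N)) = 0 by ring,
      rot_zero] at this
    rw [hg, Function.comp_apply, rot_rot]
    exact this.symm
  have hcop : ∀ x, q x ≠ 0 → copies N R ρ (fun n => α + 2 * Real.pi * n / N) g x = W x := by
    intro x hx
    by_cases h : ∃ i < N, rot (-(α + 2 * Real.pi * i / N)) x ∈ ball (polarPoint R 0) ρ
    · obtain ⟨i, hi, h⟩ := h
      rw [copies, sum_eq_single_of_mem_ball hR hθ hY (fun x hx => indicator_of_notMem hx _) hi h,
        indicator_of_mem h, hgrot]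
    · push Not at h
      refine absurd ?_ hx
      rw [hq, arrayPotential_eq_sum hR hθ]
      exact sum_eq_zero_of_notMem_ball (fun x hx => well_eq_zero hx) h
  have hcop1 : q * copies N R ρ (fun n => α + 2 * Real.pi * n / N) g = q * W := by
    ext x
    by_cases hx : q x = 0
    · simp [hx]
    · simp [hcop x hx]
  have hgm : MemLp g ∞ volume := memLp_comp_isometry hWn.1 _
  refine ⟨g, hgm, fun x => (hu0 _).trans (huW _), ?_, ?_, memLp_copies hgm, ?_⟩
  · ext x
    have := rotSum_reflect hN hvτ (rot α x)
    rw [mirror_rot, rot_rot, two_mul, add_neg_cancel_right] at this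
    exact this
  -- If the profile vanished on the model disk, all its copies would, so `q W = 0` and then `0 ≤ q u
  -- ≤ q W` would force `q u = 0`.
  · intro h0
    apply hune
    have h1 := arrayPotential_mul_pow_copies (V := V) (w := g) hR hθ hY 1
    rw [pow_one, pow_one, ← hq, hcop1] at h1
    have h2 : q * W =ᵐ[volume] 0 := by
      rw [h1]
      have : ∀ᵐ x, ∀ i ∈ Finset.range N, (well V ρ (polarPoint R 0) * g)
          (rot (-(α + 2 * Real.pi * i / N)) x) = 0 :=
        (Filter.eventually_all_finset _).2 fun i _ => ae_comp_isometry h0 _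
      filter_upwards [this] with x hx
      rw [Finset.sum_apply]
      exact Finset.sum_eq_zero hx
    filter_upwards [h2, hq0] with x h3 h4
    refine le_antisymm ?_ (mul_nonneg h4 (hu0 x))
    refine (mul_le_mul_of_nonneg_left (huW x) h4).trans h3.le
  · rw [hcop1, hWn.2]
    congr with x
    by_cases hx : q x = 0
    · simp [hx]
    · rw [hcop x hx]

end Symmetrization

/-! ### Comparison with the equiangular configuration -/

theorem groundEnergy_le_and_lt {N : ℕ} (hN : 2 ≤ N) {R ρ : ℝ} (hR : 0 < R) (hρ : 0 < ρ)
    (hρR : ρ ≤ R * Real.sin (Real.pi / N)) {V : ℝ → ℝ}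
    (hV : MemLp V 2 (volume.restrict (Ioo 0 ρ)))
    (hV0 : ∀ᵐ r ∂(volume.restrict (Ioo 0 ρ)), 0 ≤ V r)
    (hV_ne : ¬ ∀ᵐ r ∂(volume.restrict (Ioo 0 ρ)), V r = 0) {Y Y₀ : Finset Plane}
    (hY : IsCircleArray N R ρ Y) (hY₀ : IsEquiangular N R Y₀) :
    groundEnergy hV Y ≤ groundEnergy hV Y₀ ∧
      (¬ IsEquiangular N R Y → groundEnergy hV Y < groundEnergy hV Y₀) := by
  have hN0 : 0 < N := by omega
  have hN' : (N : ℝ) ≠ 0 := Nat.cast_ne_zero.2 hN0.ne'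
  have hY₀c := hY₀.isCircleArray hN hR hρR
  obtain ⟨α, hα⟩ := hY₀
  have hθ₀ := isAngleSeq_of_equiangular hN0 hα
  obtain ⟨θ, hθ⟩ := exists_isAngleSeq hN0 hY
  have hneg : groundEnergy hV Y₀ < 0 := groundEnergy_neg hV hR hρ
    ⟨_, hθ₀.mem hN0 0⟩ hY₀c.norm_eq hV0 hV_ne
  set κ := √(-groundEnergy hV Y₀) with hκdef
  have hκ : 0 < κ := Real.sqrt_pos.2 (by linarith)
  have hgr : groundEnergy hV Y₀ = -κ ^ 2 := by
    rw [hκdef, Real.sq_sqrt (by linarith), neg_neg]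
  obtain ⟨g, hg, hg0, hgm, hgne, hnull⟩ := exists_symmetric_profile hV hR hN0 hV0 hY₀c hθ₀ hκ hgr
  set W := well V ρ (polarPoint R 0) with hW
  have hW2 : MemLp W 2 volume := memLp_well hV _
  have hW1 : Integrable W := integrable_well hV _
  set f := W * g with hf
  have hf2 : MemLp f 2 volume := MemLp.mul_bounded hW2 hg
  have hf1 : Integrable f := integrable_mul_bounded hW1 hg
  have hf0 : ∀ᵐ x, 0 ≤ f x := by
    filter_upwards [well_nonneg hV0 (polarPoint R 0)] with x hx
    exact mul_nonneg hx (hg0 x)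
  have hfs : ∀ x ∉ ball (polarPoint R 0) ρ, f x = 0 := fun x hx => by
    simp [hf, hW, well_eq_zero hx]
  have hfm : f ∘ mirror = f := by
    rw [hf]
    nth_rw 2 [← hgm]
    rw [hW]
    nth_rw 2 [← well_comp_mirror]
    rfl
  have hρR1 : ρ / R ≤ 1 := by
    rw [div_le_one hR]
    exact hρR.trans (mul_le_of_le_one_right hR.le (Real.sin_le_one _))
  -- Two disks whose centres have angular distance `2a` touch, since their chord is `2R sin a = 2ρ`.
  set a := Real.arcsin (ρ / R) with ha
  have hρR0 : 0 < ρ / R := div_pos hρ hR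
  have hsin : Real.sin a = ρ / R := Real.sin_arcsin (by linarith) hρR1
  have hRsin : R * Real.sin a = ρ := by
    rw [hsin]
    field_simp
  have ha2 : a ≤ Real.pi / 2 := Real.arcsin_le_pi_div_two _
  have ha0 : 0 ≤ a := Real.arcsin_nonneg.2 hρR0.le
  have hF : StrictConvexOn ℝ (Icc (2 * a) (2 * Real.pi - 2 * a)) (angForm κ f) := by
    refine strictConvexOn_angForm hR hκ hf2 hf1 hfs hfm hf0 hgne ha0 fun β hβ => ?_
    rw [← hRsin]
    refine mul_lt_mul_of_pos_left ?_ hR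
    rcases le_total β (Real.pi / 2) with h | h
    · exact Real.sin_lt_sin_of_lt_of_le_pi_div_two (by linarith [Real.pi_pos]) h hβ.1
    · rw [← Real.sin_pi_sub β]
      exact Real.sin_lt_sin_of_lt_of_le_pi_div_two (by linarith [Real.pi_pos]) (by linarith)
        (by linarith [hβ.2])
  have hWg2 : Integrable (W * g ^ 2) := by
    have := integrable_mul_bounded hf1 hg
    rwa [hf, mul_assoc, ← sq] at this
  have hpot : ∀ {Z : Finset Plane} {φ : ℕ → ℝ}, IsAngleSeq N R Z φ → IsCircleArray N R ρ Z →
      ∫ x, arrayPotential V ρ Z x * copies N R ρ φ g x ^ 2 = N * ∫ x, (W * g ^ 2) x := by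
    intro Z φ hφ hZ
    rw [← integral_sum_comp_rot (θ := φ) hWg2, ← arrayPotential_mul_pow_copies hR hφ hZ]
    rfl
  have hdens : ∀ {Z : Finset Plane} {φ : ℕ → ℝ}, IsAngleSeq N R Z φ → IsCircleArray N R ρ Z →
      arrayPotential V ρ Z * copies N R ρ φ g = ∑ i ∈ Finset.range N, f ∘ rot (-φ i) := by
    intro Z φ hφ hZ
    have := arrayPotential_mul_pow_copies (V := V) (w := g) hR hφ hZ 1
    rwa [pow_one, pow_one] at this
  -- The optimality equation of the equiangular array, with all `k`-th neighbours at the same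
  -- angular distance; its right side is the common potential term of every admissible array.
  have heq : ∑ k ∈ Finset.range N, N * angForm κ f (2 * Real.pi * k / N) =
      N * ∫ x, (W * g ^ 2) x := by
    rw [← hpot hθ₀ hY₀c, ← hnull.2, hdens hθ₀ hY₀c, kernForm_sum_rot hκ hf2 hθ₀]
    refine Finset.sum_congr rfl fun k _ => ?_
    have : ∀ i ∈ Finset.range N, angForm κ f (α + 2 * Real.pi * (i + k : ℕ) / N -
        (α + 2 * Real.pi * i / N)) = angForm κ f (2 * Real.pi * k / N) := by
      intro i _
      congr 1
      push_cast
      ring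
    rw [Finset.sum_congr rfl this]
    simp
  have hsum_le : ∀ k ∈ Finset.range N, N * angForm κ f (2 * Real.pi * k / N) ≤
      ∑ i ∈ Finset.range N, angForm κ f (θ (i + k) - θ i) := fun k hk =>
    mul_le_sum_angle hR hθ hY ha2 hRsin hF (Finset.mem_range.1 hk)
  have hcm : MemLp (copies N R ρ θ g) ∞ volume := memLp_copies hg
  rw [hgr]
  constructor
  · refine groundEnergy_le hV hV0 hκ hcm ?_ ?_
    · rw [hdens hθ hY]
      intro h0
      apply not_ae_comp_isometry hgne (rot (-θ 0))
      have hall : ∀ᵐ x, ∀ i ∈ Finset.range N, 0 ≤ f (rot (-θ i) x) :=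
        (Filter.eventually_all_finset _).2 fun i _ => ae_comp_isometry hf0 _
      filter_upwards [h0, hall] with x h1 h2
      rw [Finset.sum_apply] at h1
      have h3 := (Finset.sum_eq_zero_iff_of_nonneg (fun i hi => h2 i hi)).1 h1
      exact h3 0 (Finset.mem_range.2 hN0)
    · rw [hpot hθ hY, hdens hθ hY, kernForm_sum_rot hκ hf2 hθ, ← heq]
      exact Finset.sum_le_sum hsum_le
  · intro hne
    refine groundEnergy_lt hV hV0 hκ hcm ?_
    rw [hpot hθ hY, hdens hθ hY, kernForm_sum_rot hκ hf2 hθ, ← heq]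
    -- Nearest neighbours, `k = 1`, suffice for strictness; the index occurs in the sum because `N ≥
    -- 2`.
    exact Finset.sum_lt_sum hsum_le ⟨1, Finset.mem_range.2 (by omega),
      mul_lt_sum_angle hR hN hθ hY ha2 hRsin hF hne⟩

end WellArray

end

/-! ### The main theorem. -/

theorem theorem5p1 (N : ℕ) (hN : 2 ≤ N) (R ρ : ℝ) (hR : 0 < R) (hρ : 0 < ρ)
    (hρR : ρ ≤ R * Real.sin (Real.pi / N)) (V : ℝ → ℝ)
    (hV : MeasureTheory.MemLp V 2 (MeasureTheory.volume.restrict (Set.Ioo 0 ρ)))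
    (hV_nonneg : ∀ᵐ r ∂(MeasureTheory.volume.restrict (Set.Ioo 0 ρ)), 0 ≤ V r)
    (hV_ne : ¬ ∀ᵐ r ∂(MeasureTheory.volume.restrict (Set.Ioo 0 ρ)), V r = 0) :
    -- the ground state energy is a negative eigenvalue and the minimum of the spectrum
    (∀ Y, WellArray.IsCircleArray N R ρ Y →
      IsLeast (WellArray.realSpectrum (WellArray.hamiltonian hV Y)) (WellArray.groundEnergy hV Y) ∧
      WellArray.IsEigenvalue (WellArray.hamiltonian hV Y) (WellArray.groundEnergy hV Y) ∧
      WellArray.groundEnergy hV Y < 0) ∧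
    -- the equiangular configurations exist and are admissible
    (∃ Y, WellArray.IsEquiangular N R Y) ∧
    (∀ Y, WellArray.IsEquiangular N R Y → WellArray.IsCircleArray N R ρ Y) ∧
    -- the maximizers are exactly the equiangular configurations
    (∀ Y, WellArray.IsCircleArray N R ρ Y →
      ((∀ Y', WellArray.IsCircleArray N R ρ Y' →
          WellArray.groundEnergy hV Y' ≤ WellArray.groundEnergy hV Y) ↔
        WellArray.IsEquiangular N R Y)) := by
  refine ⟨fun Y hY => ?_, WellArray.exists_isEquiangular N R,
    fun Y hY => hY.isCircleArray hN hR hρR, fun Y hY => ⟨fun hmax => ?_, fun hYe Y' hY' => ?_⟩⟩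
  · have hne : Y.Nonempty := Finset.card_pos.1 (by rw [hY.card_eq]; omega)
    have hneg := WellArray.groundEnergy_neg hV hR hρ hne hY.norm_eq hV_nonneg hV_ne
    exact ⟨(WellArray.isLeast_groundEnergy hV Y).1,
      WellArray.isEigenvalue_groundEnergy hV hY.norm_eq hneg, hneg⟩
  · by_contra hne
    obtain ⟨Y₀, hY₀⟩ := WellArray.exists_isEquiangular N R
    have h1 := (WellArray.groundEnergy_le_and_lt hN hR hρ hρR hV hV_nonneg hV_ne hY hY₀).2 hne
    exact absurd (hmax Y₀ (hY₀.isCircleArray hN hR hρR)) (not_le.2 h1)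
  · exact (WellArray.groundEnergy_le_and_lt hN hR hρ hρR hV hV_nonneg hV_ne hY' hYe).1
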